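/- **Notation.** Let $e_1,\dots,e_7$ be seven symbols and write $\bar e_i=-e_i$. A signed permutation is a permutation of $\{\pm e_1,\dots,\pm e_7\}$ that commutes with $x\mapsto -x$; cycles are written up to this symmetry (so $(e_1\,\bar e_5)$ means $e_1\mapsto -e_5$, $e_5\mapsto -e_1$), symbols not mentioned are fixed, and in a product the right factor acts first. Let - $\alpha=(e_1e_2e_4e_3e_6e_5e_7)$, $\beta=(e_2e_4e_6)(e_3e_7e_5)$; - $N_1$: $e_i\mapsto -e_i$ for $i=4,5,6,7$, and $e_i\mapsto e_i$ otherwise; $N_7$: $e_i\mapsto -e_i$ for $i=1,3,5,7$, and $e_i\mapsto e_i$ otherwise; - $\gamma$: $e_1\mapsto -e_4$, $e_4\mapsto -e_1$, $e_2\mapsto -e_5$, $e_5\mapsto -e_2$, $e_3\mapsto -e_3$, $e_7\mapsto -e_7$, $e_6\mapsto e_6$; - $\theta$: $e_1\mapsto -e_5$, $e_5\mapsto -e_1$, $e_2\mapsto -e_3$, $e_3\mapsto -e_4$, $e_4\mapsto -e_7$, $e_7\mapsto e_2$, $e_6\mapsto -e_6$; - $A$: $e_1\mapsto -e_7$, $e_7\mapsto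 -e_3$, $e_3\mapsto -e_1$, $e_2\mapsto -e_4$, $e_4\mapsto -e_6$, $e_6\mapsto e_2$, $e_5\mapsto -e_5$; - $B$: $e_2\mapsto -e_6$, $e_6\mapsto e_2$, $e_3\mapsto -e_5$, $e_5\mapsto e_3$, and $e_1,e_4,e_7$ fixed; - $\tilde\beta=(e_3e_2e_1)(e_4e_6e_5)$, $\tilde\gamma=(e_1e_5)(e_3e_7)$, $\tilde\theta=(e_1e_4e_2e_5)(e_6e_7)$, $\tilde A=(e_1e_6e_2)(e_3e_5e_4)$, $\tilde B=(e_1e_3)(e_4e_6)$; - $\delta$: $e_1\mapsto -e_5$, $e_5\mapsto -e_1$, $e_3\leftrightarrow e_7$, $e_2\mapsto -e_2$, $e_4\mapsto -e_4$, $e_6\mapsto e_6$. The groups considered, with the names by which they are known (in which a dot and a colon indicate a non-split and a split extension), are - $7{:}3=\langle\alpha,\beta\rangle$ and $2^3{:}7{:}3=\langle\alpha,\beta,N_1\rangle$; - the two groups of order 1344, $2^3.PSL_2(7)=\langle\alpha,\beta,\gamma,N_1\rangle$ and $2^3{:}PSL_2(7)=\langle\alpha,\tilde\beta,\tilde\gamma,N_1\rangle$;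 - $4.S_4{:}2=\langle\gamma,\theta\rangle$, $4{:}S_4{:}2=\langle\tilde A,\tilde B,N_1\rangle$, $2^3.S_4=\langle A,B\rangle$, $2^3{:}S_4=\langle\tilde\gamma,\tilde\theta,N_1\rangle$; - $P=\langle\alpha,\tilde\beta,\tilde\gamma\rangle$ and $P'=\langle\alpha,\tilde\beta,\delta\rangle$, two copies of $PSL_2(7)$ in $2^3{:}PSL_2(7)$. Representations are finite-dimensional and complex, an equality of representations is an isomorphism, $+$ is the direct sum and $m(X)$ is the sum of $m$ copies of $X$. Let $\mu=\frac12(-1+i\sqrt3)$ and $\eta=\frac12(-1+i\sqrt7)$. **Labels.** For each group we list elements $c_1,c_2,\dots$ and, for each label, a row of numbers. The theorem asserts that every element of the group is conjugate to exactly one $c_j$; that for each label there is an irreducible representation whose character takes the listed values at $c_1,c_2,\dots$; and that every irreducible representation is isomorphic to that of exactly one label. - $7{:}3$; elements $1, \beta, \beta^2, \alpha, \alpha^3$; rows $1$: $(1, 1, 1, 1, 1)$; $1_1$: $(1, \mu, \bar\mu, 1, 1)$; $1_2$: $(1, \bar\mu, \mu, 1, 1)$; $3_1$: $(3, 0, 0,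 \eta, \bar\eta)$; $3_2$: $(3, 0, 0, \bar\eta, \eta)$. - $2^3{:}7{:}3$; elements $1, N_1, \beta^2, \beta, \beta^2\,N_7, \beta\,N_7, \alpha, \alpha^3$; rows $1$: $(1, 1, 1, 1, 1, 1, 1, 1)$; $1_1$: $(1, 1, \bar\mu, \mu, \bar\mu, \mu, 1, 1)$; $1_2$: $(1, 1, \mu, \bar\mu, \mu, \bar\mu, 1, 1)$; $3_1$: $(3, 3, 0, 0, 0, 0, \eta, \bar\eta)$; $3_2$: $(3, 3, 0, 0, 0, 0, \bar\eta, \eta)$; $7_1$: $(7, -1, 1, 1, -1, -1, 0, 0)$; $7_2$: $(7, -1, \mu, \bar\mu, -\mu, -\bar\mu, 0, 0)$; $7_3$: $(7, -1, \bar\mu, \mu, -\bar\mu, -\mu, 0, 0)$. - $PSL_2(7)$; elements for $P$: $1, \tilde\gamma, \tilde\beta, \alpha^2\,\tilde\gamma, \alpha, \alpha^3$; elements for $P'$: $1, \delta, \tilde\beta, \alpha^2\,\delta, \alpha, \alpha^3$; rows $1$: $(1, 1, 1, 1, 1, 1)$; $3_1$: $(3, -1, 0, 1, \eta, \bar\eta)$;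 $3_2$: $(3, -1, 0, 1, \bar\eta, \eta)$; $6$: $(6, 2, 0, 0, -1, -1)$; $7$: $(7, -1, 1, -1, 0, 0)$; $8$: $(8, 0, -1, 0, 1, 1)$. - Groups of order 1344; elements for $2^3.PSL_2(7)$: $1, N_1, \gamma, \beta, \gamma\,N_1, \alpha\,\gamma\,\alpha\,N_1\,\beta, \alpha\,\beta\,\gamma, \alpha, \alpha^3, \alpha^2\,\gamma\,N_1, \alpha^2\,\gamma$; elements for $2^3{:}PSL_2(7)$: $1, N_1, \tilde\gamma\,N_1, \tilde\beta, \delta, \tilde\gamma, \tilde\beta\,N_1, \alpha, \alpha^3, \alpha^2\,\tilde\gamma, \alpha^2\,\delta$; rows $1$: $(1, 1, 1, 1, 1, 1, 1, 1, 1, 1, 1)$; $3_1$: $(3, 3, -1, 0, -1, -1, 0, \eta, \bar\eta, 1, 1)$; $3_2$: $(3, 3, -1, 0, -1, -1, 0, \bar\eta, \eta, 1, 1)$; $6$: $(6, 6, 2, 0, 2, 2, 0, -1, -1, 0, 0)$; $7_1$: $(7, -1, -1, 1, -1, 3, -1, 0, 0, 1, -1)$; $7_2$: $(7, 7, -1,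 1, -1, -1, 1, 0, 0, -1, -1)$; $7_3$: $(7, -1, -1, 1, 3, -1, -1, 0, 0, -1, 1)$; $8$: $(8, 8, 0, -1, 0, 0, -1, 1, 1, 0, 0)$; $14$: $(14, -2, -2, -1, 2, 2, 1, 0, 0, 0, 0)$; $21_1$: $(21, -3, 1, 0, -3, 1, 0, 0, 0, -1, 1)$; $21_2$: $(21, -3, 1, 0, 1, -3, 0, 0, 0, 1, -1)$. - $4.S_4{:}2$ and $4{:}S_4{:}2$; elements for $4.S_4{:}2$: $1, \theta^4, (\gamma\,\theta)^3, \gamma, \gamma\,\theta^2\,\gamma\,\theta^3, (\gamma\,\theta)^2\,\gamma\,\theta^3, (\gamma\,\theta)^2, \gamma\,\theta^4, \theta^2, (\gamma\,\theta^2)^2, (\gamma\,\theta)^2\,\theta, \gamma\,\theta, \gamma\,\theta^2, \theta$; elements for $4{:}S_4{:}2$: $1, \tilde A^2\,N_1\,\tilde A\,N_1, N_1, \tilde A^2\,\tilde B\,N_1\,\tilde A\,N_1, \tilde A^2\,\tilde B\,\tilde A\,N_1, (\tilde A\,\tilde B)^2\,N_1, \tilde A, \tilde B, (\tilde A\,\tilde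 B)^2, (\tilde A\,\tilde B\,N_1)^2, \tilde B\,N_1, \tilde A\,N_1, \tilde A\,\tilde B, \tilde A\,\tilde B\,N_1$; rows $1$: $(1, 1, 1, 1, 1, 1, 1, 1, 1, 1, 1, 1, 1, 1)$; $1_1$: $(1, 1, -1, 1, -1, -1, 1, 1, 1, 1, -1, -1, 1, -1)$; $1_2$: $(1, 1, -1, -1, 1, -1, 1, -1, 1, 1, 1, -1, -1, 1)$; $1_3$: $(1, 1, 1, -1, -1, 1, 1, -1, 1, 1, -1, 1, -1, -1)$; $2_1$: $(2, 2, -2, 0, 0, -2, -1, 0, 2, 2, 0, 1, 0, 0)$; $2_2$: $(2, 2, 2, 0, 0, 2, -1, 0, 2, 2, 0, -1, 0, 0)$; $3_1$: $(3, 3, 3, -1, -1, -1, 0, -1, -1, -1, -1, 0, 1, 1)$; $3_2$: $(3, 3, 3, 1, 1, -1, 0, 1, -1, -1, 1, 0, -1, -1)$; $3_3$: $(3, 3, -3, 1, -1, 1, 0, 1, -1, -1, -1, 0, -1, 1)$; $3_4$: $(3, 3, -3, -1, 1, 1, 0, -1, -1, -1, 1, 0, 1, -1)$; $6_1$: $(6,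 -2, 0, 0, -2, 0, 0, 0, -2, 2, 2, 0, 0, 0)$; $6_2$: $(6, -2, 0, 0, 2, 0, 0, 0, -2, 2, -2, 0, 0, 0)$; $6_3$: $(6, -2, 0, -2, 0, 0, 0, 2, 2, -2, 0, 0, 0, 0)$; $6_4$: $(6, -2, 0, 2, 0, 0, 0, -2, 2, -2, 0, 0, 0, 0)$. - $2^3.S_4$ and $2^3{:}S_4$; elements for $2^3.S_4$: $1, A^3, B^2, A\,B\,A\,B^3, A^2\,B\,A\,B^2, A^2, (A^2\,B)^2, (A\,B)^2, A^3\,B, B, A, A\,B, A^2\,B$; elements for $2^3{:}S_4$: $1, \tilde\theta^3\,N_1\,\tilde\theta\,N_1, N_1, \tilde\gamma\,\tilde\theta^2\,\tilde\gamma\,N_1, \tilde\gamma\,N_1, \tilde\gamma\,\tilde\theta, \tilde\theta^2\,N_1, \tilde\theta^2, \tilde\gamma\,\tilde\theta^2\,\tilde\gamma\,N_1\,\tilde\theta, \tilde\gamma, \tilde\gamma\,\tilde\theta\,N_1, \tilde\gamma\,\tilde\theta\,\tilde\gamma\,N_1, \tilde\theta$; rows $1$: $(1, 1, 1, 1, 1,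 1, 1, 1, 1, 1, 1, 1, 1)$; $1_1$: $(1, 1, 1, 1, -1, 1, 1, 1, -1, -1, 1, -1, -1)$; $2$: $(2, 2, 2, 2, 0, -1, 2, 2, 0, 0, -1, 0, 0)$; $3_1$: $(3, 3, -1, -1, -1, 0, -1, 3, 1, 1, 0, -1, 1)$; $3_2$: $(3, 3, -1, -1, 1, 0, 3, -1, -1, -1, 0, -1, 1)$; $3_3$: $(3, 3, -1, -1, 1, 0, -1, 3, -1, -1, 0, 1, -1)$; $3_4$: $(3, 3, -1, -1, -1, 0, 3, -1, 1, 1, 0, 1, -1)$; $3_5$: $(3, 3, 3, -1, 1, 0, -1, -1, 1, 1, 0, -1, -1)$; $3_6$: $(3, 3, 3, -1, -1, 0, -1, -1, -1, -1, 0, 1, 1)$; $4_1$: $(4, -4, 0, 0, 0, 1, 0, 0, -2, 2, -1, 0, 0)$; $4_2$: $(4, -4, 0, 0, 0, 1, 0, 0, 2, -2, -1, 0, 0)$; $6$: $(6, 6, -2, 2, 0, 0, -2, -2, 0, 0, 0, 0, 0)$; $8$: $(8, -8, 0, 0, 0, -1, 0, 0, 0, 0, 1, 0, 0)$. **Theorem.**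 With these labels, the irreducible representations are as just described, and the following hold. **A. Tensor products.** In each group $1\otimes X=X$, the products $X\otimes Y$ and $Y\otimes X$ are isomorphic, and the remaining products are as follows. *(A1) $2^3{:}7{:}3$.* $1_1\otimes 1_1=1_2$; $1_1\otimes 1_2=1$; $1_1\otimes 3_1=3_1$; $1_1\otimes 3_2=3_2$; $1_1\otimes 7_1=7_3$; $1_1\otimes 7_2=7_1$; $1_1\otimes 7_3=7_2$. $1_2\otimes 1_2=1_1$; $1_2\otimes 3_1=3_1$; $1_2\otimes 3_2=3_2$; $1_2\otimes 7_1=7_2$; $1_2\otimes 7_2=7_3$; $1_2\otimes 7_3=7_1$. $3_1\otimes 3_1=3_1+2(3_2)$; $3_1\otimes 3_2=1+1_1+1_2+3_1+3_2$; $3_1\otimes 7_1=7_1+7_2+7_3$; $3_1\otimes 7_2=7_1+7_2+7_3$; $3_1\otimes 7_3=7_1+7_2+7_3$. $3_2\otimes 3_2=2(3_1)+3_2$; $3_2\otimes 7_1=7_1+7_2+7_3$; $3_2\otimes 7_2=7_1+7_2+7_3$; $3_2\otimes 7_3=7_1+7_2+7_3$. $7_1\otimes 7_1=1+3_1+3_2+2(7_1)+2(7_2)+2(7_3)$;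 $7_1\otimes 7_2=1_2+3_1+3_2+2(7_1)+2(7_2)+2(7_3)$; $7_1\otimes 7_3=1_1+3_1+3_2+2(7_1)+2(7_2)+2(7_3)$. $7_2\otimes 7_2=1_1+3_1+3_2+2(7_1)+2(7_2)+2(7_3)$; $7_2\otimes 7_3=1+3_1+3_2+2(7_1)+2(7_2)+2(7_3)$. $7_3\otimes 7_3=1_2+3_1+3_2+2(7_1)+2(7_2)+2(7_3)$. *(A2) $2^3.PSL_2(7)$ and $2^3{:}PSL_2(7)$ (the same table for both groups).* $3_1\otimes 3_1=3_2+6$; $3_1\otimes 3_2=1+8$; $3_1\otimes 6=3_2+7_2+8$; $3_1\otimes 7_1=21_2$; $3_1\otimes 7_2=6+7_2+8$; $3_1\otimes 7_3=21_1$; $3_1\otimes 8=3_1+6+7_2+8$; $3_1\otimes 14=21_1+21_2$; $3_1\otimes 21_1=7_3+14+21_1+21_2$; $3_1\otimes 21_2=7_1+14+21_1+21_2$. $3_2\otimes 3_2=3_1+6$; $3_2\otimes 6=3_1+7_2+8$; $3_2\otimes 7_1=21_2$; $3_2\otimes 7_2=6+7_2+8$; $3_2\otimes 7_3=21_1$;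 $3_2\otimes 8=3_2+6+7_2+8$; $3_2\otimes 14=21_1+21_2$; $3_2\otimes 21_1=7_3+14+21_1+21_2$; $3_2\otimes 21_2=7_1+14+21_1+21_2$. $6\otimes 6=1+2(6)+7_2+2(8)$; $6\otimes 7_1=7_1+14+21_1$; $6\otimes 7_2=3_1+3_2+6+2(7_2)+2(8)$; $6\otimes 7_3=7_3+14+21_2$; $6\otimes 8=3_1+3_2+2(6)+2(7_2)+2(8)$; $6\otimes 14=7_1+7_3+2(14)+21_1+21_2$; $6\otimes 21_1=7_1+14+3(21_1)+2(21_2)$; $6\otimes 21_2=7_3+14+2(21_1)+3(21_2)$. $7_1\otimes 7_1=1+6+7_1+14+21_1$; $7_1\otimes 7_2=7_3+21_1+21_2$; $7_1\otimes 7_3=7_2+21_1+21_2$; $7_1\otimes 8=14+21_1+21_2$; $7_1\otimes 14=6+7_1+8+14+2(21_1)+21_2$; $7_1\otimes 21_1=6+7_1+7_2+7_3+8+2(14)+2(21_1)+2(21_2)$; $7_1\otimes 21_2=3_1+3_2+7_2+7_3+8+14+2(21_1)+3(21_2)$. $7_2\otimes 7_2=1+3_1+3_2+2(6)+2(7_2)+2(8)$;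 $7_2\otimes 7_3=7_1+21_1+21_2$; $7_2\otimes 8=3_1+3_2+2(6)+2(7_2)+3(8)$; $7_2\otimes 14=14+2(21_1)+2(21_2)$; $7_2\otimes 21_1=7_1+7_3+2(14)+2(21_1)+3(21_2)$; $7_2\otimes 21_2=7_1+7_3+2(14)+3(21_1)+2(21_2)$. $7_3\otimes 7_3=1+6+7_3+14+21_2$; $7_3\otimes 8=14+21_1+21_2$; $7_3\otimes 14=6+7_3+8+14+21_1+2(21_2)$; $7_3\otimes 21_1=3_1+3_2+7_1+7_2+8+14+3(21_1)+2(21_2)$; $7_3\otimes 21_2=6+7_1+7_2+7_3+8+2(14)+2(21_1)+2(21_2)$. $8\otimes 8=1+3_1+3_2+2(6)+3(7_2)+3(8)$; $8\otimes 14=7_1+7_3+14+2(21_1)+2(21_2)$; $8\otimes 21_1=7_1+7_3+2(14)+3(21_1)+3(21_2)$; $8\otimes 21_2=7_1+7_3+2(14)+3(21_1)+3(21_2)$. $14\otimes 14=1+2(6)+7_1+7_2+7_3+8+2(14)+3(21_1)+3(21_2)$; $14\otimes 21_1=3_1+3_2+6+2(7_1)+2(7_2)+7_3+2(8)+3(14)+5(21_1)+4(21_2)$;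 $14\otimes 21_2=3_1+3_2+6+7_1+2(7_2)+2(7_3)+2(8)+3(14)+4(21_1)+5(21_2)$. $21_1\otimes 21_1=1+3_1+3_2+3(6)+2(7_1)+2(7_2)+3(7_3)+3(8)+5(14)+6(21_1)+7(21_2)$; $21_1\otimes 21_2=3_1+3_2+2(6)+2(7_1)+3(7_2)+2(7_3)+3(8)+4(14)+7(21_1)+7(21_2)$. $21_2\otimes 21_2=1+3_1+3_2+3(6)+3(7_1)+2(7_2)+2(7_3)+3(8)+5(14)+7(21_1)+6(21_2)$. *(A3) $4.S_4{:}2$ and $4{:}S_4{:}2$ (the same table for both groups).* $1_1\otimes 1_1=1$; $1_1\otimes 1_2=1_3$; $1_1\otimes 1_3=1_2$; $1_1\otimes 2_1=2_2$; $1_1\otimes 2_2=2_1$; $1_1\otimes 3_1=3_4$; $1_1\otimes 3_2=3_3$; $1_1\otimes 3_3=3_2$; $1_1\otimes 3_4=3_1$; $1_1\otimes 6_1=6_2$; $1_1\otimes 6_2=6_1$; $1_1\otimes 6_3=6_3$; $1_1\otimes 6_4=6_4$. $1_2\otimes 1_2=1$; $1_2\otimes 1_3=1_1$; $1_2\otimes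 2_1=2_2$; $1_2\otimes 2_2=2_1$; $1_2\otimes 3_1=3_3$; $1_2\otimes 3_2=3_4$; $1_2\otimes 3_3=3_1$; $1_2\otimes 3_4=3_2$; $1_2\otimes 6_1=6_1$; $1_2\otimes 6_2=6_2$; $1_2\otimes 6_3=6_4$; $1_2\otimes 6_4=6_3$. $1_3\otimes 1_3=1$; $1_3\otimes 2_1=2_1$; $1_3\otimes 2_2=2_2$; $1_3\otimes 3_1=3_2$; $1_3\otimes 3_2=3_1$; $1_3\otimes 3_3=3_4$; $1_3\otimes 3_4=3_3$; $1_3\otimes 6_1=6_2$; $1_3\otimes 6_2=6_1$; $1_3\otimes 6_3=6_4$; $1_3\otimes 6_4=6_3$. $2_1\otimes 2_1=1+1_3+2_2$; $2_1\otimes 2_2=1_1+1_2+2_1$; $2_1\otimes 3_1=3_3+3_4$; $2_1\otimes 3_2=3_3+3_4$; $2_1\otimes 3_3=3_1+3_2$; $2_1\otimes 3_4=3_1+3_2$; $2_1\otimes 6_1=6_1+6_2$; $2_1\otimes 6_2=6_1+6_2$; $2_1\otimes 6_3=6_3+6_4$; $2_1\otimes 6_4=6_3+6_4$. $2_2\otimes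 2_2=1+1_3+2_2$; $2_2\otimes 3_1=3_1+3_2$; $2_2\otimes 3_2=3_1+3_2$; $2_2\otimes 3_3=3_3+3_4$; $2_2\otimes 3_4=3_3+3_4$; $2_2\otimes 6_1=6_1+6_2$; $2_2\otimes 6_2=6_1+6_2$; $2_2\otimes 6_3=6_3+6_4$; $2_2\otimes 6_4=6_3+6_4$. $3_1\otimes 3_1=1+2_2+3_1+3_2$; $3_1\otimes 3_2=1_3+2_2+3_1+3_2$; $3_1\otimes 3_3=1_2+2_1+3_3+3_4$; $3_1\otimes 3_4=1_1+2_1+3_3+3_4$; $3_1\otimes 6_1=6_2+6_3+6_4$; $3_1\otimes 6_2=6_1+6_3+6_4$; $3_1\otimes 6_3=6_1+6_2+6_4$; $3_1\otimes 6_4=6_1+6_2+6_3$. $3_2\otimes 3_2=1+2_2+3_1+3_2$; $3_2\otimes 3_3=1_1+2_1+3_3+3_4$; $3_2\otimes 3_4=1_2+2_1+3_3+3_4$; $3_2\otimes 6_1=6_1+6_3+6_4$; $3_2\otimes 6_2=6_2+6_3+6_4$; $3_2\otimes 6_3=6_1+6_2+6_3$; $3_2\otimes 6_4=6_1+6_2+6_4$.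 $3_3\otimes 3_3=1+2_2+3_1+3_2$; $3_3\otimes 3_4=1_3+2_2+3_1+3_2$; $3_3\otimes 6_1=6_2+6_3+6_4$; $3_3\otimes 6_2=6_1+6_3+6_4$; $3_3\otimes 6_3=6_1+6_2+6_3$; $3_3\otimes 6_4=6_1+6_2+6_4$. $3_4\otimes 3_4=1+2_2+3_1+3_2$; $3_4\otimes 6_1=6_1+6_3+6_4$; $3_4\otimes 6_2=6_2+6_3+6_4$; $3_4\otimes 6_3=6_1+6_2+6_4$; $3_4\otimes 6_4=6_1+6_2+6_3$. $6_1\otimes 6_1=1+1_2+2_1+2_2+3_2+3_4+6_1+6_2+6_3+6_4$; $6_1\otimes 6_2=1_1+1_3+2_1+2_2+3_1+3_3+6_1+6_2+6_3+6_4$; $6_1\otimes 6_3=3_1+3_2+3_3+3_4+6_1+6_2+6_3+6_4$; $6_1\otimes 6_4=3_1+3_2+3_3+3_4+6_1+6_2+6_3+6_4$. $6_2\otimes 6_2=1+1_2+2_1+2_2+3_2+3_4+6_1+6_2+6_3+6_4$; $6_2\otimes 6_3=3_1+3_2+3_3+3_4+6_1+6_2+6_3+6_4$; $6_2\otimes 6_4=3_1+3_2+3_3+3_4+6_1+6_2+6_3+6_4$.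 $6_3\otimes 6_3=1+1_1+2_1+2_2+3_2+3_3+6_1+6_2+6_3+6_4$; $6_3\otimes 6_4=1_2+1_3+2_1+2_2+3_1+3_4+6_1+6_2+6_3+6_4$. $6_4\otimes 6_4=1+1_1+2_1+2_2+3_2+3_3+6_1+6_2+6_3+6_4$. *(A4) $2^3.S_4$ and $2^3{:}S_4$ (the same table for both groups).* $1_1\otimes 1_1=1$; $1_1\otimes 2=2$; $1_1\otimes 3_1=3_3$; $1_1\otimes 3_2=3_4$; $1_1\otimes 3_3=3_1$; $1_1\otimes 3_4=3_2$; $1_1\otimes 3_5=3_6$; $1_1\otimes 3_6=3_5$; $1_1\otimes 4_1=4_2$; $1_1\otimes 4_2=4_1$; $1_1\otimes 6=6$; $1_1\otimes 8=8$. $2\otimes 2=1+1_1+2$; $2\otimes 3_1=3_1+3_3$; $2\otimes 3_2=3_2+3_4$; $2\otimes 3_3=3_1+3_3$; $2\otimes 3_4=3_2+3_4$; $2\otimes 3_5=3_5+3_6$; $2\otimes 3_6=3_5+3_6$; $2\otimes 4_1=8$; $2\otimes 4_2=8$; $2\otimes 6=2(6)$; $2\otimes 8=4_1+4_2+8$.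 $3_1\otimes 3_1=1+2+3_1+3_3$; $3_1\otimes 3_2=3_6+6$; $3_1\otimes 3_3=1_1+2+3_1+3_3$; $3_1\otimes 3_4=3_5+6$; $3_1\otimes 3_5=3_4+6$; $3_1\otimes 3_6=3_2+6$; $3_1\otimes 4_1=4_1+8$; $3_1\otimes 4_2=4_2+8$; $3_1\otimes 6=3_2+3_4+3_5+3_6+6$; $3_1\otimes 8=4_1+4_2+2(8)$. $3_2\otimes 3_2=1+2+3_2+3_4$; $3_2\otimes 3_3=3_5+6$; $3_2\otimes 3_4=1_1+2+3_2+3_4$; $3_2\otimes 3_5=3_3+6$; $3_2\otimes 3_6=3_1+6$; $3_2\otimes 4_1=4_2+8$; $3_2\otimes 4_2=4_1+8$; $3_2\otimes 6=3_1+3_3+3_5+3_6+6$; $3_2\otimes 8=4_1+4_2+2(8)$. $3_3\otimes 3_3=1+2+3_1+3_3$; $3_3\otimes 3_4=3_6+6$; $3_3\otimes 3_5=3_2+6$; $3_3\otimes 3_6=3_4+6$; $3_3\otimes 4_1=4_2+8$; $3_3\otimes 4_2=4_1+8$; $3_3\otimes 6=3_2+3_4+3_5+3_6+6$; $3_3\otimes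 8=4_1+4_2+2(8)$. $3_4\otimes 3_4=1+2+3_2+3_4$; $3_4\otimes 3_5=3_1+6$; $3_4\otimes 3_6=3_3+6$; $3_4\otimes 4_1=4_1+8$; $3_4\otimes 4_2=4_2+8$; $3_4\otimes 6=3_1+3_3+3_5+3_6+6$; $3_4\otimes 8=4_1+4_2+2(8)$. $3_5\otimes 3_5=1+2+3_5+3_6$; $3_5\otimes 3_6=1_1+2+3_5+3_6$; $3_5\otimes 4_1=4_1+8$; $3_5\otimes 4_2=4_2+8$; $3_5\otimes 6=3_1+3_2+3_3+3_4+6$; $3_5\otimes 8=4_1+4_2+2(8)$. $3_6\otimes 3_6=1+2+3_5+3_6$; $3_6\otimes 4_1=4_2+8$; $3_6\otimes 4_2=4_1+8$; $3_6\otimes 6=3_1+3_2+3_3+3_4+6$; $3_6\otimes 8=4_1+4_2+2(8)$. $4_1\otimes 4_1=1+3_1+3_4+3_5+6$; $4_1\otimes 4_2=1_1+3_2+3_3+3_6+6$; $4_1\otimes 6=4_1+4_2+2(8)$; $4_1\otimes 8=2+3_1+3_2+3_3+3_4+3_5+3_6+2(6)$. $4_2\otimes 4_2=1+3_1+3_4+3_5+6$;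 $4_2\otimes 6=4_1+4_2+2(8)$; $4_2\otimes 8=2+3_1+3_2+3_3+3_4+3_5+3_6+2(6)$. $6\otimes 6=1+1_1+2(2)+3_1+3_2+3_3+3_4+3_5+3_6+2(6)$; $6\otimes 8=2(4_1)+2(4_2)+4(8)$. $8\otimes 8=1+1_1+2+2(3_1)+2(3_2)+2(3_3)+2(3_4)+2(3_5)+2(3_6)+4(6)$. **B. Restrictions.** *(B1)* $2^3{:}7{:}3$ is a subgroup of both $2^3.PSL_2(7)$ and $2^3{:}PSL_2(7)$, and from either of them the irreducible representations restrict to it as: $1\mapsto 1$; $3_1\mapsto 3_1$; $3_2\mapsto 3_2$; $6\mapsto 3_1+3_2$; $7_1\mapsto 7_1$; $7_2\mapsto 1+3_1+3_2$; $7_3\mapsto 7_1$; $8\mapsto 1_1+1_2+3_1+3_2$; $14\mapsto 7_2+7_3$; $21_1\mapsto 7_1+7_2+7_3$; $21_2\mapsto 7_1+7_2+7_3$. *(B2)* $P$ and $P'$ are isomorphic to $PSL_2(7)$ and are subgroups of $2^3{:}PSL_2(7)$. The irreducible representations of $2^3{:}PSL_2(7)$ restrict to $P'$ as: $1\mapsto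 1$; $3_1\mapsto 3_1$; $3_2\mapsto 3_2$; $6\mapsto 6$; $7_1\mapsto 7$; $7_2\mapsto 7$; $7_3\mapsto 1+6$; $8\mapsto 8$; $14\mapsto 6+8$; $21_1\mapsto 3_1+3_2+7+8$; $21_2\mapsto 6+7+8$. The restrictions to $P$ are given by the same list after interchanging $7_1$ with $7_3$ and $21_1$ with $21_2$ on the left-hand side. *(B3)* $7{:}3$ is a subgroup of $2^3{:}7{:}3$, and the restrictions are: $1\mapsto 1$; $1_1\mapsto 1_1$; $1_2\mapsto 1_2$; $3_1\mapsto 3_1$; $3_2\mapsto 3_2$; $7_1\mapsto 1+3_1+3_2$; $7_2\mapsto 1_2+3_1+3_2$; $7_3\mapsto 1_1+3_1+3_2$. *(B4)* $7{:}3$ is a subgroup of $P\cong PSL_2(7)$, and the restrictions are: $1\mapsto 1$; $3_1\mapsto 3_1$; $3_2\mapsto 3_2$; $6\mapsto 3_1+3_2$; $7\mapsto 1+3_1+3_2$; $8\mapsto 1_1+1_2+3_1+3_2$. -/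

import Mathlib

universe u

noncomputable section

namespace OctGroups

/-! ### Signed permutations

`(i, ε) : Fin 7 × ℤˣ` stands for `ε eᵢ`, where `eᵢ` is the `i`-th imaginary octonion unit; the
indices are `1, …, 7` with `7 = 0` in `Fin 7`. -/

/-- Permutations of the set of all `± eᵢ`. -/
abbrev SPerm := Equiv.Perm (Fin 7 × ℤˣ)

/-- The signed permutation `eᵢ ↦ -e_{π i}` for `i ∈ neg`, and `eᵢ ↦ e_{π i}` otherwise. -/
def signed (π : Equiv.Perm (Fin 7)) (neg : Finset (Fin 7)) : SPerm where
  toFun x := (π x.1, if x.1 ∈ neg then -x.2 else x.2)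
  invFun x := (π.symm x.1, if π.symm x.1 ∈ neg then -x.2 else x.2)
  left_inv x := by
    obtain ⟨i, s⟩ := x
    by_cases h : i ∈ neg <;> simp [h]
  right_inv x := by
    obtain ⟨i, s⟩ := x
    by_cases h : π.symm i ∈ neg <;> simp [h]

/-- The cyclic permutation of order seven (also the same permutation of coordinates). -/
def α : SPerm := signed c[1, 2, 4, 3, 6, 5, 7] ∅
def β : SPerm := signed (c[2, 4, 6] * c[3, 7, 5]) ∅
def N₁ : SPerm := signed 1 {4, 5, 6, 7}
def N₇ : SPerm := signed 1 {1, 3, 5, 7}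
def γ : SPerm := signed (c[1, 4] * c[2, 5]) {1, 2, 3, 4, 5, 7}
def θ : SPerm := signed (c[1, 5] * c[2, 3, 4, 7]) {1, 2, 3, 4, 5, 6}
def A : SPerm := signed (c[1, 7, 3] * c[2, 4, 6]) {1, 2, 3, 4, 5, 7}
def B : SPerm := signed (c[2, 6] * c[3, 5]) {2, 3}

def βt : SPerm := signed (c[3, 2, 1] * c[4, 6, 5]) ∅
def γt : SPerm := signed (c[1, 5] * c[3, 7]) ∅
def θt : SPerm := signed (c[1, 4, 2, 5] * c[6, 7]) ∅
def At : SPerm := signed (c[1, 6, 2] * c[3, 5, 4]) ∅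
def Bt : SPerm := signed (c[1, 3] * c[4, 6]) ∅
def δ : SPerm := signed (c[1, 5] * c[3, 7]) {1, 2, 4, 5}

/-! ### The groups -/

/-- `7:3` -/
def G21 : Subgroup SPerm := Subgroup.closure {α, β}
/-- `2^3:7:3` -/
def G168 : Subgroup SPerm := Subgroup.closure {α, β, N₁}
/-- `PSL_2(7)`, acting by permutations of coordinates -/
def GPSL : Subgroup SPerm := Subgroup.closure {α, βt, γt}
/-- the other copy of `PSL_2(7)` in the split extension, irreducible on the coordinate space -/
def GPSLirr : Subgroup SPerm := Subgroup.closure {α, βt, δ}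
/-- the non-split extension `2^3.PSL_2(7)` -/
def G1344ns : Subgroup SPerm := Subgroup.closure {α, β, γ, N₁}
/-- the split extension `2^3:PSL_2(7)` -/
def G1344sp : Subgroup SPerm := Subgroup.closure {α, βt, γt, N₁}
/-- `4.S_4:2`, in the non-split extension -/
def G192aNs : Subgroup SPerm := Subgroup.closure {γ, θ}
/-- `4:S_4:2`, in the split extension -/
def G192aSp : Subgroup SPerm := Subgroup.closure {At, Bt, N₁}
/-- `2^3.S_4`, in the non-split extension -/
def G192bNs : Subgroup SPerm := Subgroup.closure {A, B}
/-- `2^3:S_4`, in the split extension -/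
def G192bSp : Subgroup SPerm := Subgroup.closure {γt, θt, N₁}

/-! ### Representatives of the conjugacy classes, in the order of the columns of the tables -/

def cls21 : Fin 5 → SPerm := ![1, β, β ^ 2, α, α ^ 3]
def cls168 : Fin 8 → SPerm := ![1, N₁, β ^ 2, β, β ^ 2 * N₇, β * N₇, α, α ^ 3]
def clsPSL : Fin 6 → SPerm := ![1, γt, βt, α ^ 2 * γt, α, α ^ 3]
def clsPSLirr : Fin 6 → SPerm := ![1, δ, βt, α ^ 2 * δ, α, α ^ 3]
def cls1344ns : Fin 11 → SPerm :=
  ![1, N₁, γ, β, γ * N₁, α * γ * α * N₁ * β, α * β * γ, α, α ^ 3, α ^ 2 * γ * N₁, α ^ 2 * γ]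
def cls1344sp : Fin 11 → SPerm :=
  ![1, N₁, γt * N₁, βt, δ, γt, βt * N₁, α, α ^ 3, α ^ 2 * γt, α ^ 2 * δ]
def cls192aNs : Fin 14 → SPerm :=
  ![1, θ ^ 4, (γ * θ) ^ 3, γ, γ * θ ^ 2 * γ * θ ^ 3, (γ * θ) ^ 2 * γ * θ ^ 3, (γ * θ) ^ 2,
    γ * θ ^ 4, θ ^ 2, (γ * θ ^ 2) ^ 2, (γ * θ) ^ 2 * θ, γ * θ, γ * θ ^ 2, θ]
def cls192aSp : Fin 14 → SPerm :=
  ![1, At ^ 2 * N₁ * At * N₁, N₁, At ^ 2 * Bt * N₁ * At * N₁, At ^ 2 * Bt * At * N₁,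
    (At * Bt) ^ 2 * N₁, At, Bt, (At * Bt) ^ 2, (At * Bt * N₁) ^ 2, Bt * N₁, At * N₁, At * Bt,
    At * Bt * N₁]
def cls192bNs : Fin 13 → SPerm :=
  ![1, A ^ 3, B ^ 2, A * B * A * B ^ 3, A ^ 2 * B * A * B ^ 2, A ^ 2, (A ^ 2 * B) ^ 2,
    (A * B) ^ 2, A ^ 3 * B, B, A, A * B, A ^ 2 * B]
def cls192bSp : Fin 13 → SPerm :=
  ![1, θt ^ 3 * N₁ * θt * N₁, N₁, γt * θt ^ 2 * γt * N₁, γt * N₁, γt * θt, θt ^ 2 * N₁, θt ^ 2,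
    γt * θt ^ 2 * γt * N₁ * θt, γt, γt * θt * N₁, γt * θt * γt * N₁, θt]

/-! ### Labels of the irreducible representations and the character tables

`r7_2` is the label written `7_2` and so on.  The two groups of order 1344 share one table, and so
do the groups `4.S_4:2` and `4:S_4:2`, and the groups `2^3.S_4` and `2^3:S_4`. -/

inductive Irr21
  | r1 | r1_1 | r1_2 | r3_1 | r3_2
  deriving DecidableEq

inductive Irr168
  | r1 | r1_1 | r1_2 | r3_1 | r3_2 | r7_1 | r7_2 | r7_3
  deriving DecidableEq

inductive IrrPSL
  | r1 | r3_1 | r3_2 | r6 | r7 | r8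
  deriving DecidableEq

inductive Irr1344
  | r1 | r3_1 | r3_2 | r6 | r7_1 | r7_2 | r7_3 | r8 | r14 | r21_1 | r21_2
  deriving DecidableEq

inductive Irr192a
  | r1 | r1_1 | r1_2 | r1_3 | r2_1 | r2_2 | r3_1 | r3_2 | r3_3 | r3_4 | r6_1 | r6_2 | r6_3 | r6_4
  deriving DecidableEq

inductive Irr192b
  | r1 | r1_1 | r2 | r3_1 | r3_2 | r3_3 | r3_4 | r3_5 | r3_6 | r4_1 | r4_2 | r6 | r8
  deriving DecidableEq

def mu : ℂ := (-1 + Complex.I * (Real.sqrt 3 : ℝ)) / 2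
def muBar : ℂ := (-1 - Complex.I * (Real.sqrt 3 : ℝ)) / 2
def eta : ℂ := (-1 + Complex.I * (Real.sqrt 7 : ℝ)) / 2
def etaBar : ℂ := (-1 - Complex.I * (Real.sqrt 7 : ℝ)) / 2

def chi21 : Irr21 → Fin 5 → ℂ
  | .r1 => ![1, 1, 1, 1, 1]
  | .r1_1 => ![1, mu, muBar, 1, 1]
  | .r1_2 => ![1, muBar, mu, 1, 1]
  | .r3_1 => ![3, 0, 0, eta, etaBar]
  | .r3_2 => ![3, 0, 0, etaBar, eta]

def chi168 : Irr168 → Fin 8 → ℂ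
  | .r1 => ![1, 1, 1, 1, 1, 1, 1, 1]
  | .r1_1 => ![1, 1, muBar, mu, muBar, mu, 1, 1]
  | .r1_2 => ![1, 1, mu, muBar, mu, muBar, 1, 1]
  | .r3_1 => ![3, 3, 0, 0, 0, 0, eta, etaBar]
  | .r3_2 => ![3, 3, 0, 0, 0, 0, etaBar, eta]
  | .r7_1 => ![7, -1, 1, 1, -1, -1, 0, 0]
  | .r7_2 => ![7, -1, mu, muBar, -mu, -muBar, 0, 0]
  | .r7_3 => ![7, -1, muBar, mu, -muBar, -mu, 0, 0]

def chiPSL : IrrPSL → Fin 6 → ℂ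
  | .r1 => ![1, 1, 1, 1, 1, 1]
  | .r3_1 => ![3, -1, 0, 1, eta, etaBar]
  | .r3_2 => ![3, -1, 0, 1, etaBar, eta]
  | .r6 => ![6, 2, 0, 0, -1, -1]
  | .r7 => ![7, -1, 1, -1, 0, 0]
  | .r8 => ![8, 0, -1, 0, 1, 1]

def chi1344 : Irr1344 → Fin 11 → ℂ
  | .r1 => ![1, 1, 1, 1, 1, 1, 1, 1, 1, 1, 1]
  | .r3_1 => ![3, 3, -1, 0, -1, -1, 0, eta, etaBar, 1, 1]
  | .r3_2 => ![3, 3, -1, 0, -1, -1, 0, etaBar, eta, 1, 1]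
  | .r6 => ![6, 6, 2, 0, 2, 2, 0, -1, -1, 0, 0]
  | .r7_1 => ![7, -1, -1, 1, -1, 3, -1, 0, 0, 1, -1]
  | .r7_2 => ![7, 7, -1, 1, -1, -1, 1, 0, 0, -1, -1]
  | .r7_3 => ![7, -1, -1, 1, 3, -1, -1, 0, 0, -1, 1]
  | .r8 => ![8, 8, 0, -1, 0, 0, -1, 1, 1, 0, 0]
  | .r14 => ![14, -2, -2, -1, 2, 2, 1, 0, 0, 0, 0]
  | .r21_1 => ![21, -3, 1, 0, -3, 1, 0, 0, 0, -1, 1]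
  | .r21_2 => ![21, -3, 1, 0, 1, -3, 0, 0, 0, 1, -1]

def chi192a : Irr192a → Fin 14 → ℂ
  | .r1 => ![1, 1, 1, 1, 1, 1, 1, 1, 1, 1, 1, 1, 1, 1]
  | .r1_1 => ![1, 1, -1, 1, -1, -1, 1, 1, 1, 1, -1, -1, 1, -1]
  | .r1_2 => ![1, 1, -1, -1, 1, -1, 1, -1, 1, 1, 1, -1, -1, 1]
  | .r1_3 => ![1, 1, 1, -1, -1, 1, 1, -1, 1, 1, -1, 1, -1, -1]
  | .r2_1 => ![2, 2, -2, 0, 0, -2, -1, 0, 2, 2, 0, 1, 0, 0]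
  | .r2_2 => ![2, 2, 2, 0, 0, 2, -1, 0, 2, 2, 0, -1, 0, 0]
  | .r3_1 => ![3, 3, 3, -1, -1, -1, 0, -1, -1, -1, -1, 0, 1, 1]
  | .r3_2 => ![3, 3, 3, 1, 1, -1, 0, 1, -1, -1, 1, 0, -1, -1]
  | .r3_3 => ![3, 3, -3, 1, -1, 1, 0, 1, -1, -1, -1, 0, -1, 1]
  | .r3_4 => ![3, 3, -3, -1, 1, 1, 0, -1, -1, -1, 1, 0, 1, -1]
  | .r6_1 => ![6, -2, 0, 0, -2, 0, 0, 0, -2, 2, 2, 0, 0, 0]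
  | .r6_2 => ![6, -2, 0, 0, 2, 0, 0, 0, -2, 2, -2, 0, 0, 0]
  | .r6_3 => ![6, -2, 0, -2, 0, 0, 0, 2, 2, -2, 0, 0, 0, 0]
  | .r6_4 => ![6, -2, 0, 2, 0, 0, 0, -2, 2, -2, 0, 0, 0, 0]

def chi192b : Irr192b → Fin 13 → ℂ
  | .r1 => ![1, 1, 1, 1, 1, 1, 1, 1, 1, 1, 1, 1, 1]
  | .r1_1 => ![1, 1, 1, 1, -1, 1, 1, 1, -1, -1, 1, -1, -1]
  | .r2 => ![2, 2, 2, 2, 0, -1, 2, 2, 0, 0, -1, 0, 0]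
  | .r3_1 => ![3, 3, -1, -1, -1, 0, -1, 3, 1, 1, 0, -1, 1]
  | .r3_2 => ![3, 3, -1, -1, 1, 0, 3, -1, -1, -1, 0, -1, 1]
  | .r3_3 => ![3, 3, -1, -1, 1, 0, -1, 3, -1, -1, 0, 1, -1]
  | .r3_4 => ![3, 3, -1, -1, -1, 0, 3, -1, 1, 1, 0, 1, -1]
  | .r3_5 => ![3, 3, 3, -1, 1, 0, -1, -1, 1, 1, 0, -1, -1]
  | .r3_6 => ![3, 3, 3, -1, -1, 0, -1, -1, -1, -1, 0, 1, 1]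
  | .r4_1 => ![4, -4, 0, 0, 0, 1, 0, 0, -2, 2, -1, 0, 0]
  | .r4_2 => ![4, -4, 0, 0, 0, 1, 0, 0, 2, -2, -1, 0, 0]
  | .r6 => ![6, 6, -2, 2, 0, 0, -2, -2, 0, 0, 0, 0, 0]
  | .r8 => ![8, -8, 0, 0, 0, -1, 0, 0, 0, 0, 1, 0, 0]

/-! ### Systems of irreducible representations and their decompositions -/

/-- A complete system of irreducible complex representations of `G`, one for each label, with the
character table `χ`: the columns are indexed by the representatives `cls` of the conjugacy classes
of `G`, and every finite-dimensional irreducible complex representation of `G` is isomorphic to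
exactly one member of the system. -/
structure IrrepSystem (G : Subgroup SPerm) {L : Type} {n : ℕ} (cls : Fin n → SPerm)
    (χ : L → Fin n → ℂ) where
  dim : L → ℕ
  rep : ∀ i, Representation ℂ G (Fin (dim i) → ℂ)
  irreducible : ∀ i, (rep i).IsIrreducible
  cls_mem : ∀ j, cls j ∈ G
  cls_conj : ∀ g : G, ∃! j, IsConj (⟨cls j, cls_mem j⟩ : G) g
  character_eq : ∀ i j, (rep i).character ⟨cls j, cls_mem j⟩ = χ i j
  complete : ∀ (V : Type u) [AddCommGroup V] [Module ℂ V] [FiniteDimensional ℂ V]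
    (σ : Representation ℂ G V), σ.IsIrreducible → ∃! i, Nonempty (σ.Equiv (rep i))

/-- The direct sum in which the `k`-th irreducible representation occurs `m k` times. -/
def IrrepSystem.sum {G : Subgroup SPerm} {L : Type} {n : ℕ} {cls : Fin n → SPerm}
    {χ : L → Fin n → ℂ} (S : IrrepSystem.{u} G cls χ) (m : L → ℕ) :=
  Representation.directSum (fun p : (Σ k : L, Fin (m k)) => S.rep p.1)

/-- The multiplicity of `k` in a formal sum, given as a list of pairs `(multiplicity, label)`. -/
def mult {L : Type} [DecidableEq L] (l : List (ℕ × L)) (k : L) : ℕ :=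
  (l.map fun p => if p.2 = k then p.1 else 0).sum

/-- The irreducible representations of `G` are given by the character table `χ`, and the tensor
products of any two of them decompose according to the table `t`, in which each unordered pair of
labels is listed in one order (the entry for the opposite order being empty). -/
def TensorRule (G : Subgroup SPerm) {L : Type} [DecidableEq L] {n : ℕ}
    (cls : Fin n → SPerm) (χ : L → Fin n → ℂ) (t : L → L → List (ℕ × L)) : Prop :=
  Nonempty (IrrepSystem.{u} G cls χ) ∧
    ∀ (S : IrrepSystem.{u} G cls χ) (i j : L),
      Nonempty (((S.rep i).tprod (S.rep j)).Equiv (S.sum (mult (t i j) ⊔ mult (t j i))))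

/-- `H` is a subgroup of `G`, both have irreducible representations as in the respective character
tables, and those of `G` decompose on restriction to `H` according to the table `b`. -/
def BranchingRule (G H : Subgroup SPerm) {L L' : Type} [DecidableEq L'] {n n' : ℕ}
    (cls : Fin n → SPerm) (χ : L → Fin n → ℂ) (cls' : Fin n' → SPerm) (χ' : L' → Fin n' → ℂ)
    (b : L → List (ℕ × L')) : Prop :=
  Nonempty (IrrepSystem.{u} G cls χ) ∧ Nonempty (IrrepSystem.{u} H cls' χ') ∧
    ∃ h : H ≤ G, ∀ (S : IrrepSystem.{u} G cls χ) (S' : IrrepSystem.{u} H cls' χ') (i : L),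
      Nonempty (Representation.Equiv ((S.rep i).comp (Subgroup.inclusion h)) (S'.sum (mult (b i))))

/-! ### The tables of tensor products and of restrictions

A list `[(m₁, i₁), (m₂, i₂), …]` stands for the direct sum of `m₁` copies of the irreducible
representation with label `i₁`, `m₂` copies of the one with label `i₂`, …. -/

def tensor168 : Irr168 → Irr168 → List (ℕ × Irr168)
  | .r1, x => [(1, x)]
  | .r1_1, .r1_1 => [(1, .r1_2)]
  | .r1_1, .r1_2 => [(1, .r1)]
  | .r1_1, .r3_1 => [(1, .r3_1)]
  | .r1_1, .r3_2 => [(1, .r3_2)]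
  | .r1_1, .r7_1 => [(1, .r7_3)]
  | .r1_1, .r7_2 => [(1, .r7_1)]
  | .r1_1, .r7_3 => [(1, .r7_2)]
  | .r1_2, .r1_2 => [(1, .r1_1)]
  | .r1_2, .r3_1 => [(1, .r3_1)]
  | .r1_2, .r3_2 => [(1, .r3_2)]
  | .r1_2, .r7_1 => [(1, .r7_2)]
  | .r1_2, .r7_2 => [(1, .r7_3)]
  | .r1_2, .r7_3 => [(1, .r7_1)]
  | .r3_1, .r3_1 => [(1, .r3_1), (2, .r3_2)]
  | .r3_1, .r3_2 => [(1, .r1), (1, .r1_1), (1, .r1_2), (1, .r3_1), (1, .r3_2)]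
  | .r3_1, .r7_1 => [(1, .r7_1), (1, .r7_2), (1, .r7_3)]
  | .r3_1, .r7_2 => [(1, .r7_1), (1, .r7_2), (1, .r7_3)]
  | .r3_1, .r7_3 => [(1, .r7_1), (1, .r7_2), (1, .r7_3)]
  | .r3_2, .r3_2 => [(2, .r3_1), (1, .r3_2)]
  | .r3_2, .r7_1 => [(1, .r7_1), (1, .r7_2), (1, .r7_3)]
  | .r3_2, .r7_2 => [(1, .r7_1), (1, .r7_2), (1, .r7_3)]
  | .r3_2, .r7_3 => [(1, .r7_1), (1, .r7_2), (1, .r7_3)]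
  | .r7_1, .r7_1 => [(1, .r1), (1, .r3_1), (1, .r3_2), (2, .r7_1), (2, .r7_2), (2, .r7_3)]
  | .r7_1, .r7_2 => [(1, .r1_2), (1, .r3_1), (1, .r3_2), (2, .r7_1), (2, .r7_2), (2, .r7_3)]
  | .r7_1, .r7_3 => [(1, .r1_1), (1, .r3_1), (1, .r3_2), (2, .r7_1), (2, .r7_2), (2, .r7_3)]
  | .r7_2, .r7_2 => [(1, .r1_1), (1, .r3_1), (1, .r3_2), (2, .r7_1), (2, .r7_2), (2, .r7_3)]
  | .r7_2, .r7_3 => [(1, .r1), (1, .r3_1), (1, .r3_2), (2, .r7_1), (2, .r7_2), (2, .r7_3)]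
  | .r7_3, .r7_3 => [(1, .r1_2), (1, .r3_1), (1, .r3_2), (2, .r7_1), (2, .r7_2), (2, .r7_3)]
  | _, _ => []

def tensor1344 : Irr1344 → Irr1344 → List (ℕ × Irr1344)
  | .r1, x => [(1, x)]
  | .r3_1, .r3_1 => [(1, .r3_2), (1, .r6)]
  | .r3_1, .r3_2 => [(1, .r1), (1, .r8)]
  | .r3_1, .r6 => [(1, .r3_2), (1, .r7_2), (1, .r8)]
  | .r3_1, .r7_1 => [(1, .r21_2)]
  | .r3_1, .r7_2 => [(1, .r6), (1, .r7_2), (1, .r8)]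
  | .r3_1, .r7_3 => [(1, .r21_1)]
  | .r3_1, .r8 => [(1, .r3_1), (1, .r6), (1, .r7_2), (1, .r8)]
  | .r3_1, .r14 => [(1, .r21_1), (1, .r21_2)]
  | .r3_1, .r21_1 => [(1, .r7_3), (1, .r14), (1, .r21_1), (1, .r21_2)]
  | .r3_1, .r21_2 => [(1, .r7_1), (1, .r14), (1, .r21_1), (1, .r21_2)]
  | .r3_2, .r3_2 => [(1, .r3_1), (1, .r6)]
  | .r3_2, .r6 => [(1, .r3_1), (1, .r7_2), (1, .r8)]
  | .r3_2, .r7_1 => [(1, .r21_2)]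
  | .r3_2, .r7_2 => [(1, .r6), (1, .r7_2), (1, .r8)]
  | .r3_2, .r7_3 => [(1, .r21_1)]
  | .r3_2, .r8 => [(1, .r3_2), (1, .r6), (1, .r7_2), (1, .r8)]
  | .r3_2, .r14 => [(1, .r21_1), (1, .r21_2)]
  | .r3_2, .r21_1 => [(1, .r7_3), (1, .r14), (1, .r21_1), (1, .r21_2)]
  | .r3_2, .r21_2 => [(1, .r7_1), (1, .r14), (1, .r21_1), (1, .r21_2)]
  | .r6, .r6 => [(1, .r1), (2, .r6), (1, .r7_2), (2, .r8)]
  | .r6, .r7_1 => [(1, .r7_1), (1, .r14), (1, .r21_1)]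
  | .r6, .r7_2 => [(1, .r3_1), (1, .r3_2), (1, .r6), (2, .r7_2), (2, .r8)]
  | .r6, .r7_3 => [(1, .r7_3), (1, .r14), (1, .r21_2)]
  | .r6, .r8 => [(1, .r3_1), (1, .r3_2), (2, .r6), (2, .r7_2), (2, .r8)]
  | .r6, .r14 => [(1, .r7_1), (1, .r7_3), (2, .r14), (1, .r21_1), (1, .r21_2)]
  | .r6, .r21_1 => [(1, .r7_1), (1, .r14), (3, .r21_1), (2, .r21_2)]
  | .r6, .r21_2 => [(1, .r7_3), (1, .r14), (2, .r21_1), (3, .r21_2)]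
  | .r7_1, .r7_1 => [(1, .r1), (1, .r6), (1, .r7_1), (1, .r14), (1, .r21_1)]
  | .r7_1, .r7_2 => [(1, .r7_3), (1, .r21_1), (1, .r21_2)]
  | .r7_1, .r7_3 => [(1, .r7_2), (1, .r21_1), (1, .r21_2)]
  | .r7_1, .r8 => [(1, .r14), (1, .r21_1), (1, .r21_2)]
  | .r7_1, .r14 => [(1, .r6), (1, .r7_1), (1, .r8), (1, .r14), (2, .r21_1), (1, .r21_2)]
  | .r7_1, .r21_1 => [(1, .r6), (1, .r7_1), (1, .r7_2), (1, .r7_3), (1, .r8), (2, .r14), (2, .r21_1), (2, .r21_2)]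
  | .r7_1, .r21_2 => [(1, .r3_1), (1, .r3_2), (1, .r7_2), (1, .r7_3), (1, .r8), (1, .r14), (2, .r21_1), (3, .r21_2)]
  | .r7_2, .r7_2 => [(1, .r1), (1, .r3_1), (1, .r3_2), (2, .r6), (2, .r7_2), (2, .r8)]
  | .r7_2, .r7_3 => [(1, .r7_1), (1, .r21_1), (1, .r21_2)]
  | .r7_2, .r8 => [(1, .r3_1), (1, .r3_2), (2, .r6), (2, .r7_2), (3, .r8)]
  | .r7_2, .r14 => [(1, .r14), (2, .r21_1), (2, .r21_2)]
  | .r7_2, .r21_1 => [(1, .r7_1), (1, .r7_3), (2, .r14), (2, .r21_1), (3, .r21_2)]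
  | .r7_2, .r21_2 => [(1, .r7_1), (1, .r7_3), (2, .r14), (3, .r21_1), (2, .r21_2)]
  | .r7_3, .r7_3 => [(1, .r1), (1, .r6), (1, .r7_3), (1, .r14), (1, .r21_2)]
  | .r7_3, .r8 => [(1, .r14), (1, .r21_1), (1, .r21_2)]
  | .r7_3, .r14 => [(1, .r6), (1, .r7_3), (1, .r8), (1, .r14), (1, .r21_1), (2, .r21_2)]
  | .r7_3, .r21_1 => [(1, .r3_1), (1, .r3_2), (1, .r7_1), (1, .r7_2), (1, .r8), (1, .r14), (3, .r21_1), (2, .r21_2)]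
  | .r7_3, .r21_2 => [(1, .r6), (1, .r7_1), (1, .r7_2), (1, .r7_3), (1, .r8), (2, .r14), (2, .r21_1), (2, .r21_2)]
  | .r8, .r8 => [(1, .r1), (1, .r3_1), (1, .r3_2), (2, .r6), (3, .r7_2), (3, .r8)]
  | .r8, .r14 => [(1, .r7_1), (1, .r7_3), (1, .r14), (2, .r21_1), (2, .r21_2)]
  | .r8, .r21_1 => [(1, .r7_1), (1, .r7_3), (2, .r14), (3, .r21_1), (3, .r21_2)]
  | .r8, .r21_2 => [(1, .r7_1), (1, .r7_3), (2, .r14), (3, .r21_1), (3, .r21_2)]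
  | .r14, .r14 => [(1, .r1), (2, .r6), (1, .r7_1), (1, .r7_2), (1, .r7_3), (1, .r8), (2, .r14), (3, .r21_1), (3, .r21_2)]
  | .r14, .r21_1 => [(1, .r3_1), (1, .r3_2), (1, .r6), (2, .r7_1), (2, .r7_2), (1, .r7_3), (2, .r8), (3, .r14), (5, .r21_1), (4, .r21_2)]
  | .r14, .r21_2 => [(1, .r3_1), (1, .r3_2), (1, .r6), (1, .r7_1), (2, .r7_2), (2, .r7_3), (2, .r8), (3, .r14), (4, .r21_1), (5, .r21_2)]
  | .r21_1, .r21_1 => [(1, .r1), (1, .r3_1), (1, .r3_2), (3, .r6), (2, .r7_1), (2, .r7_2), (3, .r7_3), (3, .r8), (5, .r14), (6, .r21_1), (7, .r21_2)]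
  | .r21_1, .r21_2 => [(1, .r3_1), (1, .r3_2), (2, .r6), (2, .r7_1), (3, .r7_2), (2, .r7_3), (3, .r8), (4, .r14), (7, .r21_1), (7, .r21_2)]
  | .r21_2, .r21_2 => [(1, .r1), (1, .r3_1), (1, .r3_2), (3, .r6), (3, .r7_1), (2, .r7_2), (2, .r7_3), (3, .r8), (5, .r14), (7, .r21_1), (6, .r21_2)]
  | _, _ => []

def tensor192a : Irr192a → Irr192a → List (ℕ × Irr192a)
  | .r1, x => [(1, x)]
  | .r1_1, .r1_1 => [(1, .r1)]
  | .r1_1, .r1_2 => [(1, .r1_3)]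
  | .r1_1, .r1_3 => [(1, .r1_2)]
  | .r1_1, .r2_1 => [(1, .r2_2)]
  | .r1_1, .r2_2 => [(1, .r2_1)]
  | .r1_1, .r3_1 => [(1, .r3_4)]
  | .r1_1, .r3_2 => [(1, .r3_3)]
  | .r1_1, .r3_3 => [(1, .r3_2)]
  | .r1_1, .r3_4 => [(1, .r3_1)]
  | .r1_1, .r6_1 => [(1, .r6_2)]
  | .r1_1, .r6_2 => [(1, .r6_1)]
  | .r1_1, .r6_3 => [(1, .r6_3)]
  | .r1_1, .r6_4 => [(1, .r6_4)]
  | .r1_2, .r1_2 => [(1, .r1)]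
  | .r1_2, .r1_3 => [(1, .r1_1)]
  | .r1_2, .r2_1 => [(1, .r2_2)]
  | .r1_2, .r2_2 => [(1, .r2_1)]
  | .r1_2, .r3_1 => [(1, .r3_3)]
  | .r1_2, .r3_2 => [(1, .r3_4)]
  | .r1_2, .r3_3 => [(1, .r3_1)]
  | .r1_2, .r3_4 => [(1, .r3_2)]
  | .r1_2, .r6_1 => [(1, .r6_1)]
  | .r1_2, .r6_2 => [(1, .r6_2)]
  | .r1_2, .r6_3 => [(1, .r6_4)]
  | .r1_2, .r6_4 => [(1, .r6_3)]
  | .r1_3, .r1_3 => [(1, .r1)]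
  | .r1_3, .r2_1 => [(1, .r2_1)]
  | .r1_3, .r2_2 => [(1, .r2_2)]
  | .r1_3, .r3_1 => [(1, .r3_2)]
  | .r1_3, .r3_2 => [(1, .r3_1)]
  | .r1_3, .r3_3 => [(1, .r3_4)]
  | .r1_3, .r3_4 => [(1, .r3_3)]
  | .r1_3, .r6_1 => [(1, .r6_2)]
  | .r1_3, .r6_2 => [(1, .r6_1)]
  | .r1_3, .r6_3 => [(1, .r6_4)]
  | .r1_3, .r6_4 => [(1, .r6_3)]
  | .r2_1, .r2_1 => [(1, .r1), (1, .r1_3), (1, .r2_2)]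
  | .r2_1, .r2_2 => [(1, .r1_1), (1, .r1_2), (1, .r2_1)]
  | .r2_1, .r3_1 => [(1, .r3_3), (1, .r3_4)]
  | .r2_1, .r3_2 => [(1, .r3_3), (1, .r3_4)]
  | .r2_1, .r3_3 => [(1, .r3_1), (1, .r3_2)]
  | .r2_1, .r3_4 => [(1, .r3_1), (1, .r3_2)]
  | .r2_1, .r6_1 => [(1, .r6_1), (1, .r6_2)]
  | .r2_1, .r6_2 => [(1, .r6_1), (1, .r6_2)]
  | .r2_1, .r6_3 => [(1, .r6_3), (1, .r6_4)]
  | .r2_1, .r6_4 => [(1, .r6_3), (1, .r6_4)]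
  | .r2_2, .r2_2 => [(1, .r1), (1, .r1_3), (1, .r2_2)]
  | .r2_2, .r3_1 => [(1, .r3_1), (1, .r3_2)]
  | .r2_2, .r3_2 => [(1, .r3_1), (1, .r3_2)]
  | .r2_2, .r3_3 => [(1, .r3_3), (1, .r3_4)]
  | .r2_2, .r3_4 => [(1, .r3_3), (1, .r3_4)]
  | .r2_2, .r6_1 => [(1, .r6_1), (1, .r6_2)]
  | .r2_2, .r6_2 => [(1, .r6_1), (1, .r6_2)]
  | .r2_2, .r6_3 => [(1, .r6_3), (1, .r6_4)]
  | .r2_2, .r6_4 => [(1, .r6_3), (1, .r6_4)]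
  | .r3_1, .r3_1 => [(1, .r1), (1, .r2_2), (1, .r3_1), (1, .r3_2)]
  | .r3_1, .r3_2 => [(1, .r1_3), (1, .r2_2), (1, .r3_1), (1, .r3_2)]
  | .r3_1, .r3_3 => [(1, .r1_2), (1, .r2_1), (1, .r3_3), (1, .r3_4)]
  | .r3_1, .r3_4 => [(1, .r1_1), (1, .r2_1), (1, .r3_3), (1, .r3_4)]
  | .r3_1, .r6_1 => [(1, .r6_2), (1, .r6_3), (1, .r6_4)]
  | .r3_1, .r6_2 => [(1, .r6_1), (1, .r6_3), (1, .r6_4)]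
  | .r3_1, .r6_3 => [(1, .r6_1), (1, .r6_2), (1, .r6_4)]
  | .r3_1, .r6_4 => [(1, .r6_1), (1, .r6_2), (1, .r6_3)]
  | .r3_2, .r3_2 => [(1, .r1), (1, .r2_2), (1, .r3_1), (1, .r3_2)]
  | .r3_2, .r3_3 => [(1, .r1_1), (1, .r2_1), (1, .r3_3), (1, .r3_4)]
  | .r3_2, .r3_4 => [(1, .r1_2), (1, .r2_1), (1, .r3_3), (1, .r3_4)]
  | .r3_2, .r6_1 => [(1, .r6_1), (1, .r6_3), (1, .r6_4)]
  | .r3_2, .r6_2 => [(1, .r6_2), (1, .r6_3), (1, .r6_4)]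
  | .r3_2, .r6_3 => [(1, .r6_1), (1, .r6_2), (1, .r6_3)]
  | .r3_2, .r6_4 => [(1, .r6_1), (1, .r6_2), (1, .r6_4)]
  | .r3_3, .r3_3 => [(1, .r1), (1, .r2_2), (1, .r3_1), (1, .r3_2)]
  | .r3_3, .r3_4 => [(1, .r1_3), (1, .r2_2), (1, .r3_1), (1, .r3_2)]
  | .r3_3, .r6_1 => [(1, .r6_2), (1, .r6_3), (1, .r6_4)]
  | .r3_3, .r6_2 => [(1, .r6_1), (1, .r6_3), (1, .r6_4)]
  | .r3_3, .r6_3 => [(1, .r6_1), (1, .r6_2), (1, .r6_3)]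
  | .r3_3, .r6_4 => [(1, .r6_1), (1, .r6_2), (1, .r6_4)]
  | .r3_4, .r3_4 => [(1, .r1), (1, .r2_2), (1, .r3_1), (1, .r3_2)]
  | .r3_4, .r6_1 => [(1, .r6_1), (1, .r6_3), (1, .r6_4)]
  | .r3_4, .r6_2 => [(1, .r6_2), (1, .r6_3), (1, .r6_4)]
  | .r3_4, .r6_3 => [(1, .r6_1), (1, .r6_2), (1, .r6_4)]
  | .r3_4, .r6_4 => [(1, .r6_1), (1, .r6_2), (1, .r6_3)]
  | .r6_1, .r6_1 => [(1, .r1), (1, .r1_2), (1, .r2_1), (1, .r2_2), (1, .r3_2), (1, .r3_4), (1, .r6_1), (1, .r6_2), (1, .r6_3), (1, .r6_4)]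
  | .r6_1, .r6_2 => [(1, .r1_1), (1, .r1_3), (1, .r2_1), (1, .r2_2), (1, .r3_1), (1, .r3_3), (1, .r6_1), (1, .r6_2), (1, .r6_3), (1, .r6_4)]
  | .r6_1, .r6_3 => [(1, .r3_1), (1, .r3_2), (1, .r3_3), (1, .r3_4), (1, .r6_1), (1, .r6_2), (1, .r6_3), (1, .r6_4)]
  | .r6_1, .r6_4 => [(1, .r3_1), (1, .r3_2), (1, .r3_3), (1, .r3_4), (1, .r6_1), (1, .r6_2), (1, .r6_3), (1, .r6_4)]
  | .r6_2, .r6_2 => [(1, .r1), (1, .r1_2), (1, .r2_1), (1, .r2_2), (1, .r3_2), (1, .r3_4), (1, .r6_1), (1, .r6_2), (1, .r6_3), (1, .r6_4)]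
  | .r6_2, .r6_3 => [(1, .r3_1), (1, .r3_2), (1, .r3_3), (1, .r3_4), (1, .r6_1), (1, .r6_2), (1, .r6_3), (1, .r6_4)]
  | .r6_2, .r6_4 => [(1, .r3_1), (1, .r3_2), (1, .r3_3), (1, .r3_4), (1, .r6_1), (1, .r6_2), (1, .r6_3), (1, .r6_4)]
  | .r6_3, .r6_3 => [(1, .r1), (1, .r1_1), (1, .r2_1), (1, .r2_2), (1, .r3_2), (1, .r3_3), (1, .r6_1), (1, .r6_2), (1, .r6_3), (1, .r6_4)]
  | .r6_3, .r6_4 => [(1, .r1_2), (1, .r1_3), (1, .r2_1), (1, .r2_2), (1, .r3_1), (1, .r3_4), (1, .r6_1), (1, .r6_2), (1, .r6_3), (1, .r6_4)]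
  | .r6_4, .r6_4 => [(1, .r1), (1, .r1_1), (1, .r2_1), (1, .r2_2), (1, .r3_2), (1, .r3_3), (1, .r6_1), (1, .r6_2), (1, .r6_3), (1, .r6_4)]
  | _, _ => []

def tensor192b : Irr192b → Irr192b → List (ℕ × Irr192b)
  | .r1, x => [(1, x)]
  | .r1_1, .r1_1 => [(1, .r1)]
  | .r1_1, .r2 => [(1, .r2)]
  | .r1_1, .r3_1 => [(1, .r3_3)]
  | .r1_1, .r3_2 => [(1, .r3_4)]
  | .r1_1, .r3_3 => [(1, .r3_1)]
  | .r1_1, .r3_4 => [(1, .r3_2)]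
  | .r1_1, .r3_5 => [(1, .r3_6)]
  | .r1_1, .r3_6 => [(1, .r3_5)]
  | .r1_1, .r4_1 => [(1, .r4_2)]
  | .r1_1, .r4_2 => [(1, .r4_1)]
  | .r1_1, .r6 => [(1, .r6)]
  | .r1_1, .r8 => [(1, .r8)]
  | .r2, .r2 => [(1, .r1), (1, .r1_1), (1, .r2)]
  | .r2, .r3_1 => [(1, .r3_1), (1, .r3_3)]
  | .r2, .r3_2 => [(1, .r3_2), (1, .r3_4)]
  | .r2, .r3_3 => [(1, .r3_1), (1, .r3_3)]
  | .r2, .r3_4 => [(1, .r3_2), (1, .r3_4)]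
  | .r2, .r3_5 => [(1, .r3_5), (1, .r3_6)]
  | .r2, .r3_6 => [(1, .r3_5), (1, .r3_6)]
  | .r2, .r4_1 => [(1, .r8)]
  | .r2, .r4_2 => [(1, .r8)]
  | .r2, .r6 => [(2, .r6)]
  | .r2, .r8 => [(1, .r4_1), (1, .r4_2), (1, .r8)]
  | .r3_1, .r3_1 => [(1, .r1), (1, .r2), (1, .r3_1), (1, .r3_3)]
  | .r3_1, .r3_2 => [(1, .r3_6), (1, .r6)]
  | .r3_1, .r3_3 => [(1, .r1_1), (1, .r2), (1, .r3_1), (1, .r3_3)]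
  | .r3_1, .r3_4 => [(1, .r3_5), (1, .r6)]
  | .r3_1, .r3_5 => [(1, .r3_4), (1, .r6)]
  | .r3_1, .r3_6 => [(1, .r3_2), (1, .r6)]
  | .r3_1, .r4_1 => [(1, .r4_1), (1, .r8)]
  | .r3_1, .r4_2 => [(1, .r4_2), (1, .r8)]
  | .r3_1, .r6 => [(1, .r3_2), (1, .r3_4), (1, .r3_5), (1, .r3_6), (1, .r6)]
  | .r3_1, .r8 => [(1, .r4_1), (1, .r4_2), (2, .r8)]
  | .r3_2, .r3_2 => [(1, .r1), (1, .r2), (1, .r3_2), (1, .r3_4)]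
  | .r3_2, .r3_3 => [(1, .r3_5), (1, .r6)]
  | .r3_2, .r3_4 => [(1, .r1_1), (1, .r2), (1, .r3_2), (1, .r3_4)]
  | .r3_2, .r3_5 => [(1, .r3_3), (1, .r6)]
  | .r3_2, .r3_6 => [(1, .r3_1), (1, .r6)]
  | .r3_2, .r4_1 => [(1, .r4_2), (1, .r8)]
  | .r3_2, .r4_2 => [(1, .r4_1), (1, .r8)]
  | .r3_2, .r6 => [(1, .r3_1), (1, .r3_3), (1, .r3_5), (1, .r3_6), (1, .r6)]
  | .r3_2, .r8 => [(1, .r4_1), (1, .r4_2), (2, .r8)]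
  | .r3_3, .r3_3 => [(1, .r1), (1, .r2), (1, .r3_1), (1, .r3_3)]
  | .r3_3, .r3_4 => [(1, .r3_6), (1, .r6)]
  | .r3_3, .r3_5 => [(1, .r3_2), (1, .r6)]
  | .r3_3, .r3_6 => [(1, .r3_4), (1, .r6)]
  | .r3_3, .r4_1 => [(1, .r4_2), (1, .r8)]
  | .r3_3, .r4_2 => [(1, .r4_1), (1, .r8)]
  | .r3_3, .r6 => [(1, .r3_2), (1, .r3_4), (1, .r3_5), (1, .r3_6), (1, .r6)]
  | .r3_3, .r8 => [(1, .r4_1), (1, .r4_2), (2, .r8)]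
  | .r3_4, .r3_4 => [(1, .r1), (1, .r2), (1, .r3_2), (1, .r3_4)]
  | .r3_4, .r3_5 => [(1, .r3_1), (1, .r6)]
  | .r3_4, .r3_6 => [(1, .r3_3), (1, .r6)]
  | .r3_4, .r4_1 => [(1, .r4_1), (1, .r8)]
  | .r3_4, .r4_2 => [(1, .r4_2), (1, .r8)]
  | .r3_4, .r6 => [(1, .r3_1), (1, .r3_3), (1, .r3_5), (1, .r3_6), (1, .r6)]
  | .r3_4, .r8 => [(1, .r4_1), (1, .r4_2), (2, .r8)]
  | .r3_5, .r3_5 => [(1, .r1), (1, .r2), (1, .r3_5), (1, .r3_6)]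
  | .r3_5, .r3_6 => [(1, .r1_1), (1, .r2), (1, .r3_5), (1, .r3_6)]
  | .r3_5, .r4_1 => [(1, .r4_1), (1, .r8)]
  | .r3_5, .r4_2 => [(1, .r4_2), (1, .r8)]
  | .r3_5, .r6 => [(1, .r3_1), (1, .r3_2), (1, .r3_3), (1, .r3_4), (1, .r6)]
  | .r3_5, .r8 => [(1, .r4_1), (1, .r4_2), (2, .r8)]
  | .r3_6, .r3_6 => [(1, .r1), (1, .r2), (1, .r3_5), (1, .r3_6)]
  | .r3_6, .r4_1 => [(1, .r4_2), (1, .r8)]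
  | .r3_6, .r4_2 => [(1, .r4_1), (1, .r8)]
  | .r3_6, .r6 => [(1, .r3_1), (1, .r3_2), (1, .r3_3), (1, .r3_4), (1, .r6)]
  | .r3_6, .r8 => [(1, .r4_1), (1, .r4_2), (2, .r8)]
  | .r4_1, .r4_1 => [(1, .r1), (1, .r3_1), (1, .r3_4), (1, .r3_5), (1, .r6)]
  | .r4_1, .r4_2 => [(1, .r1_1), (1, .r3_2), (1, .r3_3), (1, .r3_6), (1, .r6)]
  | .r4_1, .r6 => [(1, .r4_1), (1, .r4_2), (2, .r8)]
  | .r4_1, .r8 => [(1, .r2), (1, .r3_1), (1, .r3_2), (1, .r3_3), (1, .r3_4), (1, .r3_5), (1, .r3_6), (2, .r6)]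
  | .r4_2, .r4_2 => [(1, .r1), (1, .r3_1), (1, .r3_4), (1, .r3_5), (1, .r6)]
  | .r4_2, .r6 => [(1, .r4_1), (1, .r4_2), (2, .r8)]
  | .r4_2, .r8 => [(1, .r2), (1, .r3_1), (1, .r3_2), (1, .r3_3), (1, .r3_4), (1, .r3_5), (1, .r3_6), (2, .r6)]
  | .r6, .r6 => [(1, .r1), (1, .r1_1), (2, .r2), (1, .r3_1), (1, .r3_2), (1, .r3_3), (1, .r3_4), (1, .r3_5), (1, .r3_6), (2, .r6)]
  | .r6, .r8 => [(2, .r4_1), (2, .r4_2), (4, .r8)]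
  | .r8, .r8 => [(1, .r1), (1, .r1_1), (1, .r2), (2, .r3_1), (2, .r3_2), (2, .r3_3), (2, .r3_4), (2, .r3_5), (2, .r3_6), (4, .r6)]
  | _, _ => []

def br1344To168 : Irr1344 → List (ℕ × Irr168)
  | .r1 => [(1, .r1)]
  | .r3_1 => [(1, .r3_1)]
  | .r3_2 => [(1, .r3_2)]
  | .r6 => [(1, .r3_1), (1, .r3_2)]
  | .r7_1 => [(1, .r7_1)]
  | .r7_2 => [(1, .r1), (1, .r3_1), (1, .r3_2)]
  | .r7_3 => [(1, .r7_1)]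
  | .r8 => [(1, .r1_1), (1, .r1_2), (1, .r3_1), (1, .r3_2)]
  | .r14 => [(1, .r7_2), (1, .r7_3)]
  | .r21_1 => [(1, .r7_1), (1, .r7_2), (1, .r7_3)]
  | .r21_2 => [(1, .r7_1), (1, .r7_2), (1, .r7_3)]

def br1344ToPSL : Irr1344 → List (ℕ × IrrPSL)
  | .r1 => [(1, .r1)]
  | .r3_1 => [(1, .r3_1)]
  | .r3_2 => [(1, .r3_2)]
  | .r6 => [(1, .r6)]
  | .r7_1 => [(1, .r7)]
  | .r7_2 => [(1, .r7)]
  | .r7_3 => [(1, .r1), (1, .r6)]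
  | .r8 => [(1, .r8)]
  | .r14 => [(1, .r6), (1, .r8)]
  | .r21_1 => [(1, .r3_1), (1, .r3_2), (1, .r7), (1, .r8)]
  | .r21_2 => [(1, .r6), (1, .r7), (1, .r8)]

def br168To21 : Irr168 → List (ℕ × Irr21)
  | .r1 => [(1, .r1)]
  | .r1_1 => [(1, .r1_1)]
  | .r1_2 => [(1, .r1_2)]
  | .r3_1 => [(1, .r3_1)]
  | .r3_2 => [(1, .r3_2)]
  | .r7_1 => [(1, .r1), (1, .r3_1), (1, .r3_2)]
  | .r7_2 => [(1, .r1_2), (1, .r3_1), (1, .r3_2)]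
  | .r7_3 => [(1, .r1_1), (1, .r3_1), (1, .r3_2)]

def brPSLTo21 : IrrPSL → List (ℕ × Irr21)
  | .r1 => [(1, .r1)]
  | .r3_1 => [(1, .r3_1)]
  | .r3_2 => [(1, .r3_2)]
  | .r6 => [(1, .r3_1), (1, .r3_2)]
  | .r7 => [(1, .r1), (1, .r3_1), (1, .r3_2)]
  | .r8 => [(1, .r1_1), (1, .r1_2), (1, .r3_1), (1, .r3_2)]

/-- The table for the copy of `PSL_2(7)` that acts by permutations of coordinates: the previous one
with `7_1, 7_3` and `21_1, 21_2` interchanged. -/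
def br1344ToPSL' : Irr1344 → List (ℕ × IrrPSL)
  | .r7_1 => br1344ToPSL .r7_3
  | .r7_3 => br1344ToPSL .r7_1
  | .r21_1 => br1344ToPSL .r21_2
  | .r21_2 => br1344ToPSL .r21_1
  | i => br1344ToPSL i

end OctGroups

end

open OctGroups

/-!
No representation is constructed explicitly: everything is read off the character tables.

*From a table to the irreducible representations.* Let `χ` be a table for the finite group `G`, with
one row for each label and one column for each conjugacy class, the rows and the column of degrees
satisfying the orthogonality relations, such that moreover every row, divided by its degree, defines
a character of the centre of the group algebra, that is, respects the products of class sums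
(`CharacterTableData`). For an irreducible representation `σ`, the weighted sum over the rows of the
central elements `∑ χᵢ(g⁻¹) g` is the group order, so that some row `i` acts by a nonzero map. Since
the class sums act on its image through the central character of the row `i`, and on the space of
`σ` by scalars (Schur), the character of `σ` is proportional to this row, and both have norm `1`;
hence they are equal (`exists_character_eq`). Conversely, if a row were not an irreducible
character, then its central element would act by zero on all irreducible representations, hence on
the regular one (`exists_irreducible`). The decomposition of tensor products and restrictions is
then a matter of linear combinations of rows (`tensorRule_of_data`, `branchingRule_of_data`).

*The conditions on the tables.* A signed permutation is encoded as a number with seven hexadecimal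
digits, the images of the `eᵢ`, and a character value `a + b μ + c η + d μη` by the integers
`a, b, c, d`. For each group a Boolean function (`checkGroup`) enumerates the conjugacy class of
each representative, verifies that the union of the classes is closed under left multiplication by
the generators, hence is the whole group, that the index of the class is invariant under
conjugation, and that the relations above hold; `exists_characterTableData` shows that the value
`true` implies the existence of `CharacterTableData`, and the value is computed by the kernel. The
classes of the representatives for the subgroups are recorded at the same time, for the
restrictions.

*The groups `PSL₂(7)`.* The Bruhat decomposition gives a criterion for a homomorphism from `SL₂` of
a field in terms of finitely many kinds of relations (`BruhatData.hom`), which are verified for a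
suitable word in the generators; its kernel is the centre (`BruhatData.ker_eq_center`).
-/

/-! ### Complex representations of finite groups -/

namespace Representation

open scoped MonoidAlgebra DirectSum

section Transport

variable {G V W : Type*} [Group G] [AddCommGroup V] [Module ℂ V] [AddCommGroup W] [Module ℂ W]

theorem Equiv.isIrreducible {ρ : Representation ℂ G V} {σ : Representation ℂ G W}
    (e : ρ.Equiv σ) (h : ρ.IsIrreducible) : σ.IsIrreducible := by
  rw [irreducible_iff_isSimpleModule_asModule] at h ⊢
  let f := IntertwiningMap.equivLinearMapAsModule ρ σ e.toIntertwiningMap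
  have hf : Function.Bijective f := e.toLinearEquiv.bijective
  exact IsSimpleModule.congr (LinearEquiv.ofBijective f hf).symm

/-- The representation on `W` obtained from `ρ` along a linear equivalence. -/
noncomputable def transport (ρ : Representation ℂ G V) (e : V ≃ₗ[ℂ] W) : Representation ℂ G W :=
  (e.conjRingEquiv : Module.End ℂ V →* Module.End ℂ W).comp ρ

/-- A representation is equivalent to its transport along a linear equivalence. -/
noncomputable def transportEquiv (ρ : Representation ℂ G V) (e : V ≃ₗ[ℂ] W) :
    ρ.Equiv (ρ.transport e) :=
  .mk e fun g => by ext v; simp [transport]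

/-- Schur's lemma, for a linear map commuting with the action. -/
theorem IsIrreducible.exists_eq_smul_id [FiniteDimensional ℂ V] {σ : Representation ℂ G V}
    (hσ : σ.IsIrreducible) (f : V →ₗ[ℂ] V) (hf : ∀ g, f ∘ₗ σ g = σ g ∘ₗ f) :
    ∃ a : ℂ, f = a • LinearMap.id := by
  obtain ⟨a, ha⟩ := IsIrreducible.algebraMap_intertwiningMap_bijective_of_isAlgClosed.2
    (⟨f, hf⟩ : IntertwiningMap σ σ)
  exact ⟨a, (congrArg IntertwiningMap.toLinearMap ha).symm⟩

end Transport

section DirectSum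

variable {G ι κ : Type*} [Group G] {V : ι → Type*} [∀ i, AddCommGroup (V i)] [∀ i, Module ℂ (V i)]

/-- Componentwise equivalences, together with a bijection of the index sets, give an equivalence
of direct sums. -/
theorem nonempty_equiv_directSum {W : κ → Type*} [∀ i, AddCommGroup (W i)] [∀ i, Module ℂ (W i)]
    {ρ : ∀ i, Representation ℂ G (V i)} {σ : ∀ i, Representation ℂ G (W i)} (h : κ ≃ ι)
    (e : ∀ k, Nonempty ((ρ (h k)).Equiv (σ k))) :
    Nonempty ((directSum ρ).Equiv (directSum σ)) := by
  replace e := fun k => (e k).some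
  refine ⟨.mk ((DirectSum.lequivCongrLeft ℂ h.symm).trans
    (DFinsupp.mapRange.linearEquiv fun k => (e k).toLinearEquiv)) fun g => ?_⟩
  refine LinearMap.ext fun x => DFinsupp.ext fun k => ?_
  exact (e k).toIntertwiningMap.isIntertwining _ _ g (x (h k))

theorem character_directSum [Fintype ι] [∀ i, FiniteDimensional ℂ (V i)]
    (ρ : ∀ i, Representation ℂ G (V i)) (g : G) :
    (directSum ρ).character g = ∑ i, (ρ i).character g := by
  classical
  have h : directSum ρ g = ∑ i, DirectSum.lof ℂ ι V i ∘ₗ ρ i g ∘ₗ DirectSum.component ℂ ι V i := by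
    refine DirectSum.linearMap_ext _ fun j => LinearMap.ext fun x => ?_
    simp only [LinearMap.comp_apply, LinearMap.sum_apply, directSum_apply, DirectSum.lmap_lof]
    rw [Finset.sum_eq_single j]
    · rw [DirectSum.component.lof_self]
    · intro i _ hij
      rw [DirectSum.component.of, dif_neg (Ne.symm hij)]
      simp
    · simp
  rw [character, h, map_sum]
  refine Finset.sum_congr rfl fun i _ => ?_
  rw [LinearMap.trace_comp_comm', LinearMap.comp_assoc, character]
  congr 1
  ext x
  simp

end DirectSum

section Decomposition

variable {G : Type*} [Group G]

/-- A simple module over the group algebra, as an irreducible representation in coordinates. -/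
theorem exists_irreducible_fin {M : Type*} [AddCommGroup M] [Module ℂ M] [Module ℂ[G] M]
    [IsScalarTower ℂ ℂ[G] M] [FiniteDimensional ℂ M] (hM : IsSimpleModule ℂ[G] M) :
    ∃ (d : ℕ) (τ : Representation ℂ G (Fin d → ℂ)) (e : M ≃ₗ[ℂ] (Fin d → ℂ)),
      τ.IsIrreducible ∧ ∀ g x, e (MonoidAlgebra.of ℂ G g • x) = τ g (e x) := by
  let ρ : Representation ℂ G M :=
    ((Algebra.lsmul ℂ ℂ M : ℂ[G] →ₐ[ℂ] Module.End ℂ M) : ℂ[G] →* Module.End ℂ M).comp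
      (MonoidAlgebra.of ℂ G)
  have hρ : ρ.asAlgebraHom = Algebra.lsmul ℂ ℂ M :=
    (MonoidAlgebra.lift ℂ _ G).apply_symm_apply (Algebra.lsmul ℂ ℂ M)
  let f : M ≃ₗ[ℂ[G]] ρ.asModule :=
    { ρ.asModuleEquiv.symm with
      map_smul' := fun r x => by
        refine ρ.asModuleEquiv.injective ?_
        change r • x = ρ.asModuleEquiv (r • ρ.asModuleEquiv.symm x)
        rw [asModuleEquiv_map_smul, hρ]
        rfl }
  refine ⟨_, ρ.transport (Module.finBasis ℂ M).equivFun, (Module.finBasis ℂ M).equivFun,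
    (ρ.transportEquiv _).isIrreducible
      ((irreducible_iff_isSimpleModule_asModule ρ).2 (IsSimpleModule.congr f.symm)), fun g x => ?_⟩
  simp [transport, ρ]

/-- Maschke's theorem: every finite-dimensional representation is a direct sum of irreducible
ones. -/
theorem exists_equiv_directSum_irreducible [Finite G] {V : Type*} [AddCommGroup V] [Module ℂ V]
    [FiniteDimensional ℂ V] (ρ : Representation ℂ G V) :
    ∃ (m : ℕ) (d : Fin m → ℕ) (τ : ∀ i, Representation ℂ G (Fin (d i) → ℂ)),
      (∀ i, (τ i).IsIrreducible) ∧ Nonempty (ρ.Equiv (directSum τ)) := by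
  have : NeZero (Nat.card G : ℂ) := ⟨Nat.cast_ne_zero.2 Nat.card_pos.ne'⟩
  have : Module.Finite ℂ[G] ρ.asModule := Module.Finite.of_restrictScalars_finite ℂ _ _
  have : FiniteDimensional ℂ ρ.asModule := ρ.asModuleEquiv.symm.finiteDimensional
  obtain ⟨m, S, e, hS⟩ := IsSemisimpleModule.exists_linearEquiv_fin_dfinsupp ℂ[G] ρ.asModule
  have hfin : ∀ i, FiniteDimensional ℂ (S i) := fun i =>
    inferInstanceAs (FiniteDimensional ℂ ((S i).restrictScalars ℂ))
  choose d τ f hτ hf using fun i => exists_irreducible_fin (hS i)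
  refine ⟨m, d, τ, hτ, ⟨.mk ((ρ.asModuleEquiv.symm.trans (e.restrictScalars ℂ)).trans
    (DFinsupp.mapRange.linearEquiv f)) fun g => ?_⟩⟩
  refine LinearMap.ext fun v => DFinsupp.ext fun i => ?_
  change f i (e (ρ.asModuleEquiv.symm (ρ g v)) i) = τ i g (f i (e (ρ.asModuleEquiv.symm v) i))
  rw [asModuleEquiv_symm_map_rho, map_smul, ← hf]
  rfl

end Decomposition

end Representation

/-! ### The irreducible characters of a finite group from its table -/

/-- Numerical evidence that `χ` is the character table of the finite group `G`, the columns being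
indexed by the representatives `c` of the conjugacy classes. -/
structure CharacterTableData (G : Type*) [Group G] [Fintype G] {L ι : Type*} [Fintype L]
    [DecidableEq L] [DecidableEq ι] (c : ι → G) (χ : L → ι → ℂ) where
  /-- The index of the conjugacy class of an element. -/
  cl : G → ι
  cl_conj : ∀ x g, cl (x * g * x⁻¹) = cl g
  cl_rep : ∀ j, cl (c j) = j
  isConj : ∀ g, IsConj (c (cl g)) g
  /-- The degree of a character. -/
  deg : L → ℕ
  deg_pos : ∀ i, 0 < deg i
  deg_eq : ∀ i, χ i (cl 1) = deg i
  /-- Orthogonality of each column with the column of degrees. -/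
  column_orthogonality : ∀ j, ∑ i, χ i (cl 1) * χ i j = if j = cl 1 then (Fintype.card G : ℂ) else 0
  /-- Orthogonality of the rows. -/
  row_orthogonality : ∀ i k,
    ∑ g, χ i (cl g) * χ k (cl g⁻¹) = if i = k then (Fintype.card G : ℂ) else 0
  /-- Each row defines an algebra homomorphism on the centre of the group algebra. -/
  central : ∀ i j k, (deg i : ℂ) * ∑ y with cl y = j, χ i (cl (c k * y)) =
    ({y | cl y = j} : Finset G).card * (χ i k * χ i j)

namespace CharacterTableData

open Representation

variable {G : Type*} [Group G] [Fintype G] {L ι : Type*} [Fintype L]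
    [DecidableEq L] [DecidableEq ι] {c : ι → G} {χ : L → ι → ℂ} (D : CharacterTableData G c χ)

include D

theorem cl_eq_iff {g h : G} : D.cl g = D.cl h ↔ IsConj g h := by
  refine ⟨fun e => ?_, fun e => ?_⟩
  · have := D.isConj h
    rw [← e] at this
    exact (D.isConj g).symm.trans this
  · obtain ⟨x, rfl⟩ := isConj_iff.1 e
    exact (D.cl_conj x g).symm

theorem character_eq_of_cl {V : Type*} [AddCommGroup V] [Module ℂ V] (σ : Representation ℂ G V)
    (g : G) : σ.character g = σ.character (c (D.cl g)) := by
  obtain ⟨x, hx⟩ := isConj_iff.1 (D.isConj g)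
  rw [← char_conj σ (c (D.cl g)) x, hx]

theorem central_apply (i : L) (j : ι) (g : G) :
    (D.deg i : ℂ) * ∑ y with D.cl y = j, χ i (D.cl (g * y)) =
      ({y | D.cl y = j} : Finset G).card * (χ i (D.cl g) * χ i j) := by
  rw [← D.central i j (D.cl g)]
  congr 1
  obtain ⟨x, hx⟩ := isConj_iff.1 (D.isConj g)
  refine Finset.sum_bij' (fun y _ => x⁻¹ * y * x) (fun y _ => x * y * x⁻¹) ?_ ?_ ?_ ?_ ?_
  · intro y hy
    simpa [D.cl_conj] using (D.cl_conj x⁻¹ y).trans (Finset.mem_filter.1 hy).2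
  · intro y hy
    simpa [D.cl_conj] using hy
  · intro y _
    group
  · intro y _
    group
  · intro y _
    rw [← D.cl_conj x (c (D.cl g) * _)]
    nth_rw 1 [← hx]
    congr 1
    group

variable {V : Type*} [AddCommGroup V] [Module ℂ V]

/-- The action of the class sum of the `j`-th conjugacy class. -/
noncomputable def classSum (σ : Representation ℂ G V) (j : ι) : V →ₗ[ℂ] V :=
  ∑ y with D.cl y = j, σ y

/-- The action of the central element `∑ χᵢ(g⁻¹) g`, a multiple of the `i`-th central idempotent. -/
noncomputable def rowSum (σ : Representation ℂ G V) (i : L) : V →ₗ[ℂ] V :=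
  ∑ g, χ i (D.cl g⁻¹) • σ g

theorem classSum_commute (σ : Representation ℂ G V) (j : ι) (g : G) :
    D.classSum σ j ∘ₗ σ g = σ g ∘ₗ D.classSum σ j := by
  have : D.classSum σ j * σ g = σ g * D.classSum σ j := by
    simp only [classSum, Finset.sum_mul, Finset.mul_sum, ← map_mul]
    refine Finset.sum_bij' (fun y _ => g⁻¹ * y * g) (fun y _ => g * y * g⁻¹) ?_ ?_ ?_ ?_ ?_
    · intro y hy
      simpa using (D.cl_conj g⁻¹ y).trans (Finset.mem_filter.1 hy).2
    · intro y hy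
      simpa [D.cl_conj] using hy
    · intro y _
      group
    · intro y _
      group
    · intro y _
      congr 1
      group
  exact this

theorem rowSum_commute (σ : Representation ℂ G V) (i : L) (g : G) :
    D.rowSum σ i ∘ₗ σ g = σ g ∘ₗ D.rowSum σ i := by
  have : D.rowSum σ i * σ g = σ g * D.rowSum σ i := by
    simp only [rowSum, Finset.sum_mul, Finset.mul_sum, smul_mul_assoc, mul_smul_comm, ← map_mul]
    refine Fintype.sum_equiv (MulAut.conj g⁻¹).toEquiv _ _ fun y => ?_
    simp only [MulEquiv.toEquiv_eq_coe, MulEquiv.coe_toEquiv, MulAut.conj_apply]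
    congr 1
    · rw [← D.cl_conj g⁻¹ y⁻¹]
      group
    · congr 1
      group
  exact this

/-- The sum of the central elements of all rows, weighted by the degrees, is the group order. -/
theorem sum_rowSum (σ : Representation ℂ G V) :
    ∑ i, χ i (D.cl 1) • D.rowSum σ i = (Fintype.card G : ℂ) • LinearMap.id := by
  classical
  have h : ∀ g : G, ∑ i, (χ i (D.cl 1) * χ i (D.cl g⁻¹)) • σ g =
      if g = 1 then (Fintype.card G : ℂ) • σ g else 0 := by
    intro g
    rw [← Finset.sum_smul, D.column_orthogonality]
    by_cases hg : g = 1
    · simp [hg]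
    · have : D.cl g⁻¹ ≠ D.cl 1 := fun e => hg <| by
        simpa using isConj_one_left.1 (D.cl_eq_iff.1 e)
      simp [hg, this]
  simp only [rowSum, Finset.smul_sum, smul_smul]
  rw [Finset.sum_comm]
  simp only [h, Finset.sum_ite_eq', Finset.mem_univ, if_true, map_one]
  rfl

/-- The class sums act on the image of the `i`-th row through the `i`-th central character. -/
theorem classSum_comp_rowSum (σ : Representation ℂ G V) (i : L) (j : ι) :
    (D.deg i : ℂ) • (D.classSum σ j ∘ₗ D.rowSum σ i) =
      (({y | D.cl y = j} : Finset G).card * χ i j) • D.rowSum σ i := by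
  have h : D.classSum σ j * D.rowSum σ i =
      ∑ g, (∑ y with D.cl y = j, χ i (D.cl (g⁻¹ * y))) • σ g := by
    simp only [classSum, rowSum, Finset.sum_mul, Finset.mul_sum, mul_smul_comm, ← map_mul,
      Finset.sum_smul]
    simp only [Finset.smul_sum]
    rw [Finset.sum_comm]
    conv_rhs => rw [Finset.sum_comm]
    refine Finset.sum_congr rfl fun y _ => ?_
    refine Fintype.sum_equiv (Equiv.mulLeft y) _ _ fun g => ?_
    simp
  change (D.deg i : ℂ) • (D.classSum σ j * D.rowSum σ i) = _
  rw [h, rowSum, Finset.smul_sum, Finset.smul_sum]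
  refine Finset.sum_congr rfl fun g _ => ?_
  rw [smul_smul, smul_smul, D.central_apply]
  ring_nf

theorem trace_rowSum (σ : Representation ℂ G V) (i : L) :
    LinearMap.trace ℂ V (D.rowSum σ i) = ∑ g, χ i (D.cl g⁻¹) * σ.character g := by
  simp [rowSum, character]

theorem trace_classSum (σ : Representation ℂ G V) (j : ι) :
    LinearMap.trace ℂ V (D.classSum σ j) =
      ({y | D.cl y = j} : Finset G).card * σ.character (c j) := by
  rw [classSum, map_sum, Finset.sum_congr rfl (g := fun _ => σ.character (c j)), Finset.sum_const,
    nsmul_eq_mul]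
  intro y hy
  rw [← (Finset.mem_filter.1 hy).2, ← D.character_eq_of_cl]
  rfl

/-- Every irreducible character is a row of the table: the class sums act through some central
character of the table, and the norm determines the degree. -/
theorem exists_character_eq [FiniteDimensional ℂ V] (σ : Representation ℂ G V)
    (hσ : σ.IsIrreducible) : ∃ i, ∀ g, σ.character g = χ i (D.cl g) := by
  have hcard : (Fintype.card G : ℂ) ≠ 0 := Nat.cast_ne_zero.2 Fintype.card_ne_zero
  have hV : Nontrivial V := by
    have := hσ.toNontrivial
    by_contra hV
    rw [not_nontrivial_iff_subsingleton] at hV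
    exact not_subsingleton (Subrepresentation σ) ⟨fun a b => by
      ext v; simp [Subsingleton.elim v 0]⟩
  -- some row does not act by zero
  obtain ⟨i, hi⟩ : ∃ i, D.rowSum σ i ≠ 0 := by
    by_contra! h
    have := D.sum_rowSum σ
    simp only [h, smul_zero, Finset.sum_const_zero] at this
    obtain ⟨v, hv⟩ := exists_ne (0 : V)
    have := congrArg (fun f => f v) this
    exact smul_ne_zero hcard hv this.symm
  have hd : (D.deg i : ℂ) ≠ 0 := Nat.cast_ne_zero.2 (D.deg_pos i).ne'
  -- up to the ratio of the degrees, the character is the row `i`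
  have hratio : ∀ g, (D.deg i : ℂ) * σ.character g = Module.finrank ℂ V * χ i (D.cl g) := by
    intro g
    rw [D.character_eq_of_cl]
    set j := D.cl g
    obtain ⟨a, ha⟩ := hσ.exists_eq_smul_id _ (D.classSum_commute σ j)
    have hs : (({y | D.cl y = j} : Finset G).card : ℂ) ≠ 0 :=
      Nat.cast_ne_zero.2 (Finset.card_ne_zero.2 ⟨g, by simp [j]⟩)
    have h1 := D.classSum_comp_rowSum σ i j
    rw [ha, LinearMap.smul_comp, LinearMap.id_comp, smul_smul] at h1
    have h2 := smul_left_injective ℂ hi h1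
    have h3 := D.trace_classSum σ j
    rw [ha, map_smul, LinearMap.trace_id, smul_eq_mul] at h3
    apply mul_left_cancel₀ hs
    linear_combination (Module.finrank ℂ V : ℂ) * h2 - (D.deg i : ℂ) * h3
  have hnorm : ∑ g, σ.character g * σ.character g⁻¹ = Fintype.card G := by
    have : Invertible (Nat.card G : ℂ) :=
      invertibleOfNonzero (by rw [Nat.card_eq_fintype_card]; exact hcard)
    have := char_orthonormal σ σ
    rw [if_pos ⟨Representation.Equiv.refl σ⟩, Nat.card_eq_fintype_card,
      inv_mul_eq_one₀ hcard] at this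
    exact this.symm
  have hsq : (D.deg i : ℂ) ^ 2 = (Module.finrank ℂ V : ℂ) ^ 2 := by
    have h := D.row_orthogonality i i
    rw [if_pos rfl] at h
    apply mul_right_cancel₀ hcard
    conv_lhs => rw [← hnorm]
    rw [← h, Finset.mul_sum, Finset.mul_sum]
    refine Finset.sum_congr rfl fun g _ => ?_
    linear_combination (D.deg i * σ.character g⁻¹) * hratio g +
      (Module.finrank ℂ V * χ i (D.cl g)) * hratio g⁻¹
  have hdim : (D.deg i : ℂ) = Module.finrank ℂ V := by
    have : D.deg i ^ 2 = Module.finrank ℂ V ^ 2 := by exact_mod_cast hsq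
    exact_mod_cast Nat.pow_left_injective two_ne_zero this
  refine ⟨i, fun g => mul_left_cancel₀ hd ?_⟩
  rw [hratio, hdim]

theorem row_injective {i k : L} (h : ∀ g, χ i (D.cl g) = χ k (D.cl g)) : i = k := by
  by_contra hik
  have h1 := D.row_orthogonality i k
  have h2 := D.row_orthogonality k k
  simp only [h] at h1
  rw [h1, if_neg hik, if_pos rfl] at h2
  exact Nat.cast_ne_zero.2 Fintype.card_ne_zero h2.symm

/-- Every row of the table is an irreducible character, since otherwise the central idempotent
of the row would act by zero on the regular representation. -/
theorem exists_irreducible (i : L) : ∃ (d : ℕ) (τ : Representation ℂ G (Fin d → ℂ)),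
    τ.IsIrreducible ∧ ∀ g, τ.character g = χ i (D.cl g) := by
  classical
  by_contra! hne
  have hzero : ∀ (d : ℕ) (τ : Representation ℂ G (Fin d → ℂ)), τ.IsIrreducible →
      D.rowSum τ i = 0 := by
    intro d τ hτ
    obtain ⟨a, ha⟩ := hτ.exists_eq_smul_id _ (D.rowSum_commute τ i)
    obtain ⟨k, hk⟩ := D.exists_character_eq τ hτ
    have hki : k ≠ i := by
      rintro rfl
      obtain ⟨g, hg⟩ := hne d τ hτ
      exact hg (hk g)
    have htr := D.trace_rowSum τ i
    have hrow := D.row_orthogonality k i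
    rw [if_neg hki] at hrow
    simp only [hk, mul_comm (χ i _)] at htr
    rw [hrow, ha, map_smul, LinearMap.trace_id, smul_eq_mul] at htr
    rcases mul_eq_zero.1 htr with h | h
    · rw [ha, h, zero_smul]
    · have : Subsingleton (Fin d → ℂ) :=
        Module.finrank_zero_iff (R := ℂ).1 (by exact_mod_cast h)
      exact Subsingleton.elim _ _
  obtain ⟨m, d, τ, hτ, ⟨e⟩⟩ := exists_equiv_directSum_irreducible (leftRegular ℂ G)
  have hreg : D.rowSum (leftRegular ℂ G) i = 0 := by
    refine LinearMap.ext fun v => e.toLinearEquiv.injective (DFinsupp.ext fun k => ?_)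
    change DirectSum.component ℂ _ _ k (e.toIntertwiningMap _) =
      DirectSum.component ℂ _ _ k (e.toLinearEquiv 0)
    have h0 : D.rowSum (τ k) i (DirectSum.component ℂ _ _ k (e.toIntertwiningMap v)) = 0 := by
      rw [hzero _ _ (hτ k), LinearMap.zero_apply]
    rw [map_zero, map_zero, ← h0]
    simp only [rowSum, LinearMap.sum_apply, LinearMap.smul_apply, map_sum, map_smul,
      e.toIntertwiningMap.isIntertwining]
    rfl
  have h1 := congrArg (fun f => (f (MonoidAlgebra.single 1 1)).coeff 1) hreg
  simp only [rowSum, LinearMap.sum_apply, LinearMap.smul_apply, leftRegular, ofMulAction_single,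
    smul_eq_mul, mul_one, MonoidAlgebra.smul_single, MonoidAlgebra.coeff_sum,
    Finsupp.finsetSum_apply, MonoidAlgebra.coeff_single, Finsupp.single_apply, Finset.sum_ite_eq',
    Finset.mem_univ, if_true, inv_one, D.deg_eq, LinearMap.zero_apply, MonoidAlgebra.coeff_zero,
    Finsupp.coe_zero, Pi.zero_apply, Nat.cast_eq_zero] at h1
  exact (D.deg_pos i).ne' h1

end CharacterTableData

namespace OctGroups

open Representation

variable {G : Subgroup SPerm} [Fintype G] {L : Type} [Fintype L] [DecidableEq L] {n : ℕ}
    {cls : Fin n → SPerm} {χ : L → Fin n → ℂ} {hcls : ∀ j, cls j ∈ G}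

theorem nonempty_irrepSystem
    (D : CharacterTableData G (fun j => (⟨cls j, hcls j⟩ : G)) χ) :
    Nonempty (IrrepSystem.{u} G cls χ) := by
  have hcard : (Fintype.card G : ℂ) ≠ 0 := Nat.cast_ne_zero.2 Fintype.card_ne_zero
  choose d τ hτ hchar using D.exists_irreducible
  refine ⟨⟨d, τ, hτ, hcls, fun g => ⟨D.cl g, D.isConj g, fun j hj => ?_⟩, fun i j => ?_, ?_⟩⟩
  · rw [← D.cl_eq_iff.2 hj, D.cl_rep]
  · rw [hchar, D.cl_rep]
  · intro V _ _ _ σ hσ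
    obtain ⟨i, hi⟩ := D.exists_character_eq σ hσ
    refine ⟨i, ?_, fun k ⟨e⟩ => D.row_injective fun g => ?_⟩
    · have : Invertible (Nat.card G : ℂ) :=
        invertibleOfNonzero (by rw [Nat.card_eq_fintype_card]; exact hcard)
      have := hτ i
      have h := char_orthonormal (τ i) σ
      simp only [hi, hchar, D.row_orthogonality, if_true, Nat.card_eq_fintype_card] at h
      rw [inv_mul_cancel₀ hcard] at h
      by_contra hne
      simp only [] at hne
      rw [if_neg hne] at h
      exact one_ne_zero h
    · rw [← hchar, ← hi, char_iso e]

theorem IrrepSystem.character_apply (S : IrrepSystem.{u} G cls χ)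
    (D : CharacterTableData G (fun j => (⟨cls j, hcls j⟩ : G)) χ) (i : L) (g : G) :
    (S.rep i).character g = χ i (D.cl g) := by
  rw [D.character_eq_of_cl, ← S.character_eq]

/-- A representation whose character is a sum of rows of the table is the corresponding direct sum
of irreducible representations: it is a sum of irreducible ones by Maschke's theorem, and the
orthogonality of the rows determines the multiplicities. -/
theorem IrrepSystem.nonempty_equiv_sum (S : IrrepSystem.{u} G cls χ)
    (D : CharacterTableData G (fun j => (⟨cls j, hcls j⟩ : G)) χ) {V : Type*} [AddCommGroup V]
    [Module ℂ V] [FiniteDimensional ℂ V] (σ : Representation ℂ G V) (m : L → ℕ)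
    (h : ∀ j, σ.character ⟨cls j, hcls j⟩ = ∑ k, m k * χ k j) :
    Nonempty (σ.Equiv (S.sum m)) := by
  have hcard : (Fintype.card G : ℂ) ≠ 0 := Nat.cast_ne_zero.2 Fintype.card_ne_zero
  obtain ⟨r, d, τ, hτ, ⟨e⟩⟩ := exists_equiv_directSum_irreducible σ
  have hex : ∀ j, ∃ k, Nonempty ((τ j).Equiv (S.rep k)) := fun j => by
    let E := transportEquiv (τ j) (ULift.moduleEquiv.{0, 0, u} (R := ℂ) (M := Fin (d j) → ℂ)).symm
    obtain ⟨k, ⟨e⟩, -⟩ := S.complete _ _ (E.isIrreducible (hτ j))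
    exact ⟨k, ⟨E.trans e⟩⟩
  choose f hf using hex
  -- the number of summands with a given label
  have hcount : ∀ k, Fintype.card {j // f j = k} = m k := by
    intro k
    have h1 : ∀ g, σ.character g = ∑ l, (Fintype.card {j // f j = l} : ℂ) * χ l (D.cl g) := by
      intro g
      rw [char_iso e, character_directSum, ← Finset.sum_fiberwise _ f]
      refine Finset.sum_congr rfl fun l _ => ?_
      rw [Fintype.card_subtype, ← nsmul_eq_mul]
      refine Finset.sum_eq_card_nsmul fun j hj => ?_
      rw [char_iso (hf j).some, S.character_apply D, (Finset.mem_filter.1 hj).2]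
    have h2 : ∀ g, σ.character g = ∑ l, (m l : ℂ) * χ l (D.cl g) := fun g => by
      rw [D.character_eq_of_cl, h]
    have key : ∀ a : L → ℕ, (∀ g, σ.character g = ∑ l, (a l : ℂ) * χ l (D.cl g)) →
        ∑ g, σ.character g * χ k (D.cl g⁻¹) = a k * Fintype.card G := by
      intro a ha
      simp only [ha, Finset.sum_mul]
      rw [Finset.sum_comm]
      simp only [mul_assoc, ← Finset.mul_sum, D.row_orthogonality, mul_ite, mul_zero]
      simp
    have := (key _ h1).symm.trans (key _ h2)
    exact_mod_cast mul_right_cancel₀ hcard this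
  let E : (Σ k : L, Fin (m k)) ≃ Fin r :=
    (Equiv.sigmaCongrRight fun k => (Fintype.equivFinOfCardEq (hcount k)).symm).trans
      (Equiv.sigmaFiberEquiv f)
  have hE : ∀ p, f (E p) = p.1 := fun p =>
    ((Fintype.equivFinOfCardEq (hcount p.1)).symm p.2).2
  refine ⟨e.trans (nonempty_equiv_directSum E fun p => ?_).some⟩
  rw [← hE p]
  exact hf (E p)

/-- The decomposition of tensor products can be read off the character table. -/
theorem tensorRule_of_data
    (D : CharacterTableData G (fun j => (⟨cls j, hcls j⟩ : G)) χ) (t : L → L → List (ℕ × L))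
    (h : ∀ i k j, χ i j * χ k j = ∑ l, ((mult (t i k) ⊔ mult (t k i)) l : ℕ) * χ l j) :
    TensorRule.{u} G cls χ t := by
  refine ⟨nonempty_irrepSystem D, fun S i k => S.nonempty_equiv_sum D _ _ fun j => ?_⟩
  rw [char_tensor, Pi.mul_apply, S.character_eq, S.character_eq, h]

/-- The decomposition of restrictions can be read off the character tables. -/
theorem branchingRule_of_data {H : Subgroup SPerm} [Fintype H] {L' : Type} [Fintype L']
    [DecidableEq L'] {n' : ℕ} {cls' : Fin n' → SPerm} {χ' : L' → Fin n' → ℂ}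
    {hcls' : ∀ j, cls' j ∈ H}
    (D : CharacterTableData G (fun j => (⟨cls j, hcls j⟩ : G)) χ)
    (D' : CharacterTableData H (fun j => (⟨cls' j, hcls' j⟩ : H)) χ')
    (hHG : H ≤ G) (b : L → List (ℕ × L'))
    (h : ∀ i j, χ i (D.cl ⟨cls' j, hHG (hcls' j)⟩) = ∑ l, (mult (b i) l : ℂ) * χ' l j) :
    BranchingRule.{u} G H cls χ cls' χ' b := by
  refine ⟨nonempty_irrepSystem D, nonempty_irrepSystem D', hHG, fun S S' i =>
    S'.nonempty_equiv_sum D' _ _ fun j => ?_⟩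
  rw [← h, ← S.character_apply D]
  rfl

end OctGroups

noncomputable section

namespace OctGroups

/-! ### Numerical codes of signed permutations -/

/-- The signed permutations: the permutations that commute with `x ↦ -x`. -/
def signedPerms : Subgroup SPerm := Subgroup.centralizer {signed 1 Finset.univ}

theorem apply_neg_of_mem {f : SPerm} (hf : f ∈ signedPerms) (i : Fin 7) (ε : ℤˣ) :
    f (i, -ε) = ((f (i, ε)).1, -(f (i, ε)).2) := by
  have := congrArg (fun g : SPerm => g (i, ε)) (Subgroup.mem_centralizer_singleton_iff.1 hf)
  simpa [signed] using this

theorem signed_mem (π : Equiv.Perm (Fin 7)) (neg : Finset (Fin 7)) :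
    signed π neg ∈ signedPerms := by
  refine Subgroup.mem_centralizer_singleton_iff.2 (Equiv.ext fun ⟨i, ε⟩ => ?_)
  by_cases h : i ∈ neg <;> simp [signed, h]

/-- The hexadecimal digit of `± eᵢ`: the index, with the bit `8` for a minus sign. -/
def digit (x : Fin 7 × ℤˣ) : ℕ := x.1.val + if x.2 = 1 then 0 else 8

/-- A signed permutation as a hexadecimal number whose digits are the images of `e₀, …, e₆`. -/
def code (f : SPerm) : ℕ :=
  digit (f (0, 1)) + 16 * (digit (f (1, 1)) + 16 * (digit (f (2, 1)) + 16 * (digit (f (3, 1)) +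
    16 * (digit (f (4, 1)) + 16 * (digit (f (5, 1)) + 16 * digit (f (6, 1)))))))

/-- The image, under the signed permutation with code `a`, of the signed unit whose digit is the
last digit of `x`. -/
def codeApply (a x : ℕ) : ℕ :=
  Nat.xor (Nat.land (Nat.shiftRight a (Nat.mul 4 (Nat.land x 7))) 15) (Nat.land x 8)

/-- The code of a product, computed from the codes of the factors. -/
def codeMul (a b : ℕ) : ℕ :=
  Nat.add (codeApply a b) (Nat.mul 16 (Nat.add (codeApply a (Nat.shiftRight b 4))
    (Nat.mul 16 (Nat.add (codeApply a (Nat.shiftRight b 8))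
    (Nat.mul 16 (Nat.add (codeApply a (Nat.shiftRight b 12))
    (Nat.mul 16 (Nat.add (codeApply a (Nat.shiftRight b 16))
    (Nat.mul 16 (Nat.add (codeApply a (Nat.shiftRight b 20))
    (Nat.mul 16 (codeApply a (Nat.shiftRight b 24)))))))))))))

theorem digit_lt (x : Fin 7 × ℤˣ) : digit x < 16 := by
  revert x; decide

theorem digit_injective : Function.Injective digit := by
  intro x y; revert x y; decide

theorem code_div_mod (f : SPerm) (i : Fin 7) : code f / 16 ^ i.val % 16 = digit (f (i, 1)) := by
  have h0 := digit_lt (f (0, 1))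
  have h1 := digit_lt (f (1, 1))
  have h2 := digit_lt (f (2, 1))
  have h3 := digit_lt (f (3, 1))
  have h4 := digit_lt (f (4, 1))
  have h5 := digit_lt (f (5, 1))
  have h6 := digit_lt (f (6, 1))
  fin_cases i <;> simp only [code, Fin.reduceFinMk, Fin.zero_eta, Fin.mk_one] <;> norm_num <;> omega

theorem code_injective {f g : SPerm} (hf : f ∈ signedPerms) (hg : g ∈ signedPerms)
    (h : code f = code g) : f = g := by
  have h1 : ∀ i, f (i, 1) = g (i, 1) := fun i =>
    digit_injective (by rw [← code_div_mod, h, code_div_mod])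
  refine Equiv.ext fun ⟨i, ε⟩ => ?_
  rcases Int.units_eq_one_or ε with rfl | rfl
  · exact h1 i
  · rw [apply_neg_of_mem hf, apply_neg_of_mem hg, h1]

theorem shiftRight_land_fifteen (a i : ℕ) :
    Nat.land (Nat.shiftRight a (Nat.mul 4 i)) 15 = a / 16 ^ i % 16 := by
  change (a >>> (4 * i)) &&& 15 = _
  rw [Nat.shiftRight_eq_div_pow, Nat.pow_mul, show (15 : ℕ) = 2 ^ 4 - 1 from rfl,
    Nat.and_two_pow_sub_one_eq_mod]

theorem codeApply_code {f : SPerm} (hf : f ∈ signedPerms) {x : Fin 7 × ℤˣ} {y : ℕ}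
    (hy : y % 16 = digit x) : codeApply (code f) y = digit (f x) := by
  have h7 : Nat.land y 7 = x.1.val := by
    have : Nat.land y 7 = y % 16 % 8 := by
      change y &&& (2 ^ 3 - 1) = _
      rw [Nat.and_two_pow_sub_one_eq_mod]
      omega
    rw [this, hy]
    clear hy
    revert x; decide
  have h8 : Nat.land y 8 = if x.2 = 1 then 0 else 8 := by
    have : Nat.land y 8 = Nat.land (y % 16) 8 := by
      change y &&& 8 = (y % 2 ^ 4) &&& 8
      rw [← Nat.and_two_pow_sub_one_eq_mod, Nat.and_assoc]
      rfl
    rw [this, hy]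
    clear this h7 hy
    revert x; decide
  rw [codeApply, h7, h8, shiftRight_land_fifteen, code_div_mod]
  obtain ⟨i, ε⟩ := x
  rcases Int.units_eq_one_or ε with rfl | rfl
  · simp
  · rw [apply_neg_of_mem hf]
    generalize f (i, 1) = z
    change (digit z).xor 8 = _
    clear hy h7 h8
    revert z; decide

theorem code_mul {f g : SPerm} (hf : f ∈ signedPerms) :
    code (f * g) = codeMul (code f) (code g) := by
  have h : ∀ (i : Fin 7) (k : ℕ), k = 4 * i.val →
      codeApply (code f) (Nat.shiftRight (code g) k) = digit (f (g (i, 1))) := by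
    rintro i _ rfl
    refine codeApply_code hf ?_
    rw [← code_div_mod g i]
    change code g >>> (4 * i.val) % 16 = _
    rw [Nat.shiftRight_eq_div_pow, Nat.pow_mul]
  simp only [codeMul, h 1 4 rfl, h 2 8 rfl, h 3 12 rfl, h 4 16 rfl, h 5 20 rfl, h 6 24 rfl]
  rw [show codeApply (code f) (code g) = _ from h 0 0 rfl]
  rfl

/-! ### Arithmetic in kernel reduction -/

/-- Applies `f` to a natural number. The recursion makes kernel reduction evaluate the number to a
literal before it is substituted into `f`, which thus does not repeat the evaluation. -/
def force {α : Type} (n : ℕ) (f : ℕ → α) : α :=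
  Nat.rec (f 0) (fun k _ => f (Nat.succ k)) n

theorem force_eq {α : Type} (n : ℕ) (f : ℕ → α) : force n f = f n := by
  cases n <;> rfl

/-! ### The ring generated by the character values -/

/-- The integer `p - m`, as a pair of natural numbers. -/
structure Diff where
  p : ℕ
  m : ℕ

namespace Diff

/-- The integer represented by a pair. -/
def toInt (x : Diff) : ℤ := x.p - x.m

def ofNat (n : ℕ) : Diff := ⟨n, 0⟩

def add (x y : Diff) : Diff := ⟨Nat.add x.p y.p, Nat.add x.m y.m⟩

def neg (x : Diff) : Diff := ⟨x.m, x.p⟩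

def nsmul (n : ℕ) (x : Diff) : Diff := ⟨Nat.mul n x.p, Nat.mul n x.m⟩

def mul (x y : Diff) : Diff :=
  ⟨Nat.add (Nat.mul x.p y.p) (Nat.mul x.m y.m), Nat.add (Nat.mul x.p y.m) (Nat.mul x.m y.p)⟩

def beq (x y : Diff) : Bool := Nat.beq (Nat.add x.p y.m) (Nat.add y.p x.m)

theorem toInt_ofNat (n : ℕ) : (ofNat n).toInt = n := by simp [toInt, ofNat]

theorem toInt_add (x y : Diff) : (add x y).toInt = x.toInt + y.toInt := by
  simp only [toInt, add, Nat.add_eq]; push_cast; ring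

theorem toInt_neg (x : Diff) : (neg x).toInt = -x.toInt := by
  simp only [toInt, neg]; ring

theorem toInt_nsmul (n : ℕ) (x : Diff) : (nsmul n x).toInt = n * x.toInt := by
  simp only [toInt, nsmul, Nat.mul_eq]; push_cast; ring

theorem toInt_mul (x y : Diff) : (mul x y).toInt = x.toInt * y.toInt := by
  simp only [toInt, mul, Nat.add_eq, Nat.mul_eq]; push_cast; ring

theorem toInt_eq_of_beq {x y : Diff} (h : beq x y = true) : x.toInt = y.toInt := by
  have := Nat.eq_of_beq_eq_true h
  simp only [Nat.add_eq] at this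
  simp only [toInt]
  omega

end Diff

/-- The number `a + b μ + c η + d μη`. -/
structure Cyc where
  a : Diff
  b : Diff
  c : Diff
  d : Diff

namespace Cyc

/-- The complex number represented by an element of `Cyc`. -/
def toComplex (x : Cyc) : ℂ :=
  x.a.toInt + x.b.toInt * mu + x.c.toInt * eta + x.d.toInt * (mu * eta)

/-- The constructor, with evaluation of the coordinates in kernel reduction. -/
def mkForced (a b c d : Diff) : Cyc :=
  force a.p fun ap => force a.m fun am => force b.p fun bp => force b.m fun bm =>
    force c.p fun cp => force c.m fun cm => force d.p fun dp => force d.m fun dm =>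
      ⟨⟨ap, am⟩, ⟨bp, bm⟩, ⟨cp, cm⟩, ⟨dp, dm⟩⟩

theorem mkForced_eq (a b c d : Diff) : mkForced a b c d = ⟨a, b, c, d⟩ := by
  simp only [mkForced, force_eq]

def ofNat (n : ℕ) : Cyc := ⟨.ofNat n, .ofNat 0, .ofNat 0, .ofNat 0⟩

def add (x y : Cyc) : Cyc := mkForced (x.a.add y.a) (x.b.add y.b) (x.c.add y.c) (x.d.add y.d)

def nsmul (n : ℕ) (x : Cyc) : Cyc :=
  mkForced (x.a.nsmul n) (x.b.nsmul n) (x.c.nsmul n) (x.d.nsmul n)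

/-- The product, by `μ² = -1 - μ` and `η² = -2 - η`. -/
def mulAux (x y : Cyc) : Cyc :=
  mkForced
    (((x.a.mul y.a).add (x.b.mul y.b).neg).add
      (((x.c.mul y.c).neg.add (x.d.mul y.d)).nsmul 2))
    ((((x.a.mul y.b).add (x.b.mul y.a)).add (x.b.mul y.b).neg).add
      ((((x.c.mul y.d).add (x.d.mul y.c)).neg.add (x.d.mul y.d)).nsmul 2))
    ((((x.a.mul y.c).add (x.c.mul y.a)).add (x.d.mul y.d)).add
      (((x.b.mul y.d).add (x.d.mul y.b)).add (x.c.mul y.c)).neg)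
    (((((x.a.mul y.d).add (x.d.mul y.a)).add ((x.b.mul y.c).add (x.c.mul y.b))).add
      (x.d.mul y.d)).add (((x.b.mul y.d).add (x.d.mul y.b)).add
        ((x.c.mul y.d).add (x.d.mul y.c))).neg)

/-- Whether the coordinates other than the first are `0 - 0`, a sufficient condition for a number
to be rational. -/
def isRat (x : Cyc) : Bool :=
  Nat.beq (Nat.add (Nat.add (Nat.add x.b.p x.b.m) (Nat.add x.c.p x.c.m))
    (Nat.add x.d.p x.d.m)) 0

/-- Multiplication, with a shortcut for rational factors. -/
def mul (x y : Cyc) : Cyc :=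
  match isRat x, isRat y with
  | true, _ => mkForced (x.a.mul y.a) (x.a.mul y.b) (x.a.mul y.c) (x.a.mul y.d)
  | _, true => mkForced (y.a.mul x.a) (y.a.mul x.b) (y.a.mul x.c) (y.a.mul x.d)
  | _, _ => mulAux x y

/-- Equality of coordinates. -/
def beq (x y : Cyc) : Bool :=
  Diff.beq x.a y.a && (Diff.beq x.b y.b && (Diff.beq x.c y.c && Diff.beq x.d y.d))

theorem toComplex_eq_of_beq {x y : Cyc} (h : beq x y = true) : x.toComplex = y.toComplex := by
  simp only [beq, Bool.and_eq_true] at h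
  simp only [toComplex, Diff.toInt_eq_of_beq h.1, Diff.toInt_eq_of_beq h.2.1,
    Diff.toInt_eq_of_beq h.2.2.1, Diff.toInt_eq_of_beq h.2.2.2]

theorem toComplex_ofNat (n : ℕ) : (ofNat n).toComplex = n := by
  simp [toComplex, ofNat, Diff.toInt_ofNat]

instance (n : ℕ) : OfNat Cyc n := ⟨ofNat n⟩

instance : Neg Cyc := ⟨fun x => ⟨x.a.neg, x.b.neg, x.c.neg, x.d.neg⟩⟩

/-- The primitive cube root of unity `μ = (-1 + i√3) / 2`. -/
def μ : Cyc := ⟨.ofNat 0, .ofNat 1, .ofNat 0, .ofNat 0⟩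
/-- `μbar = -1 - μ`. -/
def μbar : Cyc := ⟨⟨0, 1⟩, ⟨0, 1⟩, .ofNat 0, .ofNat 0⟩
/-- `η = (-1 + i√7) / 2`, a root of `x² + x + 2`. -/
def η : Cyc := ⟨.ofNat 0, .ofNat 0, .ofNat 1, .ofNat 0⟩
/-- `ηbar = -1 - η`. -/
def ηbar : Cyc := ⟨⟨0, 1⟩, .ofNat 0, ⟨0, 1⟩, .ofNat 0⟩

@[simp]
theorem toComplex_zero : toComplex 0 = 0 := (toComplex_ofNat 0).trans Nat.cast_zero

@[simp]
theorem toComplex_one : toComplex 1 = 1 := (toComplex_ofNat 1).trans Nat.cast_one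

@[simp]
theorem toComplex_ofNat_ofNat (n : ℕ) [n.AtLeastTwo] :
    toComplex (no_index (OfNat.ofNat n)) = OfNat.ofNat n :=
  toComplex_ofNat n

@[simp]
theorem toComplex_neg (x : Cyc) : (-x).toComplex = -x.toComplex := by
  change toComplex ⟨x.a.neg, x.b.neg, x.c.neg, x.d.neg⟩ = _
  simp only [toComplex, Diff.toInt_neg]
  push_cast
  ring

@[simp]
theorem toComplex_μ : μ.toComplex = mu := by simp [toComplex, μ, Diff.toInt, Diff.ofNat]

@[simp]
theorem toComplex_μbar : μbar.toComplex = muBar := by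
  simp [toComplex, μbar, mu, muBar, Diff.toInt, Diff.ofNat]; ring

@[simp]
theorem toComplex_η : η.toComplex = eta := by simp [toComplex, η, Diff.toInt, Diff.ofNat]

@[simp]
theorem toComplex_ηbar : ηbar.toComplex = etaBar := by
  simp [toComplex, ηbar, eta, etaBar, Diff.toInt, Diff.ofNat]; ring

theorem toComplex_add (x y : Cyc) : (add x y).toComplex = x.toComplex + y.toComplex := by
  simp only [toComplex, add, mkForced_eq, Diff.toInt_add, Int.cast_add]
  ring

theorem toComplex_nsmul (n : ℕ) (x : Cyc) : (nsmul n x).toComplex = n * x.toComplex := by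
  simp only [toComplex, nsmul, mkForced_eq, Diff.toInt_nsmul, Int.cast_mul, Int.cast_natCast]
  ring

theorem mu_sq : mu * mu = -1 - mu := by
  have h : ((Real.sqrt 3 : ℝ) : ℂ) ^ 2 = 3 := by
    rw [← Complex.ofReal_pow, Real.sq_sqrt (by norm_num)]; norm_num
  rw [mu]
  linear_combination (1 / 4 : ℂ) * ((Real.sqrt 3 : ℝ) : ℂ) ^ 2 * Complex.I_sq - (1 / 4) * h

theorem eta_sq : eta * eta = -2 - eta := by
  have h : ((Real.sqrt 7 : ℝ) : ℂ) ^ 2 = 7 := by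
    rw [← Complex.ofReal_pow, Real.sq_sqrt (by norm_num)]; norm_num
  rw [eta]
  linear_combination (1 / 4 : ℂ) * ((Real.sqrt 7 : ℝ) : ℂ) ^ 2 * Complex.I_sq - (1 / 4) * h

theorem toComplex_mulAux (x y : Cyc) : (mulAux x y).toComplex = x.toComplex * y.toComplex := by
  simp only [toComplex, mulAux, mkForced_eq, Diff.toInt_add, Diff.toInt_mul, Diff.toInt_neg,
    Diff.toInt_nsmul]
  generalize x.a.toInt = xa, x.b.toInt = xb, x.c.toInt = xc, x.d.toInt = xd
  generalize y.a.toInt = ya, y.b.toInt = yb, y.c.toInt = yc, y.d.toInt = yd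
  push_cast
  linear_combination
    -((xb + xd * eta) * (yb + yd * eta)) * mu_sq -
      ((xc * yc - xd * yd) + (xc * yd + xd * yc - xd * yd) * mu) * eta_sq

theorem toComplex_of_isRat {x : Cyc} (h : isRat x = true) : x.toComplex = x.a.toInt := by
  have := Nat.eq_of_beq_eq_true h
  simp only [Nat.add_eq, Nat.add_eq_zero_iff] at this
  simp [toComplex, Diff.toInt, this]

theorem toComplex_mul (x y : Cyc) : (mul x y).toComplex = x.toComplex * y.toComplex := by
  unfold mul
  split
  · rename_i h
    rw [toComplex_of_isRat h]
    simp only [toComplex, mkForced_eq, Diff.toInt_mul]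
    push_cast
    ring
  · rename_i h _
    rw [toComplex_of_isRat h]
    simp only [toComplex, mkForced_eq, Diff.toInt_mul]
    push_cast
    ring
  · exact toComplex_mulAux x y

/-- The sum of the products of corresponding entries, over the shorter of the two lists. -/
def dot : List ℕ → List Cyc → Cyc
  | n :: v, x :: r => add (nsmul n x) (dot v r)
  | _, _ => ofNat 0

/-- The sum of `f` over a list. -/
def sum {ι : Type} (f : ι → Cyc) : List ι → Cyc
  | [] => ofNat 0
  | i :: l => add (f i) (sum f l)

theorem toComplex_sum {ι : Type} (f : ι → Cyc) (l : List ι) :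
    (sum f l).toComplex = (l.map fun i => (f i).toComplex).sum := by
  induction l with
  | nil => simp [sum, toComplex_ofNat]
  | cons i l ih => simp [sum, toComplex_add, ih]

end Cyc

/-! ### Verification of a character table -/

/-- Applies `f` to a list of natural numbers; in kernel reduction the entries are evaluated
first. -/
def forceList {α : Type} : List ℕ → (List ℕ → α) → α
  | [], f => f []
  | x :: l, f => force x fun x => forceList l fun l => f (x :: l)

theorem forceList_eq {α : Type} (l : List ℕ) (f : List ℕ → α) : forceList l f = f l := by
  induction l generalizing f with
  | nil => rfl
  | cons x l ih => rw [forceList, force_eq, ih]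

/-- The analogue of `forceList` for a list of lists. -/
def forceLists {α : Type} : List (List ℕ) → (List (List ℕ) → α) → α
  | [], f => f []
  | x :: l, f => forceList x fun x => forceLists l fun l => f (x :: l)

theorem forceLists_eq {α : Type} (l : List (List ℕ)) (f : List (List ℕ) → α) :
    forceLists l f = f l := by
  induction l generalizing f with
  | nil => rfl
  | cons x l ih => rw [forceLists, forceList_eq, ih]

/-- The analogue of `forceList` for a list of pairs. -/
def forcePairs {α : Type} : List (ℕ × ℕ) → (List (ℕ × ℕ) → α) → α
  | [], f => f []
  | x :: l, f => force x.1 fun a => force x.2 fun b => forcePairs l fun l => f ((a, b) :: l)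

theorem forcePairs_eq {α : Type} (l : List (ℕ × ℕ)) (f : List (ℕ × ℕ) → α) :
    forcePairs l f = f l := by
  induction l generalizing f with
  | nil => rfl
  | cons x l ih => rw [forcePairs, force_eq, force_eq, ih]

/-- A hash of a code: the digits of the images of `e₁, e₂, e₄`, which determine an element of the
groups in question. The correctness of the verification does not depend on this fact. -/
def hashKey (a : ℕ) : ℕ :=
  Nat.add (Nat.land (Nat.shiftRight a 4) 255) (Nat.mul 256 (Nat.land (Nat.shiftRight a 16) 15))

/-- The entry for `a` in a table with four-bit entries, indexed by `hashKey`. -/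
def lookUp (T a : ℕ) : ℕ := Nat.land (Nat.shiftRight T (Nat.mul 4 (hashKey a))) 15

/-- The code of the conjugate of `y` by the element whose code, and that of its inverse, are given
by `s`. -/
def codeConj (s : ℕ × ℕ) (y : ℕ) : ℕ := codeMul (codeMul s.1 y) s.2

/-- Adds to the stack and to the accumulator of a search those conjugates of `y` that have not been
seen. -/
def orbitStep (y : ℕ) : List (ℕ × ℕ) → List ℕ → ℕ → List ℕ →
    (List ℕ → ℕ → List ℕ → List ℕ) → List ℕ
  | [], st, seen, acc, k => k st seen acc
  | s :: gs, st, seen, acc, k =>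
    force (codeConj s y) fun z => force (Nat.shiftLeft 1 (hashKey z)) fun m =>
      match Nat.beq (Nat.land seen m) 0 with
      | true => force (Nat.lor seen m) fun seen => orbitStep y gs (z :: st) seen (z :: acc) k
      | false => orbitStep y gs st seen acc k

/-- Depth-first enumeration of a conjugacy class. The number of steps is bounded by the first
argument after the generators; that the enumeration is complete is verified by `checkClass`. -/
def orbitLoop (gs : List (ℕ × ℕ)) : ℕ → List ℕ → ℕ → List ℕ → List ℕ
  | 0, _, _, acc => acc
  | _ + 1, [], _, acc => acc
  | n + 1, y :: st, seen, acc =>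
    orbitStep y gs st seen acc fun st seen acc => orbitLoop gs n st seen acc

/-- The conjugacy class of `c`, as a list of codes. -/
def orbit (gs : List (ℕ × ℕ)) (c : ℕ) : List ℕ :=
  orbitLoop gs 300 [c] (Nat.shiftLeft 1 (hashKey c)) [c]

/-- Writes `j` into the entries of the table `T` for the elements of a list, supposed empty. -/
def addToTable (j : ℕ) : List ℕ → ℕ → ℕ
  | [], T => T
  | y :: l, T =>
    force (Nat.lor T (Nat.shiftLeft j (Nat.mul 4 (hashKey y)))) fun T => addToTable j l T

/-- The table whose entry for an element of the `j`-th class is `j`. -/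
def classTable : ℕ → List (List ℕ) → ℕ → ℕ
  | _, [], T => T
  | j, l :: ls, T => force (addToTable j l T) fun T => classTable (j + 1) ls T

/-- Membership in a list of natural numbers, by the recursors for fast kernel reduction. -/
def elemB (a : ℕ) (l : List ℕ) : Bool :=
  List.rec false (fun b _ r => Bool.rec r true (Nat.beq a b)) l

/-- Whether a list has no duplicates. -/
def nodupB : List ℕ → Bool
  | [] => true
  | a :: l => match elemB a l with
    | true => false
    | false => nodupB l

/-- The number of occurrences in a list of natural numbers. -/
def countB (a : ℕ) (l : List ℕ) : ℕ :=
  List.rec 0 (fun b _ r => Bool.rec r (Nat.succ r) (Nat.beq a b)) l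

/-- The `j`-th class, with representative `c`, has the index `j`, which is invariant under
conjugation by the generators, and the union of the classes is closed under multiplication by the
generators. -/
def checkClass (T : ℕ) (gs : List (ℕ × ℕ)) (Os : List (List ℕ)) (c j : ℕ)
    (O : List ℕ) : Bool :=
  elemB c O && (nodupB O && O.all fun y => Nat.beq (lookUp T y) j && gs.all fun s =>
    Nat.beq (lookUp T (codeConj s y)) j &&
      force (codeMul s.1 y) fun z => elemB z (Os.getD (lookUp T z) []))

section

variable {L : Type} (n : ℕ) (labels : List L) (row : L → List Cyc)

/-- The `j`-th entry of the row with label `i`. -/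
def entry (i : L) (j : ℕ) : Cyc := (row i).getD j (Cyc.ofNat 0)

/-- The first entry of a row, if it is a natural number written as `n - 0`. -/
def degree (i : L) : ℕ := (entry row i 0).a.p

/-- Verifies that the entries in the first column are positive natural numbers. -/
def checkDegrees : Bool :=
  labels.all fun i => Nat.blt 0 (degree row i) &&
    Cyc.beq (entry row i 0) (Cyc.ofNat (degree row i))

/-- Verifies that each column is orthogonal to the column of degrees, `N` being the order of the
group. -/
def checkColumns (N : ℕ) : Bool :=
  (List.range n).all fun j =>
    Cyc.beq (Cyc.sum (fun i => Cyc.mul (entry row i 0) (entry row i j)) labels)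
      (Cyc.ofNat (cond (Nat.beq j 0) N 0))

/-- Verifies the orthogonality of the rows, from the order `N` of the group, the sizes of the
classes and the indices of the classes of the inverses. -/
def checkRows [DecidableEq L] (N : ℕ) (sizes inv : List ℕ) : Bool :=
  labels.tails.all fun l => match l with
    | [] => true
    | i :: l => (i :: l).all fun k =>
      Cyc.beq (Cyc.sum (fun j => Cyc.nsmul (sizes.getD j 0)
        (Cyc.mul (entry row i j) (entry row k (inv.getD j 0)))) (List.range n))
        (Cyc.ofNat (if i = k then N else 0))

/-- Verifies that the rows satisfy the multiplication rule of the `k`-th and the `j`-th class sum,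
where `c` represents the `k`-th class and `O` is the `j`-th class. -/
def checkCentral (T c k : ℕ) (O : List ℕ) (j : ℕ) : Bool :=
  forceList (O.map fun y => lookUp T (codeMul c y)) fun ls =>
    forceList ((List.range n).map fun l => countB l ls) fun v =>
      labels.all fun i => Cyc.beq (Cyc.nsmul (degree row i) (Cyc.dot v (row i)))
        (Cyc.nsmul O.length (Cyc.mul (entry row i k) (entry row i j)))

/-- All verifications for a group, from the codes of the generators and their inverses, the codes
of the representatives of the classes and of their inverses, the lists of elements of the classes
and the table of class indices; `extras` lists further elements with their class indices. -/
def checkAll [DecidableEq L] (extras : List (ℕ × ℕ)) (gs : List (ℕ × ℕ))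
    (cs ci : List ℕ) (Os : List (List ℕ)) (T : ℕ) : Bool :=
  Nat.beq (code 1) (cs.getD 0 0) &&
  ((List.range n).all fun j => checkClass T gs Os (cs.getD j 0) j (Os.getD j [])) &&
  (extras.all fun p => Nat.beq (lookUp T p.1) p.2) &&
  checkDegrees labels row &&
  (forceList (Os.map List.length) fun sizes => force sizes.sum fun N =>
    forceList (ci.map (lookUp T)) fun inv =>
      checkColumns n labels row N && checkRows n labels row N sizes inv) &&
  ((List.range n).all fun k => (List.range n).all fun j =>
    checkCentral n labels row T (cs.getD k 0) k (Os.getD j []) j)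

end

section

variable {n : ℕ} (gens : List SPerm) (cls : Fin n → SPerm)

/-- The codes of the generators and of their inverses. -/
def genCodes : List (ℕ × ℕ) := gens.map fun s => (code s, code s⁻¹)

/-- The codes of the class representatives. -/
def classCodes : List ℕ := (List.ofFn cls).map code

/-- The codes of the inverses of the class representatives. -/
def classInvCodes : List ℕ := (List.ofFn cls).map fun c => code c⁻¹

/-- Verifies that `row` is the character table of the group generated by `gens`, with the conjugacy
classes represented by `cls`. -/
def checkGroup {L : Type} [DecidableEq L] (labels : List L) (row : L → List Cyc)
    (extras : List (SPerm × ℕ)) : Bool :=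
  forcePairs (extras.map fun p => (code p.1, p.2)) fun extras =>
  forcePairs (genCodes gens) fun gs => forceList (classCodes cls) fun cs =>
  forceList (classInvCodes cls) fun ci => forceLists (cs.map (orbit gs)) fun Os =>
  force (classTable 0 Os 0) fun T => checkAll n labels row extras gs cs ci Os T

end

/-! ### The tables -/

def labels21 : List Irr21 :=
  [.r1, .r1_1, .r1_2, .r3_1, .r3_2]

instance : Fintype Irr21 := ⟨⟨labels21, by decide⟩, fun i => by cases i <;> decide⟩

def labels168 : List Irr168 :=
  [.r1, .r1_1, .r1_2, .r3_1, .r3_2, .r7_1, .r7_2, .r7_3]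

instance : Fintype Irr168 := ⟨⟨labels168, by decide⟩, fun i => by cases i <;> decide⟩

def labelsPSL : List IrrPSL :=
  [.r1, .r3_1, .r3_2, .r6, .r7, .r8]

instance : Fintype IrrPSL := ⟨⟨labelsPSL, by decide⟩, fun i => by cases i <;> decide⟩

def labels1344 : List Irr1344 :=
  [.r1, .r3_1, .r3_2, .r6, .r7_1, .r7_2, .r7_3, .r8, .r14, .r21_1, .r21_2]

instance : Fintype Irr1344 := ⟨⟨labels1344, by decide⟩, fun i => by cases i <;> decide⟩

def labels192a : List Irr192a :=
  [.r1, .r1_1, .r1_2, .r1_3, .r2_1, .r2_2, .r3_1, .r3_2, .r3_3, .r3_4, .r6_1, .r6_2, .r6_3, .r6_4]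

instance : Fintype Irr192a := ⟨⟨labels192a, by decide⟩, fun i => by cases i <;> decide⟩

def labels192b : List Irr192b :=
  [.r1, .r1_1, .r2, .r3_1, .r3_2, .r3_3, .r3_4, .r3_5, .r3_6, .r4_1, .r4_2, .r6, .r8]

instance : Fintype Irr192b := ⟨⟨labels192b, by decide⟩, fun i => by cases i <;> decide⟩

/-- The rows of `chi21`. -/
def row21 : Irr21 → List Cyc
  | .r1 => [1, 1, 1, 1, 1]
  | .r1_1 => [1, .μ, .μbar, 1, 1]
  | .r1_2 => [1, .μbar, .μ, 1, 1]
  | .r3_1 => [3, 0, 0, .η, .ηbar]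
  | .r3_2 => [3, 0, 0, .ηbar, .η]

/-- The rows of `chi168`. -/
def row168 : Irr168 → List Cyc
  | .r1 => [1, 1, 1, 1, 1, 1, 1, 1]
  | .r1_1 => [1, 1, .μbar, .μ, .μbar, .μ, 1, 1]
  | .r1_2 => [1, 1, .μ, .μbar, .μ, .μbar, 1, 1]
  | .r3_1 => [3, 3, 0, 0, 0, 0, .η, .ηbar]
  | .r3_2 => [3, 3, 0, 0, 0, 0, .ηbar, .η]
  | .r7_1 => [7, -1, 1, 1, -1, -1, 0, 0]
  | .r7_2 => [7, -1, .μ, .μbar, -Cyc.μ, -Cyc.μbar, 0, 0]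
  | .r7_3 => [7, -1, .μbar, .μ, -Cyc.μbar, -Cyc.μ, 0, 0]

/-- The rows of `chiPSL`. -/
def rowPSL : IrrPSL → List Cyc
  | .r1 => [1, 1, 1, 1, 1, 1]
  | .r3_1 => [3, -1, 0, 1, .η, .ηbar]
  | .r3_2 => [3, -1, 0, 1, .ηbar, .η]
  | .r6 => [6, 2, 0, 0, -1, -1]
  | .r7 => [7, -1, 1, -1, 0, 0]
  | .r8 => [8, 0, -1, 0, 1, 1]

/-- The rows of `chi1344`. -/
def row1344 : Irr1344 → List Cyc
  | .r1 => [1, 1, 1, 1, 1, 1, 1, 1, 1, 1, 1]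
  | .r3_1 => [3, 3, -1, 0, -1, -1, 0, .η, .ηbar, 1, 1]
  | .r3_2 => [3, 3, -1, 0, -1, -1, 0, .ηbar, .η, 1, 1]
  | .r6 => [6, 6, 2, 0, 2, 2, 0, -1, -1, 0, 0]
  | .r7_1 => [7, -1, -1, 1, -1, 3, -1, 0, 0, 1, -1]
  | .r7_2 => [7, 7, -1, 1, -1, -1, 1, 0, 0, -1, -1]
  | .r7_3 => [7, -1, -1, 1, 3, -1, -1, 0, 0, -1, 1]
  | .r8 => [8, 8, 0, -1, 0, 0, -1, 1, 1, 0, 0]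
  | .r14 => [14, -2, -2, -1, 2, 2, 1, 0, 0, 0, 0]
  | .r21_1 => [21, -3, 1, 0, -3, 1, 0, 0, 0, -1, 1]
  | .r21_2 => [21, -3, 1, 0, 1, -3, 0, 0, 0, 1, -1]

/-- The rows of `chi192a`. -/
def row192a : Irr192a → List Cyc
  | .r1 => [1, 1, 1, 1, 1, 1, 1, 1, 1, 1, 1, 1, 1, 1]
  | .r1_1 => [1, 1, -1, 1, -1, -1, 1, 1, 1, 1, -1, -1, 1, -1]
  | .r1_2 => [1, 1, -1, -1, 1, -1, 1, -1, 1, 1, 1, -1, -1, 1]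
  | .r1_3 => [1, 1, 1, -1, -1, 1, 1, -1, 1, 1, -1, 1, -1, -1]
  | .r2_1 => [2, 2, -2, 0, 0, -2, -1, 0, 2, 2, 0, 1, 0, 0]
  | .r2_2 => [2, 2, 2, 0, 0, 2, -1, 0, 2, 2, 0, -1, 0, 0]
  | .r3_1 => [3, 3, 3, -1, -1, -1, 0, -1, -1, -1, -1, 0, 1, 1]
  | .r3_2 => [3, 3, 3, 1, 1, -1, 0, 1, -1, -1, 1, 0, -1, -1]
  | .r3_3 => [3, 3, -3, 1, -1, 1, 0, 1, -1, -1, -1, 0, -1, 1]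
  | .r3_4 => [3, 3, -3, -1, 1, 1, 0, -1, -1, -1, 1, 0, 1, -1]
  | .r6_1 => [6, -2, 0, 0, -2, 0, 0, 0, -2, 2, 2, 0, 0, 0]
  | .r6_2 => [6, -2, 0, 0, 2, 0, 0, 0, -2, 2, -2, 0, 0, 0]
  | .r6_3 => [6, -2, 0, -2, 0, 0, 0, 2, 2, -2, 0, 0, 0, 0]
  | .r6_4 => [6, -2, 0, 2, 0, 0, 0, -2, 2, -2, 0, 0, 0, 0]

/-- The rows of `chi192b`. -/
def row192b : Irr192b → List Cyc
  | .r1 => [1, 1, 1, 1, 1, 1, 1, 1, 1, 1, 1, 1, 1]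
  | .r1_1 => [1, 1, 1, 1, -1, 1, 1, 1, -1, -1, 1, -1, -1]
  | .r2 => [2, 2, 2, 2, 0, -1, 2, 2, 0, 0, -1, 0, 0]
  | .r3_1 => [3, 3, -1, -1, -1, 0, -1, 3, 1, 1, 0, -1, 1]
  | .r3_2 => [3, 3, -1, -1, 1, 0, 3, -1, -1, -1, 0, -1, 1]
  | .r3_3 => [3, 3, -1, -1, 1, 0, -1, 3, -1, -1, 0, 1, -1]
  | .r3_4 => [3, 3, -1, -1, -1, 0, 3, -1, 1, 1, 0, 1, -1]
  | .r3_5 => [3, 3, 3, -1, 1, 0, -1, -1, 1, 1, 0, -1, -1]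
  | .r3_6 => [3, 3, 3, -1, -1, 0, -1, -1, -1, -1, 0, 1, 1]
  | .r4_1 => [4, -4, 0, 0, 0, 1, 0, 0, -2, 2, -1, 0, 0]
  | .r4_2 => [4, -4, 0, 0, 0, 1, 0, 0, 2, -2, -1, 0, 0]
  | .r6 => [6, 6, -2, 2, 0, 0, -2, -2, 0, 0, 0, 0, 0]
  | .r8 => [8, -8, 0, 0, 0, -1, 0, 0, 0, 0, 1, 0, 0]

theorem chi21_eq (i : Irr21) (j : Fin 5) : chi21 i j = (entry row21 i j).toComplex := by
  cases i <;> fin_cases j <;>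
    simp [chi21, row21, entry]

theorem chi168_eq (i : Irr168) (j : Fin 8) : chi168 i j = (entry row168 i j).toComplex := by
  cases i <;> fin_cases j <;>
    simp [chi168, row168, entry]

theorem chiPSL_eq (i : IrrPSL) (j : Fin 6) : chiPSL i j = (entry rowPSL i j).toComplex := by
  cases i <;> fin_cases j <;>
    simp [chiPSL, rowPSL, entry]

theorem chi1344_eq (i : Irr1344) (j : Fin 11) : chi1344 i j = (entry row1344 i j).toComplex := by
  cases i <;> fin_cases j <;>
    simp [chi1344, row1344, entry]

theorem chi192a_eq (i : Irr192a) (j : Fin 14) : chi192a i j = (entry row192a i j).toComplex := by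
  cases i <;> fin_cases j <;>
    simp [chi192a, row192a, entry]

theorem chi192b_eq (i : Irr192b) (j : Fin 13) : chi192b i j = (entry row192b i j).toComplex := by
  cases i <;> fin_cases j <;>
    simp [chi192b, row192b, entry]

/-! ### Correctness of the verification -/

theorem elemB_iff {a : ℕ} {l : List ℕ} : elemB a l = true ↔ a ∈ l := by
  induction l with
  | nil => simp [elemB]
  | cons b l ih =>
    have h : elemB a (b :: l) = (Nat.beq a b).rec (elemB a l) true := rfl
    rw [h]
    rcases e : Nat.beq a b with _ | _
    · have : a ≠ b := fun c => by simp [c] at e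
      simp [ih, this]
    · simp [Nat.eq_of_beq_eq_true e]

theorem nodup_of_nodupB {l : List ℕ} (h : nodupB l = true) : l.Nodup := by
  induction l with
  | nil => exact List.nodup_nil
  | cons a l ih =>
    rw [nodupB] at h
    split at h
    · simp at h
    · rename_i e
      exact List.nodup_cons.2 ⟨fun c => by simp [elemB_iff.2 c] at e, ih h⟩

theorem countB_eq (a : ℕ) (l : List ℕ) : countB a l = l.count a := by
  induction l with
  | nil => rfl
  | cons b l ih =>
    have h : countB a (b :: l) = (Nat.beq a b).rec (countB a l) (Nat.succ (countB a l)) := rfl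
    rw [h, List.count_cons]
    rcases e : Nat.beq a b with _ | _
    · have : b ≠ a := fun c => by simp [c] at e
      simp [ih, this]
    · have hab := Nat.eq_of_beq_eq_true e
      subst hab
      simp [ih]

theorem forall_mem_orbitStep {P : ℕ → Prop} {y : ℕ} {k : List ℕ → ℕ → List ℕ → List ℕ}
    (hk : ∀ st seen acc, (∀ z ∈ st, P z) → (∀ z ∈ acc, P z) → ∀ z ∈ k st seen acc, P z)
    (gs : List (ℕ × ℕ)) (hP : ∀ s ∈ gs, P (codeConj s y)) (st : List ℕ) (seen : ℕ) (acc : List ℕ)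
    (hst : ∀ z ∈ st, P z) (hacc : ∀ z ∈ acc, P z) : ∀ z ∈ orbitStep y gs st seen acc k, P z := by
  induction gs generalizing st seen acc with
  | nil => exact hk _ _ _ hst hacc
  | cons s gs ih =>
    obtain ⟨hs, hgs⟩ := List.forall_mem_cons.1 hP
    simp only [orbitStep, force_eq]
    split
    · exact ih hgs _ _ _ (List.forall_mem_cons.2 ⟨hs, hst⟩) (List.forall_mem_cons.2 ⟨hs, hacc⟩)
    · exact ih hgs _ _ _ hst hacc

theorem forall_mem_orbitLoop {P : ℕ → Prop} {gs : List (ℕ × ℕ)}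
    (hP : ∀ y, P y → ∀ s ∈ gs, P (codeConj s y)) (n : ℕ) (st : List ℕ) (seen : ℕ)
    (acc : List ℕ) (hst : ∀ z ∈ st, P z) (hacc : ∀ z ∈ acc, P z) :
    ∀ z ∈ orbitLoop gs n st seen acc, P z := by
  induction n generalizing st seen acc with
  | zero => simpa only [orbitLoop] using hacc
  | succ n ih =>
    cases st with
    | nil => simpa only [orbitLoop] using hacc
    | cons y st =>
      obtain ⟨hy, hst⟩ := List.forall_mem_cons.1 hst
      exact forall_mem_orbitStep ih gs (hP y hy) _ _ _ hst hacc

theorem forall_mem_orbit {P : ℕ → Prop} {gs : List (ℕ × ℕ)} {c : ℕ} (hc : P c)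
    (hP : ∀ y, P y → ∀ s ∈ gs, P (codeConj s y)) : ∀ z ∈ orbit gs c, P z :=
  forall_mem_orbitLoop hP _ _ _ _ (by simpa) (by simpa)

theorem Cyc.toComplex_dot (v : List ℕ) (r : List Cyc) : (Cyc.dot v r).toComplex =
    ∑ l ∈ Finset.range v.length, (v.getD l 0 : ℂ) * (r.getD l (Cyc.ofNat 0)).toComplex := by
  induction v generalizing r with
  | nil => simp [Cyc.dot, Cyc.toComplex_ofNat]
  | cons n v ih =>
    cases r with
    | nil => simp [Cyc.dot, Cyc.toComplex_ofNat]
    | cons x r =>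
      rw [Cyc.dot, Cyc.toComplex_add, Cyc.toComplex_nsmul, ih, List.length_cons,
        Finset.sum_range_succ', add_comm]
      simp

theorem sum_map_eq_sum_count (e : ℕ → ℂ) (n : ℕ) (l : List ℕ) (hl : ∀ a ∈ l, a < n) :
    (l.map e).sum = ∑ a ∈ Finset.range n, (l.count a : ℂ) * e a := by
  simp only [Finset.sum_list_map_count, nsmul_eq_mul]
  refine Finset.sum_subset (fun a ha => ?_) fun a _ ha => ?_
  · simpa using hl a (by simpa using ha)
  · simp [List.count_eq_zero_of_not_mem fun h => ha (by simpa using h)]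

theorem mem_of_mem_getD {l : List (List ℕ)} {i z : ℕ} (h : z ∈ l.getD i []) : i < l.length := by
  by_contra! hi
  rw [List.getD_eq_default _ _ hi] at h
  simp at h

section

variable {G : Subgroup SPerm} {gens : List SPerm} (hG : G = Subgroup.closure {s | s ∈ gens})

include hG

/-- The induction principle for the elements of a finite group given by generators. -/
theorem closure_induction_mul {P : SPerm → Prop} (one : P 1)
    (mul : ∀ s ∈ gens, ∀ g ∈ G, P g → P (s * g)) : ∀ g ∈ G, P g := by
  intro g hg
  have hm : ∀ x, x ∈ Submonoid.closure {s | s ∈ gens} ↔ x ∈ G := fun x => by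
    rw [hG, ← Subgroup.closure_toSubmonoid_of_finite, Subgroup.mem_toSubmonoid]
  exact Submonoid.closure_induction_left (motive := fun x _ => P x) one
    (fun s hs y hy h => mul s hs y ((hm y).1 hy) h) ((hm g).2 hg)

theorem le_signedPerms (hgens : ∀ s ∈ gens, s ∈ signedPerms) : G ≤ signedPerms := by
  rw [hG, Subgroup.closure_le]
  exact hgens

theorem code_mem_orbit_imp {n : ℕ} {cls : Fin n → SPerm} (hgens : ∀ s ∈ gens, s ∈ signedPerms)
    (hcls : ∀ j, cls j ∈ G) (j : Fin n) :
    ∀ z ∈ orbit (genCodes gens) (code (cls j)), ∃ x ∈ G, code (x * cls j * x⁻¹) = z := by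
  refine forall_mem_orbit ⟨1, one_mem G, by simp⟩ ?_
  rintro _ ⟨x, hx, rfl⟩ _ h
  obtain ⟨s, hs, rfl⟩ := List.mem_map.1 h
  have hsG : s ∈ G := hG ▸ Subgroup.subset_closure hs
  have hle := le_signedPerms hG hgens
  refine ⟨s * x, mul_mem hsG hx, ?_⟩
  rw [codeConj, ← code_mul (hgens s hs),
    ← code_mul (hle (mul_mem hsG (mul_mem (mul_mem hx (hcls j)) (inv_mem hx))))]
  simp only [mul_assoc, mul_inv_rev]

end

/-- The facts on the conjugacy classes of `G` that `checkAll` verifies. -/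
structure ClassCodes (G : Subgroup SPerm) {n : ℕ} (cls : Fin n → SPerm) (T : ℕ)
    (O : Fin n → List ℕ) : Prop where
  le : G ≤ signedPerms
  rep_mem : ∀ j, code (cls j) ∈ O j
  nodup : ∀ j, (O j).Nodup
  lookUp_eq : ∀ j, ∀ y ∈ O j, lookUp T y = j
  cover : ∀ g ∈ G, ∃ j, code g ∈ O j
  conj : ∀ x ∈ G, ∀ g ∈ G, lookUp T (code (x * g * x⁻¹)) = lookUp T (code g)
  exists_conj : ∀ j, ∀ y ∈ O j, ∃ x ∈ G, code (x * cls j * x⁻¹) = y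

theorem classCodes_of_check {G : Subgroup SPerm} {gens : List SPerm}
    (hG : G = Subgroup.closure {s | s ∈ gens}) (hgens : ∀ s ∈ gens, s ∈ signedPerms)
    {n : ℕ} {cls : Fin n → SPerm} (hcls : ∀ j, cls j ∈ G) (h0 : 0 < n) {T : ℕ}
    (h1 : code 1 = code (cls ⟨0, h0⟩))
    (h : ∀ j : Fin n, checkClass T (genCodes gens)
      ((classCodes cls).map (orbit (genCodes gens))) (code (cls j)) j
      (orbit (genCodes gens) (code (cls j))) = true) :
    ClassCodes G cls T fun j => orbit (genCodes gens) (code (cls j)) := by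
  have hle := le_signedPerms hG hgens
  have hgG : ∀ s ∈ gens, s ∈ G := fun s hs => hG ▸ Subgroup.subset_closure hs
  simp only [checkClass, Bool.and_eq_true, force_eq, List.all_eq_true, elemB_iff] at h
  have hl : ∀ j, ∀ y ∈ orbit (genCodes gens) (code (cls j)), lookUp T y = j := fun j y hy =>
    Nat.eq_of_beq_eq_true ((h j).2.2 y hy).1
  have hlen : ((classCodes cls).map (orbit (genCodes gens))).length = n := by
    simp [classCodes]
  have hget : ∀ j : Fin n, ((classCodes cls).map (orbit (genCodes gens))).getD j [] =
      orbit (genCodes gens) (code (cls j)) := fun j => by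
    simp [classCodes]
  have hcover : ∀ g ∈ G, ∃ j, code g ∈ orbit (genCodes gens) (code (cls j)) := by
    refine closure_induction_mul hG ⟨⟨0, h0⟩, by rw [h1]; exact (h _).1⟩ ?_
    rintro s hs g hg ⟨j, hj⟩
    have key := (((h j).2.2 _ hj).2 _ (List.mem_map.2 ⟨s, hs, rfl⟩)).2
    rw [← code_mul (hgens s hs)] at key
    have hlt := mem_of_mem_getD key
    rw [hlen] at hlt
    exact ⟨⟨_, hlt⟩, by rwa [← hget]⟩
  refine ⟨hle, fun j => (h j).1, fun j => nodup_of_nodupB (h j).2.1, hl, hcover, ?_,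
    code_mem_orbit_imp hG hgens hcls⟩
  refine closure_induction_mul hG (by simp) fun s hs x hx ih g hg => ?_
  obtain ⟨j, hj⟩ := hcover _ (mul_mem (mul_mem hx hg) (inv_mem hx))
  have key := Nat.eq_of_beq_eq_true
    (((h j).2.2 _ hj).2 _ (List.mem_map.2 ⟨s, hs, rfl⟩)).1
  rw [codeConj, ← code_mul (hgens s hs), ← code_mul
    (hle (mul_mem (hgG s hs) (mul_mem (mul_mem hx hg) (inv_mem hx)))), ← hl j _ hj, ih g hg] at key
  rw [← key]
  simp only [mul_assoc, mul_inv_rev]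

namespace ClassCodes

variable {G : Subgroup SPerm} {n : ℕ} {cls : Fin n → SPerm} {T : ℕ} {O : Fin n → List ℕ}
  (C : ClassCodes G cls T O)

include C

theorem lookUp_lt {g : SPerm} (hg : g ∈ G) : lookUp T (code g) < n := by
  obtain ⟨j, hj⟩ := C.cover g hg
  rw [C.lookUp_eq j _ hj]
  exact j.2

/-- The index of the class of an element. -/
def index (g : G) : Fin n := ⟨lookUp T (code g), C.lookUp_lt g.2⟩

theorem code_mem_iff (g : G) (j : Fin n) : code g ∈ O j ↔ C.index g = j := by
  obtain ⟨i, hi⟩ := C.cover g g.2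
  have h : C.index g = i := Fin.ext (C.lookUp_eq i _ hi)
  refine ⟨fun hj => Fin.ext (C.lookUp_eq j _ hj), ?_⟩
  rintro rfl
  rwa [h]

theorem index_conj (x g : G) : C.index (x * g * x⁻¹) = C.index g :=
  Fin.ext (C.conj x x.2 g g.2)

theorem index_rep (hcls : ∀ j, cls j ∈ G) (j : Fin n) : C.index ⟨cls j, hcls j⟩ = j :=
  Fin.ext (C.lookUp_eq j _ (C.rep_mem j))

theorem isConj (hcls : ∀ j, cls j ∈ G) (g : G) :
    IsConj (⟨cls (C.index g), hcls _⟩ : G) g := by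
  obtain ⟨x, hx, h⟩ := C.exists_conj _ _ ((C.code_mem_iff g _).2 rfl)
  refine isConj_iff.2 ⟨⟨x, hx⟩, Subtype.ext ?_⟩
  exact code_injective (C.le (mul_mem (mul_mem hx (hcls _)) (inv_mem hx))) (C.le g.2) h

/-- A sum over a conjugacy class as a sum over the list of codes of its elements. -/
theorem sum_class (hcls : ∀ j, cls j ∈ G) [Fintype G] (j : Fin n) {M : Type*} [AddCommMonoid M]
    (F : ℕ → M) : ∑ y with C.index y = j, F (code (y : G)) = ((O j).map F).sum := by
  rw [← List.sum_toFinset F (C.nodup j)]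
  refine Finset.sum_nbij (fun y : G => code y) (fun y hy => ?_) (fun x _ y _ h => ?_)
    (fun z hz => ?_) fun _ _ => rfl
  · simpa [C.code_mem_iff] using hy
  · exact Subtype.ext (code_injective (C.le x.2) (C.le y.2) h)
  · have hz' : z ∈ O j := by simpa using hz
    obtain ⟨x, hx, rfl⟩ := C.exists_conj j z hz'
    let y : G := ⟨_, mul_mem (mul_mem hx (hcls j)) (inv_mem hx)⟩
    exact ⟨y, by simpa using (C.code_mem_iff y j).1 hz', rfl⟩

theorem card_class (hcls : ∀ j, cls j ∈ G) [Fintype G] (j : Fin n) :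
    ({y | C.index y = j} : Finset G).card = (O j).length := by
  rw [Finset.card_eq_sum_ones, C.sum_class hcls j fun _ => 1]
  simp

theorem card_eq (hcls : ∀ j, cls j ∈ G) [Fintype G] :
    Fintype.card G = ∑ j, (O j).length := by
  rw [← Finset.card_univ, Finset.card_eq_sum_card_fiberwise (f := C.index) (t := Finset.univ)
    (by simp)]
  simp only [C.card_class hcls]

/-- The class of the inverse depends only on the class. -/
theorem index_inv (hcls : ∀ j, cls j ∈ G) (g : G) :
    C.index g⁻¹ = C.index (⟨cls (C.index g), hcls _⟩ : G)⁻¹ := by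
  obtain ⟨x, hx⟩ := isConj_iff.1 (C.isConj hcls g)
  conv_lhs => rw [← hx]
  rw [← C.index_conj x (⟨cls (C.index g), hcls _⟩ : G)⁻¹]
  simp only [mul_inv_rev, inv_inv, mul_assoc]

end ClassCodes

theorem sum_eq_sum_map {L : Type} [Fintype L] {labels : List L} (hn : labels.Nodup)
    (hm : ∀ i, i ∈ labels) {M : Type*} [AddCommMonoid M] (F : L → M) :
    ∑ i, F i = (labels.map F).sum := by
  classical
  rw [← List.sum_toFinset F hn]
  congr 1
  ext i
  simp [hm]

/-- Of two members of a list, one occurs in the part that begins with the other. -/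
theorem cons_suffix_total {L : Type} {l : List L} {i k : L} (hi : i ∈ l) (hk : k ∈ l) :
    (∃ l', i :: l' <:+ l ∧ k ∈ i :: l') ∨ ∃ l', k :: l' <:+ l ∧ i ∈ k :: l' := by
  induction l with
  | nil => simp at hi
  | cons a l ih =>
    by_cases h1 : i = a
    · subst h1
      exact .inl ⟨l, List.suffix_rfl, hk⟩
    by_cases h2 : k = a
    · subst h2
      exact .inr ⟨l, List.suffix_rfl, hi⟩
    refine (ih ((List.mem_cons.1 hi).resolve_left h1) ((List.mem_cons.1 hk).resolve_left h2)).imp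
      ?_ ?_ <;> exact fun ⟨l', h, h'⟩ => ⟨l', h.trans (List.suffix_cons a l), h'⟩

theorem sum_range_eq_sum_map {M : Type*} [AddCommMonoid M] (n : ℕ) (F : ℕ → M) :
    ((List.range n).map F).sum = ∑ j : Fin n, F j := by
  rw [← List.sum_toFinset F List.nodup_range, List.toFinset_range, Finset.sum_range]

/-- The verification by `checkGroup` establishes the character table of a group; moreover the
elements in the list `extras` have the classes given there. -/
theorem exists_characterTableData {G : Subgroup SPerm} [Fintype G] (gens : List SPerm)
    (hG : G = Subgroup.closure {s | s ∈ gens}) (hgens : ∀ s ∈ gens, s ∈ signedPerms)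
    {n : ℕ} {cls : Fin n → SPerm} (hcls : ∀ j, cls j ∈ G) (h0 : 0 < n)
    {L : Type} [Fintype L] [DecidableEq L] {labels : List L} (hn : labels.Nodup)
    (hm : ∀ i, i ∈ labels) {row : L → List Cyc} {χ : L → Fin n → ℂ}
    (hχ : ∀ i j, χ i j = (entry row i j).toComplex) {extras : List (SPerm × ℕ)}
    (h : checkGroup gens cls labels row extras = true) :
    ∃ D : CharacterTableData G (fun j => (⟨cls j, hcls j⟩ : G)) χ,
      ∀ (g : G) (k : ℕ), ((g : SPerm), k) ∈ extras → D.cl g = k := by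
  simp only [checkGroup, forcePairs_eq, forceList_eq, forceLists_eq, force_eq] at h
  set T := classTable 0 ((classCodes cls).map (orbit (genCodes gens))) 0
  have hcs : ∀ j : Fin n, (classCodes cls).getD j 0 = code (cls j) := fun j => by
    simp [classCodes]
  have hOs : ∀ j : Fin n, ((classCodes cls).map (orbit (genCodes gens))).getD j [] =
      orbit (genCodes gens) (code (cls j)) := fun j => by
    simp [classCodes]
  set O : Fin n → List ℕ := fun j => orbit (genCodes gens) (code (cls j)) with hO
  have hsz : ∀ j : Fin n, (((classCodes cls).map (orbit (genCodes gens))).map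
      List.length).getD j 0 = (O j).length := fun j => by
    simp [classCodes, hO]
  have hinv : ∀ j : Fin n, ((classInvCodes cls).map (lookUp T)).getD j 0 =
      lookUp T (code (cls j)⁻¹) := fun j => by
    simp [classInvCodes]
  have hN : (((classCodes cls).map (orbit (genCodes gens))).map List.length).sum =
      ∑ j, (O j).length := by
    simp [classCodes, List.map_ofFn, List.sum_ofFn, hO]
  simp only [checkAll, Bool.and_eq_true, forceList_eq, force_eq, hN] at h
  obtain ⟨⟨⟨⟨⟨hone, hclass⟩, hextras⟩, hdeg⟩, hcol, hrow⟩, hcentral⟩ := h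
  have C : ClassCodes G cls T O := by
    refine classCodes_of_check hG hgens hcls h0 ?_ fun j => ?_
    · rw [← hcs ⟨0, h0⟩]
      exact Nat.eq_of_beq_eq_true hone
    · have := List.all_eq_true.1 hclass j (List.mem_range.2 j.2)
      rwa [hcs, hOs] at this
  have hcl1 : C.index 1 = ⟨0, h0⟩ := by
    rw [← C.code_mem_iff]
    change code 1 ∈ O ⟨0, h0⟩
    rw [Nat.eq_of_beq_eq_true hone, show (classCodes cls).getD 0 0 = _ from hcs ⟨0, h0⟩]
    exact C.rep_mem _
  have hcard := C.card_eq hcls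
  have hsum := fun F : L → ℂ => sum_eq_sum_map hn hm F
  refine ⟨{ cl := C.index, cl_conj := C.index_conj, cl_rep := C.index_rep hcls,
            isConj := C.isConj hcls, deg := degree row, deg_pos := fun i => ?_,
            deg_eq := fun i => ?_, column_orthogonality := fun j => ?_,
            row_orthogonality := fun i k => ?_, central := fun i j k => ?_ }, fun g k hg => ?_⟩
  · exact Nat.blt_eq.mp (Bool.and_eq_true_iff.1 (List.all_eq_true.1 hdeg i (hm i))).1
  · rw [hcl1, hχ, Cyc.toComplex_eq_of_beq
      (Bool.and_eq_true_iff.1 (List.all_eq_true.1 hdeg i (hm i))).2, Cyc.toComplex_ofNat]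
  · have := Cyc.toComplex_eq_of_beq (List.all_eq_true.1 hcol j (List.mem_range.2 j.2))
    rw [Cyc.toComplex_sum, ← hsum, Cyc.toComplex_ofNat] at this
    simp only [Cyc.toComplex_mul, ← hχ, ← hcard] at this
    rw [hcl1]
    simp only [hχ] at this ⊢
    rw [this]
    rcases e : Nat.beq j 0 with _ | _
    · have : j ≠ ⟨0, h0⟩ := by rintro rfl; simp at e
      simp [this]
    · have : j = ⟨0, h0⟩ := Fin.ext (Nat.eq_of_beq_eq_true e)
      simp [this]
  · have key : ∀ i k, (∃ l, i :: l <:+ labels ∧ k ∈ i :: l) → ∑ g, χ i (C.index g) *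
        χ k (C.index g⁻¹) = if i = k then (Fintype.card G : ℂ) else 0 := by
      rintro i k ⟨l, hl, hk⟩
      have := Cyc.toComplex_eq_of_beq
        (List.all_eq_true.1 (List.all_eq_true.1 hrow _ ((List.mem_tails _ _).2 hl)) k hk)
      rw [Cyc.toComplex_sum, Cyc.toComplex_ofNat, sum_range_eq_sum_map, ← hcard] at this
      rw [← Finset.sum_fiberwise _ C.index, ← Nat.cast_zero, ← Nat.cast_ite, ← this]
      refine Finset.sum_congr rfl fun j _ => ?_
      rw [Cyc.toComplex_nsmul, Cyc.toComplex_mul, hsz, hinv, ← C.card_class hcls,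
        ← nsmul_eq_mul, ← hχ]
      refine Finset.sum_eq_card_nsmul fun g hg => ?_
      rw [C.index_inv hcls, (Finset.mem_filter.1 hg).2, hχ k]
      rfl
    rcases cons_suffix_total (hm i) (hm k) with h | h
    · exact key i k h
    · have := key k i h
      rw [← Equiv.sum_comp (Equiv.inv G)] at this
      simpa only [Equiv.inv_apply, inv_inv, mul_comm, eq_comm] using this
  · have := List.all_eq_true.1 (List.all_eq_true.1 hcentral k (List.mem_range.2 k.2)) j
      (List.mem_range.2 j.2)
    simp only [checkCentral, forceList_eq, hcs, hOs] at this
    have := Cyc.toComplex_eq_of_beq (List.all_eq_true.1 this i (hm i))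
    rw [Cyc.toComplex_nsmul, Cyc.toComplex_nsmul, Cyc.toComplex_mul, Cyc.toComplex_dot,
      ← hχ, ← hχ] at this
    rw [C.card_class hcls, ← this]
    congr 1
    have hmul : ∀ y : G, code ((⟨cls k, hcls k⟩ : G) * y : G) =
        codeMul (code (cls k)) (code y) := fun y => code_mul (C.le (hcls k))
    simp only [hχ]
    change ∑ y with C.index y = j,
      (entry row i (lookUp T (code ((⟨cls k, hcls k⟩ : G) * y : G)))).toComplex = _
    simp only [hmul]
    rw [C.sum_class hcls j fun y => (entry row i (lookUp T (codeMul (code (cls k)) y))).toComplex,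
      show (fun y => (entry row i (lookUp T (codeMul (code (cls k)) y))).toComplex) =
        (fun l => (entry row i l).toComplex) ∘ fun y => lookUp T (codeMul (code (cls k)) y)
        from rfl,
      ← List.map_map, sum_map_eq_sum_count _ n]
    · simp only [List.length_map, List.length_range]
      refine Finset.sum_congr rfl fun l hl => ?_
      simp [countB_eq, Finset.mem_range.1 hl, entry, hO]
    · intro a ha
      obtain ⟨y, hy, rfl⟩ := List.mem_map.1 ha
      obtain ⟨x, hx, rfl⟩ := C.exists_conj j y hy
      rw [← code_mul (C.le (hcls k))]
      exact C.lookUp_lt (mul_mem (hcls k) (mul_mem (mul_mem hx (hcls j)) (inv_mem hx)))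
  · have := List.all_eq_true.1 hextras _ (List.mem_map.2 ⟨_, hg, rfl⟩)
    exact Nat.eq_of_beq_eq_true this

/-! ### Verification of decompositions -/

section

variable {L L' : Type} (n : ℕ) (labels : List L) (row : L → List Cyc) (row' : L' → List Cyc)

/-- The value at the `j`-th class of the character of a formal sum. -/
def sumEntry (p : List (ℕ × L')) (j : ℕ) : Cyc :=
  Cyc.sum (fun q => Cyc.nsmul q.1 (entry row' q.2 j)) p

/-- Verifies that of the two entries of a tensor table for a pair of labels at least one is
nonempty, at most one if the labels are different, and that it gives the product of the rows. -/
def checkTensor [DecidableEq L] (t : L → L → List (ℕ × L)) : Bool :=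
  labels.all fun i => labels.all fun k =>
    match t i k with
    | [] => !(t k i).isEmpty
    | p => (decide (i = k) || (t k i).isEmpty) && (List.range n).all fun j =>
        Cyc.beq (Cyc.mul (entry row i j) (entry row k j)) (sumEntry row p j)

/-- Verifies a table of restrictions to a subgroup whose `j`-th class lies in the class with index
`idx j`. -/
def checkBranching (b : L → List (ℕ × L')) (idx : Fin n → ℕ) : Bool :=
  labels.all fun i => (List.finRange n).all fun j =>
    Cyc.beq (entry row i (idx j)) (sumEntry row' (b i) j)

end

theorem sum_mult {L : Type} [Fintype L] [DecidableEq L] (p : List (ℕ × L)) (F : L → ℂ) :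
    ∑ l, (mult p l : ℂ) * F l = (p.map fun q => (q.1 : ℂ) * F q.2).sum := by
  induction p with
  | nil => simp [mult]
  | cons q p ih =>
    have h : ∀ l, mult (q :: p) l = (if q.2 = l then q.1 else 0) + mult p l := fun l => by
      simp [mult]
    simp [h, add_mul, Finset.sum_add_distrib, ih]

theorem toComplex_sumEntry {L : Type} [Fintype L] [DecidableEq L] {n : ℕ} {row : L → List Cyc}
    {χ : L → Fin n → ℂ} (hχ : ∀ i j, χ i j = (entry row i j).toComplex) (p : List (ℕ × L))
    (j : Fin n) : (sumEntry row p j).toComplex = ∑ l, (mult p l : ℂ) * χ l j := by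
  rw [sum_mult, sumEntry, Cyc.toComplex_sum]
  simp only [Cyc.toComplex_nsmul, hχ]

theorem mul_eq_sum_of_checkTensor {L : Type} [Fintype L] [DecidableEq L] {n : ℕ}
    {labels : List L} (hm : ∀ i, i ∈ labels) {row : L → List Cyc} {χ : L → Fin n → ℂ}
    (hχ : ∀ i j, χ i j = (entry row i j).toComplex) {t : L → L → List (ℕ × L)}
    (h : checkTensor n labels row t = true) (i k : L) (j : Fin n) :
    χ i j * χ k j = ∑ l, ((mult (t i k) ⊔ mult (t k i)) l : ℕ) * χ l j := by
  have hnil : mult (L := L) [] = ⊥ := rfl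
  have key : ∀ i k, t i k ≠ [] →
      χ i j * χ k j = ∑ l, ((mult (t i k) ⊔ mult (t k i)) l : ℕ) * χ l j := by
    intro i k hne
    have := List.all_eq_true.1 (List.all_eq_true.1 h i (hm i)) k (hm k)
    split at this
    · contradiction
    · simp only [Bool.and_eq_true, Bool.or_eq_true, decide_eq_true_eq, List.isEmpty_iff] at this
      have hsup : mult (t i k) ⊔ mult (t k i) = mult (t i k) := by
        rcases this.1 with rfl | e
        · exact sup_idem _
        · rw [e, hnil, sup_bot_eq]
      rw [hsup, ← toComplex_sumEntry hχ, ← Cyc.toComplex_eq_of_beq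
        (List.all_eq_true.1 this.2 j (List.mem_range.2 j.2)), Cyc.toComplex_mul, hχ, hχ]
  by_cases hne : t i k = []
  · have := List.all_eq_true.1 (List.all_eq_true.1 h i (hm i)) k (hm k)
    rw [hne] at this
    rw [mul_comm, sup_comm]
    exact key k i (by simpa using this)
  · exact key i k hne

theorem eq_sum_of_checkBranching {L L' : Type} [Fintype L'] [DecidableEq L'] {n n' : ℕ}
    {labels : List L} (hm : ∀ i, i ∈ labels) {row : L → List Cyc} {χ : L → Fin n → ℂ}
    (hχ : ∀ i j, χ i j = (entry row i j).toComplex) {row' : L' → List Cyc} {χ' : L' → Fin n' → ℂ}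
    (hχ' : ∀ i j, χ' i j = (entry row' i j).toComplex) {b : L → List (ℕ × L')} {idx : Fin n' → ℕ}
    (h : checkBranching n' labels row row' b idx = true) (i : L) (j : Fin n') {k : Fin n}
    (hk : k = idx j) : χ i k = ∑ l, (mult (b i) l : ℂ) * χ' l j := by
  rw [← toComplex_sumEntry hχ', ← Cyc.toComplex_eq_of_beq
    (List.all_eq_true.1 (List.all_eq_true.1 h i (hm i)) j (List.mem_finRange j)), hχ, hk]

/-! ### Memberships and inclusions between the groups -/

theorem N₇_eq : N₇ = α * N₁ * α ^ 6 :=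
  code_injective (signed_mem _ _)
    (mul_mem (mul_mem (signed_mem _ _) (signed_mem _ _)) (pow_mem (signed_mem _ _) _))
    (by decide +kernel)

theorem β_eq : β = βt * α * βt * α :=
  code_injective (signed_mem _ _)
    (mul_mem (mul_mem (mul_mem (signed_mem _ _) (signed_mem _ _)) (signed_mem _ _))
      (signed_mem _ _)) (by decide +kernel)

theorem δ_eq : δ = βt * βt * γt * N₁ * γt * βt * γt :=
  code_injective (signed_mem _ _)
    (mul_mem (mul_mem (mul_mem (mul_mem (mul_mem (mul_mem (signed_mem _ _) (signed_mem _ _))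
      (signed_mem _ _)) (signed_mem _ _)) (signed_mem _ _)) (signed_mem _ _)) (signed_mem _ _))
    (by decide +kernel)

theorem α_mem_21 : α ∈ G21 := Subgroup.subset_closure (by simp)
theorem β_mem_21 : β ∈ G21 := Subgroup.subset_closure (by simp)

theorem α_mem_168 : α ∈ G168 := Subgroup.subset_closure (by simp)
theorem β_mem_168 : β ∈ G168 := Subgroup.subset_closure (by simp)
theorem N₁_mem_168 : N₁ ∈ G168 := Subgroup.subset_closure (by simp)
theorem N₇_mem_168 : N₇ ∈ G168 :=
  N₇_eq ▸ mul_mem (mul_mem α_mem_168 N₁_mem_168) (pow_mem α_mem_168 6)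

theorem α_mem_PSL : α ∈ GPSL := Subgroup.subset_closure (by simp)
theorem βt_mem_PSL : βt ∈ GPSL := Subgroup.subset_closure (by simp)
theorem γt_mem_PSL : γt ∈ GPSL := Subgroup.subset_closure (by simp)
theorem β_mem_PSL : β ∈ GPSL := by
  rw [β_eq]
  simp (maxDischargeDepth := 8) only [mul_mem, α_mem_PSL, βt_mem_PSL]

theorem α_mem_PSLirr : α ∈ GPSLirr := Subgroup.subset_closure (by simp)
theorem βt_mem_PSLirr : βt ∈ GPSLirr := Subgroup.subset_closure (by simp)
theorem δ_mem_PSLirr : δ ∈ GPSLirr := Subgroup.subset_closure (by simp)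

theorem α_mem_1344ns : α ∈ G1344ns := Subgroup.subset_closure (by simp)
theorem β_mem_1344ns : β ∈ G1344ns := Subgroup.subset_closure (by simp)
theorem γ_mem_1344ns : γ ∈ G1344ns := Subgroup.subset_closure (by simp)
theorem N₁_mem_1344ns : N₁ ∈ G1344ns := Subgroup.subset_closure (by simp)

theorem α_mem_1344sp : α ∈ G1344sp := Subgroup.subset_closure (by simp)
theorem βt_mem_1344sp : βt ∈ G1344sp := Subgroup.subset_closure (by simp)
theorem γt_mem_1344sp : γt ∈ G1344sp := Subgroup.subset_closure (by simp)
theorem N₁_mem_1344sp : N₁ ∈ G1344sp := Subgroup.subset_closure (by simp)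
theorem δ_mem_1344sp : δ ∈ G1344sp := by
  rw [δ_eq]
  simp (maxDischargeDepth := 8) only [mul_mem, βt_mem_1344sp, γt_mem_1344sp, N₁_mem_1344sp]

theorem γ_mem_192aNs : γ ∈ G192aNs := Subgroup.subset_closure (by simp)
theorem θ_mem_192aNs : θ ∈ G192aNs := Subgroup.subset_closure (by simp)

theorem At_mem_192aSp : At ∈ G192aSp := Subgroup.subset_closure (by simp)
theorem Bt_mem_192aSp : Bt ∈ G192aSp := Subgroup.subset_closure (by simp)
theorem N₁_mem_192aSp : N₁ ∈ G192aSp := Subgroup.subset_closure (by simp)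

theorem A_mem_192bNs : A ∈ G192bNs := Subgroup.subset_closure (by simp)
theorem B_mem_192bNs : B ∈ G192bNs := Subgroup.subset_closure (by simp)

theorem γt_mem_192bSp : γt ∈ G192bSp := Subgroup.subset_closure (by simp)
theorem θt_mem_192bSp : θt ∈ G192bSp := Subgroup.subset_closure (by simp)
theorem N₁_mem_192bSp : N₁ ∈ G192bSp := Subgroup.subset_closure (by simp)

theorem cls21_mem (j : Fin 5) : cls21 j ∈ G21 := by
  fin_cases j <;>
    simp (maxDischargeDepth := 8)
      [cls21, pow_mem, α_mem_21, β_mem_21]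

theorem cls168_mem (j : Fin 8) : cls168 j ∈ G168 := by
  fin_cases j <;>
    simp (maxDischargeDepth := 8)
      [cls168, mul_mem, pow_mem, α_mem_168, β_mem_168, N₁_mem_168, N₇_mem_168]

theorem clsPSL_mem (j : Fin 6) : clsPSL j ∈ GPSL := by
  fin_cases j <;>
    simp (maxDischargeDepth := 8)
      [clsPSL, mul_mem, pow_mem, α_mem_PSL, βt_mem_PSL, γt_mem_PSL]

theorem clsPSLirr_mem (j : Fin 6) : clsPSLirr j ∈ GPSLirr := by
  fin_cases j <;>
    simp (maxDischargeDepth := 8)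
      [clsPSLirr, mul_mem, pow_mem, α_mem_PSLirr, βt_mem_PSLirr, δ_mem_PSLirr]

theorem cls1344ns_mem (j : Fin 11) : cls1344ns j ∈ G1344ns := by
  fin_cases j <;>
    simp (maxDischargeDepth := 8)
      [cls1344ns, mul_mem, pow_mem, α_mem_1344ns, β_mem_1344ns, γ_mem_1344ns, N₁_mem_1344ns]

theorem cls1344sp_mem (j : Fin 11) : cls1344sp j ∈ G1344sp := by
  fin_cases j <;>
    simp (maxDischargeDepth := 8)
      [cls1344sp, mul_mem, pow_mem, α_mem_1344sp, βt_mem_1344sp, γt_mem_1344sp, N₁_mem_1344sp,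
        δ_mem_1344sp]

theorem cls192aNs_mem (j : Fin 14) : cls192aNs j ∈ G192aNs := by
  fin_cases j <;>
    simp (maxDischargeDepth := 8)
      [cls192aNs, mul_mem, pow_mem, γ_mem_192aNs, θ_mem_192aNs]

theorem cls192aSp_mem (j : Fin 14) : cls192aSp j ∈ G192aSp := by
  fin_cases j <;>
    simp (maxDischargeDepth := 8)
      [cls192aSp, mul_mem, pow_mem, At_mem_192aSp, Bt_mem_192aSp, N₁_mem_192aSp]

theorem cls192bNs_mem (j : Fin 13) : cls192bNs j ∈ G192bNs := by
  fin_cases j <;>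
    simp (maxDischargeDepth := 8)
      [cls192bNs, mul_mem, pow_mem, A_mem_192bNs, B_mem_192bNs]

theorem cls192bSp_mem (j : Fin 13) : cls192bSp j ∈ G192bSp := by
  fin_cases j <;>
    simp (maxDischargeDepth := 8)
      [cls192bSp, mul_mem, pow_mem, γt_mem_192bSp, θt_mem_192bSp, N₁_mem_192bSp]

theorem G21_le_G168 : G21 ≤ G168 :=
  Subgroup.closure_mono (by simp [Set.insert_subset_iff])

theorem G168_le_G1344ns : G168 ≤ G1344ns :=
  Subgroup.closure_mono (by simp [Set.insert_subset_iff])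

theorem G21_le_GPSL : G21 ≤ GPSL := by
  simp [G21, Subgroup.closure_le, Set.insert_subset_iff, α_mem_PSL, β_mem_PSL]

theorem GPSL_le_G1344sp : GPSL ≤ G1344sp :=
  Subgroup.closure_mono (by simp [Set.insert_subset_iff])

theorem G168_le_G1344sp : G168 ≤ G1344sp := by
  simp [G168, Subgroup.closure_le, Set.insert_subset_iff, α_mem_1344sp, N₁_mem_1344sp,
    GPSL_le_G1344sp β_mem_PSL]

theorem GPSLirr_le_G1344sp : GPSLirr ≤ G1344sp := by
  simp [GPSLirr, Subgroup.closure_le, Set.insert_subset_iff, α_mem_1344sp, βt_mem_1344sp,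
    δ_mem_1344sp]

/-! ### The character tables of the groups -/

instance (G : Subgroup SPerm) : Fintype G := Fintype.ofFinite G

/-- The indices of the classes of `G168` that contain the representatives `cls21`; similarly in the
following definitions. -/
def classes21To168 : Fin 5 → ℕ := ![0, 3, 2, 6, 7]
def classes21ToPSL : Fin 5 → ℕ := ![0, 2, 2, 4, 5]
def classes168To1344 : Fin 8 → ℕ := ![0, 1, 3, 3, 6, 6, 7, 8]
def classesPSLTo1344 : Fin 6 → ℕ := ![0, 5, 3, 9, 7, 8]
def classesPSLirrTo1344 : Fin 6 → ℕ := ![0, 4, 3, 10, 7, 8]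

theorem mem_ofFn_classes {n : ℕ} (cls : Fin n → SPerm) (idx : Fin n → ℕ) (j : Fin n) :
    (cls j, idx j) ∈ List.ofFn fun j => (cls j, idx j) :=
  List.mem_ofFn.2 ⟨j, rfl⟩

set_option maxRecDepth 100000 in
theorem checkGroup_21 : checkGroup [α, β] cls21 labels21 row21 [] = true := by
  decide +kernel

set_option maxRecDepth 100000 in
theorem checkGroup_168 : checkGroup [α, β, N₁] cls168 labels168 row168
    (List.ofFn fun j => (cls21 j, classes21To168 j)) = true := by
  decide +kernel

set_option maxRecDepth 100000 in
theorem checkGroup_PSL : checkGroup [α, βt, γt] clsPSL labelsPSL rowPSL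
    (List.ofFn fun j => (cls21 j, classes21ToPSL j)) = true := by
  decide +kernel

set_option maxRecDepth 100000 in
theorem checkGroup_PSLirr : checkGroup [α, βt, δ] clsPSLirr labelsPSL rowPSL [] = true := by
  decide +kernel

set_option maxRecDepth 100000 in
theorem checkGroup_1344ns : checkGroup [α, β, γ, N₁] cls1344ns labels1344 row1344
    (List.ofFn fun j => (cls168 j, classes168To1344 j)) = true := by
  decide +kernel

set_option maxRecDepth 100000 in
theorem checkGroup_1344sp : checkGroup [α, βt, γt, N₁] cls1344sp labels1344 row1344
    ((List.ofFn fun j => (cls168 j, classes168To1344 j)) ++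
      (List.ofFn fun j => (clsPSL j, classesPSLTo1344 j)) ++
      (List.ofFn fun j => (clsPSLirr j, classesPSLirrTo1344 j))) = true := by
  decide +kernel

set_option maxRecDepth 100000 in
theorem checkGroup_192aNs : checkGroup [γ, θ] cls192aNs labels192a row192a [] = true := by
  decide +kernel

set_option maxRecDepth 100000 in
theorem checkGroup_192aSp : checkGroup [At, Bt, N₁] cls192aSp labels192a row192a [] = true := by
  decide +kernel

set_option maxRecDepth 100000 in
theorem checkGroup_192bNs : checkGroup [A, B] cls192bNs labels192b row192b [] = true := by
  decide +kernel

set_option maxRecDepth 100000 in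
theorem checkGroup_192bSp : checkGroup [γt, θt, N₁] cls192bSp labels192b row192b [] = true := by
  decide +kernel

theorem nonempty_data_21 : Nonempty
    (CharacterTableData G21 (fun j => (⟨cls21 j, cls21_mem j⟩ : G21)) chi21) :=
  ⟨(exists_characterTableData [α, β] (congrArg _ (by ext; simp))
    (by simpa using ⟨signed_mem _ _, signed_mem _ _⟩)
    cls21_mem (by norm_num) (by decide) (fun i => by cases i <;> decide)
    chi21_eq checkGroup_21).choose⟩

theorem exists_data_168 :
    ∃ D : CharacterTableData G168 (fun j => (⟨cls168 j, cls168_mem j⟩ : G168)) chi168,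
      ∀ (g : G168) (k : ℕ), ((g : SPerm), k) ∈
        (List.ofFn fun j => (cls21 j, classes21To168 j)) → D.cl g = k :=
  exists_characterTableData [α, β, N₁] (congrArg _ (by ext; simp))
    (by simpa using ⟨signed_mem _ _, signed_mem _ _, signed_mem _ _⟩)
    cls168_mem (by norm_num) (by decide) (fun i => by cases i <;> decide)
    chi168_eq checkGroup_168

theorem exists_data_PSL :
    ∃ D : CharacterTableData GPSL (fun j => (⟨clsPSL j, clsPSL_mem j⟩ : GPSL)) chiPSL,
      ∀ (g : GPSL) (k : ℕ), ((g : SPerm), k) ∈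
        (List.ofFn fun j => (cls21 j, classes21ToPSL j)) → D.cl g = k :=
  exists_characterTableData [α, βt, γt] (congrArg _ (by ext; simp))
    (by simpa using ⟨signed_mem _ _, signed_mem _ _, signed_mem _ _⟩)
    clsPSL_mem (by norm_num) (by decide) (fun i => by cases i <;> decide)
    chiPSL_eq checkGroup_PSL

theorem nonempty_data_PSLirr : Nonempty
    (CharacterTableData GPSLirr (fun j => (⟨clsPSLirr j, clsPSLirr_mem j⟩ : GPSLirr)) chiPSL) :=
  ⟨(exists_characterTableData [α, βt, δ] (congrArg _ (by ext; simp))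
    (by simpa using ⟨signed_mem _ _, signed_mem _ _, signed_mem _ _⟩)
    clsPSLirr_mem (by norm_num) (by decide) (fun i => by cases i <;> decide)
    chiPSL_eq checkGroup_PSLirr).choose⟩

theorem exists_data_1344ns :
    ∃ D : CharacterTableData G1344ns (fun j => (⟨cls1344ns j, cls1344ns_mem j⟩ : G1344ns)) chi1344,
      ∀ (g : G1344ns) (k : ℕ), ((g : SPerm), k) ∈
        (List.ofFn fun j => (cls168 j, classes168To1344 j)) → D.cl g = k :=
  exists_characterTableData [α, β, γ, N₁] (congrArg _ (by ext; simp))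
    (by simpa using ⟨signed_mem _ _, signed_mem _ _, signed_mem _ _, signed_mem _ _⟩)
    cls1344ns_mem (by norm_num) (by decide) (fun i => by cases i <;> decide)
    chi1344_eq checkGroup_1344ns

theorem exists_data_1344sp :
    ∃ D : CharacterTableData G1344sp (fun j => (⟨cls1344sp j, cls1344sp_mem j⟩ : G1344sp)) chi1344,
      ∀ (g : G1344sp) (k : ℕ), ((g : SPerm), k) ∈
        (List.ofFn fun j => (cls168 j, classes168To1344 j)) ++
        (List.ofFn fun j => (clsPSL j, classesPSLTo1344 j)) ++
        (List.ofFn fun j => (clsPSLirr j, classesPSLirrTo1344 j)) → D.cl g = k :=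
  exists_characterTableData [α, βt, γt, N₁] (congrArg _ (by ext; simp))
    (by simpa using ⟨signed_mem _ _, signed_mem _ _, signed_mem _ _, signed_mem _ _⟩)
    cls1344sp_mem (by norm_num) (by decide) (fun i => by cases i <;> decide)
    chi1344_eq checkGroup_1344sp

theorem nonempty_data_192aNs : Nonempty
    (CharacterTableData G192aNs (fun j => (⟨cls192aNs j, cls192aNs_mem j⟩ : G192aNs)) chi192a) :=
  ⟨(exists_characterTableData [γ, θ] (congrArg _ (by ext; simp))
    (by simpa using ⟨signed_mem _ _, signed_mem _ _⟩)
    cls192aNs_mem (by norm_num) (by decide) (fun i => by cases i <;> decide)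
    chi192a_eq checkGroup_192aNs).choose⟩

theorem nonempty_data_192aSp : Nonempty
    (CharacterTableData G192aSp (fun j => (⟨cls192aSp j, cls192aSp_mem j⟩ : G192aSp)) chi192a) :=
  ⟨(exists_characterTableData [At, Bt, N₁] (congrArg _ (by ext; simp))
    (by simpa using ⟨signed_mem _ _, signed_mem _ _, signed_mem _ _⟩)
    cls192aSp_mem (by norm_num) (by decide) (fun i => by cases i <;> decide)
    chi192a_eq checkGroup_192aSp).choose⟩

theorem nonempty_data_192bNs : Nonempty
    (CharacterTableData G192bNs (fun j => (⟨cls192bNs j, cls192bNs_mem j⟩ : G192bNs)) chi192b) :=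
  ⟨(exists_characterTableData [A, B] (congrArg _ (by ext; simp))
    (by simpa using ⟨signed_mem _ _, signed_mem _ _⟩)
    cls192bNs_mem (by norm_num) (by decide) (fun i => by cases i <;> decide)
    chi192b_eq checkGroup_192bNs).choose⟩

theorem nonempty_data_192bSp : Nonempty
    (CharacterTableData G192bSp (fun j => (⟨cls192bSp j, cls192bSp_mem j⟩ : G192bSp)) chi192b) :=
  ⟨(exists_characterTableData [γt, θt, N₁] (congrArg _ (by ext; simp))
    (by simpa using ⟨signed_mem _ _, signed_mem _ _, signed_mem _ _⟩)
    cls192bSp_mem (by norm_num) (by decide) (fun i => by cases i <;> decide)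
    chi192b_eq checkGroup_192bSp).choose⟩

set_option maxRecDepth 100000 in
theorem checkTensor_168 : checkTensor 8 labels168 row168 tensor168 = true := by
  decide +kernel

set_option maxRecDepth 100000 in
theorem checkTensor_1344 : checkTensor 11 labels1344 row1344 tensor1344 = true := by
  decide +kernel

set_option maxRecDepth 100000 in
theorem checkTensor_192a : checkTensor 14 labels192a row192a tensor192a = true := by
  decide +kernel

set_option maxRecDepth 100000 in
theorem checkTensor_192b : checkTensor 13 labels192b row192b tensor192b = true := by
  decide +kernel

set_option maxRecDepth 100000 in
theorem checkBranching_br1344To168 :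
    checkBranching 8 labels1344 row1344 row168 br1344To168 classes168To1344 = true := by
  decide +kernel

set_option maxRecDepth 100000 in
theorem checkBranching_br1344ToPSL :
    checkBranching 6 labels1344 row1344 rowPSL br1344ToPSL classesPSLirrTo1344 = true := by
  decide +kernel

set_option maxRecDepth 100000 in
theorem checkBranching_br1344ToPSL' :
    checkBranching 6 labels1344 row1344 rowPSL br1344ToPSL' classesPSLTo1344 = true := by
  decide +kernel

set_option maxRecDepth 100000 in
theorem checkBranching_br168To21 :
    checkBranching 5 labels168 row168 row21 br168To21 classes21To168 = true := by
  decide +kernel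

set_option maxRecDepth 100000 in
theorem checkBranching_brPSLTo21 :
    checkBranching 5 labelsPSL rowPSL row21 brPSLTo21 classes21ToPSL = true := by
  decide +kernel

theorem tensorRule_168 : TensorRule.{u} G168 cls168 chi168 tensor168 := by
  obtain ⟨D, -⟩ := exists_data_168
  exact tensorRule_of_data D _ (mul_eq_sum_of_checkTensor (fun i => by cases i <;> decide)
    chi168_eq checkTensor_168)

theorem tensorRule_1344ns : TensorRule.{u} G1344ns cls1344ns chi1344 tensor1344 := by
  obtain ⟨D, -⟩ := exists_data_1344ns
  exact tensorRule_of_data D _ (mul_eq_sum_of_checkTensor (fun i => by cases i <;> decide)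
    chi1344_eq checkTensor_1344)

theorem tensorRule_1344sp : TensorRule.{u} G1344sp cls1344sp chi1344 tensor1344 := by
  obtain ⟨D, -⟩ := exists_data_1344sp
  exact tensorRule_of_data D _ (mul_eq_sum_of_checkTensor (fun i => by cases i <;> decide)
    chi1344_eq checkTensor_1344)

theorem tensorRule_192aNs : TensorRule.{u} G192aNs cls192aNs chi192a tensor192a := by
  obtain ⟨D⟩ := nonempty_data_192aNs
  exact tensorRule_of_data D _ (mul_eq_sum_of_checkTensor (fun i => by cases i <;> decide)
    chi192a_eq checkTensor_192a)

theorem tensorRule_192aSp : TensorRule.{u} G192aSp cls192aSp chi192a tensor192a := by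
  obtain ⟨D⟩ := nonempty_data_192aSp
  exact tensorRule_of_data D _ (mul_eq_sum_of_checkTensor (fun i => by cases i <;> decide)
    chi192a_eq checkTensor_192a)

theorem tensorRule_192bNs : TensorRule.{u} G192bNs cls192bNs chi192b tensor192b := by
  obtain ⟨D⟩ := nonempty_data_192bNs
  exact tensorRule_of_data D _ (mul_eq_sum_of_checkTensor (fun i => by cases i <;> decide)
    chi192b_eq checkTensor_192b)

theorem tensorRule_192bSp : TensorRule.{u} G192bSp cls192bSp chi192b tensor192b := by
  obtain ⟨D⟩ := nonempty_data_192bSp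
  exact tensorRule_of_data D _ (mul_eq_sum_of_checkTensor (fun i => by cases i <;> decide)
    chi192b_eq checkTensor_192b)

theorem branchingRule_1344ns_168 :
    BranchingRule.{u} G1344ns G168 cls1344ns chi1344 cls168 chi168 br1344To168 := by
  obtain ⟨D, hD⟩ := exists_data_1344ns
  obtain ⟨D', -⟩ := exists_data_168
  exact branchingRule_of_data D D' G168_le_G1344ns _ fun i j => eq_sum_of_checkBranching
    (fun i => by cases i <;> decide) chi1344_eq chi168_eq checkBranching_br1344To168 i j
    (hD _ _ (mem_ofFn_classes _ _ j))

theorem branchingRule_1344sp_168 :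
    BranchingRule.{u} G1344sp G168 cls1344sp chi1344 cls168 chi168 br1344To168 := by
  obtain ⟨D, hD⟩ := exists_data_1344sp
  obtain ⟨D', -⟩ := exists_data_168
  exact branchingRule_of_data D D' G168_le_G1344sp _ fun i j => eq_sum_of_checkBranching
    (fun i => by cases i <;> decide) chi1344_eq chi168_eq checkBranching_br1344To168 i j
    (hD _ _ (by simp only [List.mem_append, mem_ofFn_classes, true_or]))

theorem branchingRule_1344sp_PSLirr :
    BranchingRule.{u} G1344sp GPSLirr cls1344sp chi1344 clsPSLirr chiPSL br1344ToPSL := by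
  obtain ⟨D, hD⟩ := exists_data_1344sp
  obtain ⟨D'⟩ := nonempty_data_PSLirr
  exact branchingRule_of_data D D' GPSLirr_le_G1344sp _ fun i j => eq_sum_of_checkBranching
    (fun i => by cases i <;> decide) chi1344_eq chiPSL_eq checkBranching_br1344ToPSL i j
    (hD _ _ (by simp only [List.mem_append, mem_ofFn_classes, or_true]))

theorem branchingRule_1344sp_PSL :
    BranchingRule.{u} G1344sp GPSL cls1344sp chi1344 clsPSL chiPSL br1344ToPSL' := by
  obtain ⟨D, hD⟩ := exists_data_1344sp
  obtain ⟨D', -⟩ := exists_data_PSL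
  exact branchingRule_of_data D D' GPSL_le_G1344sp _ fun i j => eq_sum_of_checkBranching
    (fun i => by cases i <;> decide) chi1344_eq chiPSL_eq checkBranching_br1344ToPSL' i j
    (hD _ _ (by simp only [List.mem_append, mem_ofFn_classes, true_or, or_true]))

theorem branchingRule_168_21 :
    BranchingRule.{u} G168 G21 cls168 chi168 cls21 chi21 br168To21 := by
  obtain ⟨D, hD⟩ := exists_data_168
  obtain ⟨D'⟩ := nonempty_data_21
  exact branchingRule_of_data D D' G21_le_G168 _ fun i j => eq_sum_of_checkBranching
    (fun i => by cases i <;> decide) chi168_eq chi21_eq checkBranching_br168To21 i j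
    (hD _ _ (mem_ofFn_classes _ _ j))

theorem branchingRule_PSL_21 :
    BranchingRule.{u} GPSL G21 clsPSL chiPSL cls21 chi21 brPSLTo21 := by
  obtain ⟨D, hD⟩ := exists_data_PSL
  obtain ⟨D'⟩ := nonempty_data_21
  exact branchingRule_of_data D D' G21_le_GPSL _ fun i j => eq_sum_of_checkBranching
    (fun i => by cases i <;> decide) chiPSL_eq chi21_eq checkBranching_brPSLTo21 i j
    (hD _ _ (mem_ofFn_classes _ _ j))

/-! ### Homomorphisms from `SL₂` by the Bruhat decomposition -/

/-- Elements of a group `Γ` that correspond to the matrices `!![1, x; 0, 1]`, `!![a, 0; 0, a⁻¹]` and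
`!![0, -1; 1, 0]` under a homomorphism from `SL₂` of the field `F` that is trivial on `-1`. -/
structure BruhatData (F Γ : Type*) [Field F] [Group Γ] where
  U : F → Γ
  H : F → Γ
  w : Γ
  U_add : ∀ x y, U (x + y) = U x * U y
  H_mul : ∀ a b, a ≠ 0 → b ≠ 0 → H (a * b) = H a * H b
  H_neg_one : H (-1) = 1
  H_mul_U : ∀ a x, a ≠ 0 → H a * U x = U (a * a * x) * H a
  w_mul_w : w * w = 1
  w_mul_H : ∀ a, a ≠ 0 → w * H a = H a⁻¹ * w
  w_mul_U_mul_w : ∀ x, x ≠ 0 → w * U x * w = U (-x⁻¹) * w * H x * U (-x⁻¹)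

namespace BruhatData

variable {F Γ : Type*} [Field F] [Group Γ] (D : BruhatData F Γ)

theorem U_zero : D.U 0 = 1 := by
  have := D.U_add 0 0
  simpa using this

theorem H_one : D.H 1 = 1 := by
  have := D.H_mul 1 1 one_ne_zero one_ne_zero
  simpa using this

variable [DecidableEq F]

/-- The element that corresponds to the matrix `!![a, b; c, d]` of determinant `1`. -/
def val (a b c d : F) : Γ :=
  if c = 0 then D.U (a * b) * D.H a else D.U (a / c) * D.w * D.H c * D.U (d / c)

/-- Left multiplication by `!![1, x; 0, 1]`. -/
theorem U_mul_val (x a b c d : F) (h : a * d - b * c = 1) :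
    D.val (a + x * c) (b + x * d) c d = D.U x * D.val a b c d := by
  by_cases hc : c = 0
  · subst hc
    simp only [val, if_pos, mul_zero, add_zero, ← mul_assoc, ← D.U_add]
    congr 2
    linear_combination x * h
  · simp only [val, if_neg hc, ← mul_assoc, ← D.U_add]
    congr 4
    field_simp
    ring

/-- Left multiplication by `!![e, 0; 0, e⁻¹]`. -/
theorem H_mul_val (e a b c d : F) (he : e ≠ 0) (h : a * d - b * c = 1) :
    D.val (e * a) (e * b) (e⁻¹ * c) (e⁻¹ * d) = D.H e * D.val a b c d := by
  by_cases hc : c = 0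
  · subst hc
    have ha : a ≠ 0 := by rintro rfl; simp at h
    simp only [val, if_pos, mul_zero, ← mul_assoc, D.H_mul_U _ _ he]
    rw [mul_assoc (D.U _) (D.H e), ← D.H_mul _ _ he ha]
    congr 2
    ring
  · have hc' : e⁻¹ * c ≠ 0 := mul_ne_zero (inv_ne_zero he) hc
    have hw : D.w * D.H e⁻¹ = D.H e * D.w := by rw [D.w_mul_H _ (inv_ne_zero he), inv_inv]
    simp only [val, if_neg hc, if_neg hc', ← mul_assoc, D.H_mul_U _ _ he]
    rw [show e * a / (e⁻¹ * c) = e * e * (a / c) by field_simp,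
      show e⁻¹ * d / (e⁻¹ * c) = d / c by field_simp, D.H_mul _ _ (inv_ne_zero he) hc,
      ← mul_assoc, mul_assoc _ D.w, hw, ← mul_assoc]

/-- Left multiplication by `!![0, -1; 1, 0]`. -/
theorem w_mul_val (a b c d : F) (h : a * d - b * c = 1) :
    D.val (-c) (-d) a b = D.w * D.val a b c d := by
  by_cases ha : a = 0
  · subst ha
    have hc : c ≠ 0 := by rintro rfl; simp at h
    simp only [val, if_neg hc, if_pos, zero_div, D.U_zero, one_mul, ← mul_assoc, D.w_mul_w]
    rw [D.H_mul_U _ _ hc, ← neg_one_mul c, D.H_mul _ _ (by simp) hc, D.H_neg_one, one_mul]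
    congr 2
    field_simp
  by_cases hc : c = 0
  · subst hc
    have hd : d = a⁻¹ := eq_inv_of_mul_eq_one_right (by linear_combination h)
    simp only [val, if_neg ha, if_pos, neg_zero, zero_div, D.U_zero, one_mul]
    rw [mul_assoc, D.H_mul_U _ _ ha]
    congr 3
    field_simp
  · have hac : a / c ≠ 0 := div_ne_zero ha hc
    have hU : D.U (-(a / c)⁻¹) * D.H c = D.H c * D.U (-(a * c)⁻¹) := by
      rw [D.H_mul_U _ _ hc]
      congr 2
      field_simp
    have hH : D.H (a / c) * D.H c = D.H a := by
      rw [← D.H_mul _ _ hac hc, div_mul_cancel₀ _ hc]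
    simp only [val, if_neg ha, if_neg hc, ← mul_assoc, D.w_mul_U_mul_w _ hac]
    rw [mul_assoc _ (D.U _) (D.H c), hU, ← mul_assoc, mul_assoc _ (D.H _) (D.H c), hH,
      mul_assoc _ (D.U _) (D.U _), ← D.U_add]
    congr 2
    · congr 3
      field_simp
    · field_simp
      linear_combination -h

/-- Every matrix is a product of the three types treated in the preceding lemmas. -/
theorem val_mul (a b c d p q r s : F) (h : a * d - b * c = 1) (h' : p * s - q * r = 1) :
    D.val (a * p + b * r) (a * q + b * s) (c * p + d * r) (c * q + d * s) =
      D.val a b c d * D.val p q r s := by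
  by_cases hc : c = 0
  · subst hc
    have ha : a ≠ 0 := by rintro rfl; simp at h
    have hd : d = a⁻¹ := eq_inv_of_mul_eq_one_right (by linear_combination h)
    have h1 : D.val a b 0 d = D.U (a * b) * D.H a := if_pos rfl
    rw [h1, mul_assoc, ← D.H_mul_val a p q r s ha h', ← D.U_mul_val, hd]
    · congr 1 <;> field_simp <;> ring
    · field_simp
      linear_combination h'
  · have h1 : D.val a b c d = D.U (a / c) * D.w * D.H c * D.U (d / c) := if_neg hc
    have h2 : (p + d / c * r) * s - (q + d / c * s) * r = 1 := by linear_combination h'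
    have h3 : c * (p + d / c * r) * (c⁻¹ * s) - c * (q + d / c * s) * (c⁻¹ * r) = 1 := by
      field_simp
      field_simp at h2
      linear_combination h2
    rw [h1, mul_assoc, ← D.U_mul_val (d / c) p q r s h', mul_assoc,
      ← D.H_mul_val c _ _ _ _ hc h2, mul_assoc, ← D.w_mul_val _ _ _ _ h3, ← D.U_mul_val]
    · congr 1 <;> field_simp
      · linear_combination -r * h
      · linear_combination -s * h
    · linear_combination h3

/-- The homomorphism from `SL₂` determined by `D`. -/
def hom : Matrix.SpecialLinearGroup (Fin 2) F →* Γ :=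
  MonoidHom.mk' (fun M => D.val (M 0 0) (M 0 1) (M 1 0) (M 1 1)) fun M N => by
    have hM := M.det_coe
    have hN := N.det_coe
    rw [Matrix.det_fin_two] at hM hN
    simp only [Matrix.SpecialLinearGroup.coe_mul, Matrix.mul_apply, Fin.sum_univ_two]
    exact D.val_mul _ _ _ _ _ _ _ _ hM hN

theorem hom_apply (M : Matrix.SpecialLinearGroup (Fin 2) F) :
    D.hom M = D.val (M 0 0) (M 0 1) (M 1 0) (M 1 1) := rfl

theorem val_mem_range (a b c d : F) (h : a * d - b * c = 1) : D.val a b c d ∈ D.hom.range :=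
  ⟨⟨!![a, b; c, d], by rw [Matrix.det_fin_two_of, h]⟩, rfl⟩

theorem U_mem_range (x : F) : D.U x ∈ D.hom.range := by
  have := D.val_mem_range 1 x 0 1 (by simp)
  simpa [val, D.H_one] using this

theorem H_mem_range (a : F) (ha : a ≠ 0) : D.H a ∈ D.hom.range := by
  have := D.val_mem_range a 0 0 a⁻¹ (by simp [ha])
  simpa [val, D.U_zero] using this

theorem w_mem_range : D.w ∈ D.hom.range := by
  have := D.val_mem_range 0 (-1) 1 0 (by simp)
  simpa [val, D.U_zero, D.H_one] using this

theorem range_le {K : Subgroup Γ} (hU : ∀ x, D.U x ∈ K) (hH : ∀ a, D.H a ∈ K) (hw : D.w ∈ K) :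
    D.hom.range ≤ K := by
  rintro _ ⟨M, rfl⟩
  rw [hom_apply, val]
  split_ifs
  · exact mul_mem (hU _) (hH _)
  · exact mul_mem (mul_mem (mul_mem (hU _) hw) (hH _)) (hU _)

/-- If `w` does not lie in the image of the upper triangular matrices, and only `± 1` among these
become trivial, then the kernel is the centre. -/
theorem ker_eq_center (hw : ∀ x a, D.w ≠ D.U x * D.H a)
    (h1 : ∀ x a, a ≠ 0 → D.U x * D.H a = 1 → x = 0 ∧ a * a = 1) :
    D.hom.ker = Subgroup.center (Matrix.SpecialLinearGroup (Fin 2) F) := by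
  ext M
  have hM := M.det_coe
  rw [Matrix.det_fin_two] at hM
  rw [MonoidHom.mem_ker, Matrix.SpecialLinearGroup.mem_center_iff, hom_apply]
  constructor
  · intro h
    by_cases hc : M 1 0 = 0
    · have ha : M 0 0 ≠ 0 := by
        intro ha
        rw [ha, hc] at hM
        simp at hM
      rw [val, if_pos hc] at h
      obtain ⟨hb, haa⟩ := h1 _ _ ha h
      have hb := (mul_eq_zero.1 hb).resolve_left ha
      rw [hc, hb] at hM
      have hd : M 1 1 = M 0 0 := by
        have : M 0 0 * (M 1 1 - M 0 0) = 0 := by linear_combination hM - haa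
        exact sub_eq_zero.1 ((mul_eq_zero.1 this).resolve_left ha)
      refine ⟨M 0 0, by simpa [pow_two] using haa, ?_⟩
      ext i j
      fin_cases i <;> fin_cases j <;> simp [hb, hc, hd]
    · rw [val, if_neg hc] at h
      have hH : D.H (M 1 0)⁻¹ = (D.H (M 1 0))⁻¹ := by
        rw [eq_inv_iff_mul_eq_one, ← D.H_mul _ _ (inv_ne_zero hc) hc, inv_mul_cancel₀ hc, D.H_one]
      have hU : ∀ x, D.U (-x) = (D.U x)⁻¹ := fun x => by
        rw [eq_inv_iff_mul_eq_one, ← D.U_add, neg_add_cancel, D.U_zero]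
      refine absurd ?_ (hw (-(M 0 0 / M 1 0) + -(M 1 1 / M 1 0)) (M 1 0)⁻¹)
      rw [D.U_add, hU, hU, hH]
      calc D.w = (D.U (M 0 0 / M 1 0))⁻¹ * (D.U (M 0 0 / M 1 0) * D.w * D.H (M 1 0) *
            D.U (M 1 1 / M 1 0)) * (D.U (M 1 1 / M 1 0))⁻¹ * (D.H (M 1 0))⁻¹ := by group
        _ = _ := by rw [h, mul_one]
  · rintro ⟨r, hr, h⟩
    have h00 := congrFun (congrFun h 0) 0
    have h01 := congrFun (congrFun h 0) 1
    have h10 := congrFun (congrFun h 1) 0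
    have h11 := congrFun (congrFun h 1) 1
    simp only [Matrix.scalar_apply, Matrix.diagonal_apply_eq, ne_eq, one_ne_zero, zero_ne_one,
      not_false_eq_true, Matrix.diagonal_apply_ne] at h00 h01 h10 h11
    rw [← h00, ← h01, ← h10, ← h11, val, if_pos rfl, mul_zero, D.U_zero, one_mul]
    rw [Fintype.card_fin, pow_two, mul_self_eq_one_iff] at hr
    rcases hr with rfl | rfl
    · exact D.H_one
    · exact D.H_neg_one

end BruhatData

/-! ### The two copies of `PSL₂(7)` -/

instance : Fact (Nat.Prime 7) := ⟨by norm_num⟩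

/-- The image of the diagonal matrix with entries `a`, `a⁻¹`: the powers of `β`, which
corresponds to `a = 3`, a generator of the multiplicative group. -/
def torus : ZMod 7 → SPerm := ![1, 1, β ^ 2, β, β, β ^ 2, 1]

theorem α_mem_signedPerms : α ∈ signedPerms := signed_mem _ _

theorem torus_mem {K : Subgroup SPerm} (h : β ∈ K) (a : ZMod 7) : torus a ∈ K := by
  revert a
  change ∀ a : Fin 7, _
  intro a
  fin_cases a <;> simp [torus, pow_mem, h]

/-- The data for a homomorphism from `SL₂(7)`, from an element `w` with suitable relations. -/
def bruhatData (w : SPerm) (hw : w ∈ signedPerms) (h1 : code (w * w) = code 1)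
    (h2 : ∀ a : ZMod 7, a ≠ 0 → code (w * torus a) = code (torus a⁻¹ * w))
    (h3 : ∀ x : ZMod 7, x ≠ 0 → code (w * α ^ x.val * w) =
      code (α ^ (-x⁻¹).val * w * torus x * α ^ (-x⁻¹).val)) :
    BruhatData (ZMod 7) SPerm :=
  have hU (n : ℕ) : α ^ n ∈ signedPerms := pow_mem α_mem_signedPerms n
  have hH (a : ZMod 7) : torus a ∈ signedPerms := torus_mem (signed_mem _ _) a
  { U := fun x => α ^ x.val
    H := torus
    w := w
    U_add := fun x y => code_injective (hU _) (mul_mem (hU _) (hU _)) (by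
      revert x y; decide +kernel)
    H_mul := fun a b ha hb => code_injective (hH _) (mul_mem (hH _) (hH _)) (by
      revert a b; decide +kernel)
    H_neg_one := rfl
    H_mul_U := fun a x ha => code_injective (mul_mem (hH _) (hU _)) (mul_mem (hU _) (hH _)) (by
      revert a x; decide +kernel)
    w_mul_w := code_injective (mul_mem hw hw) (one_mem _) h1
    w_mul_H := fun a ha => code_injective (mul_mem hw (hH _)) (mul_mem (hH _) hw) (h2 a ha)
    w_mul_U_mul_w := fun x hx => code_injective (mul_mem (mul_mem hw (hU _)) hw)
      (mul_mem (mul_mem (mul_mem (hU _) hw) (hH _)) (hU _)) (h3 x hx) }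

theorem βt_eq : βt = α ^ (3 : ZMod 7).val * torus 2 :=
  code_injective (signed_mem _ _)
    (mul_mem (pow_mem α_mem_signedPerms _) (torus_mem (signed_mem _ _) _)) (by decide +kernel)

theorem eq_of_mul_torus_eq_one (x a : ZMod 7) (ha : a ≠ 0) (h : α ^ x.val * torus a = 1) :
    x = 0 ∧ a * a = 1 := by
  replace h := congrArg code h
  revert x a
  decide +kernel

/-- A group generated by `α`, `βt` and an element `s`, for which `w` satisfies the relations in
`BruhatData`, is isomorphic to `PSL₂(7)`: the homomorphism from `SL₂(7)` has this group as its image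
and the centre as its kernel. -/
theorem nonempty_equiv_PSL (s w : SPerm) (hs : s ∈ signedPerms) (hws : w = α * s * α * βt * s)
    (h1 : code (w * w) = code 1)
    (h2 : ∀ a : ZMod 7, a ≠ 0 → code (w * torus a) = code (torus a⁻¹ * w))
    (h3 : ∀ x : ZMod 7, x ≠ 0 → code (w * α ^ x.val * w) =
      code (α ^ (-x⁻¹).val * w * torus x * α ^ (-x⁻¹).val))
    (h4 : ∀ x a : ZMod 7, code w ≠ code (α ^ x.val * torus a))
    (h5 : code s = code (α ^ (2 : ZMod 7).val * w * torus 2 * α ^ (5 : ZMod 7).val)) :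
    Nonempty (Subgroup.closure {α, βt, s} ≃*
      Matrix.ProjectiveSpecialLinearGroup (Fin 2) (ZMod 7)) := by
  have hα : α ∈ Subgroup.closure {α, βt, s} := Subgroup.subset_closure (by simp)
  have hβt : βt ∈ Subgroup.closure {α, βt, s} := Subgroup.subset_closure (by simp)
  have hs' : s ∈ Subgroup.closure {α, βt, s} := Subgroup.subset_closure (by simp)
  have hw : w ∈ signedPerms := by
    rw [hws]
    exact mul_mem (mul_mem (mul_mem (mul_mem α_mem_signedPerms hs) α_mem_signedPerms)
      (signed_mem _ _)) hs
  have hβ : β ∈ Subgroup.closure {α, βt, s} := by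
    rw [β_eq]
    exact mul_mem (mul_mem (mul_mem hβt hα) hβt) hα
  let D := bruhatData w hw h1 h2 h3
  have hrange : D.hom.range = Subgroup.closure {α, βt, s} := by
    refine le_antisymm (D.range_le (fun x => pow_mem hα _) (torus_mem hβ) ?_) ?_
    · change w ∈ _
      rw [hws]
      exact mul_mem (mul_mem (mul_mem (mul_mem hα hs') hα) hβt) hs'
    · rw [Subgroup.closure_le]
      rintro _ (rfl | rfl | rfl)
      · exact pow_one α ▸ D.U_mem_range 1
      · rw [βt_eq]
        exact mul_mem (D.U_mem_range 3) (D.H_mem_range 2 (by decide))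
      · rw [SetLike.mem_coe, code_injective hs (mul_mem (mul_mem (mul_mem
          (pow_mem α_mem_signedPerms _) hw) (torus_mem (signed_mem _ _) _))
          (pow_mem α_mem_signedPerms _)) h5]
        exact mul_mem (mul_mem (mul_mem (D.U_mem_range 2) D.w_mem_range)
          (D.H_mem_range 2 (by decide))) (D.U_mem_range 5)
  have hker := D.ker_eq_center (fun x a h => h4 x a (congrArg code h)) eq_of_mul_torus_eq_one
  exact ⟨((QuotientGroup.quotientMulEquivOfEq hker.symm).trans
    ((QuotientGroup.quotientKerEquivRange D.hom).trans (MulEquiv.subgroupCongr hrange))).symm⟩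

theorem nonempty_GPSL_equiv :
    Nonempty (GPSL ≃* Matrix.ProjectiveSpecialLinearGroup (Fin 2) (ZMod 7)) :=
  nonempty_equiv_PSL γt _ (signed_mem _ _) rfl (by decide +kernel) (by decide +kernel)
    (by decide +kernel) (by decide +kernel) (by decide +kernel)

theorem nonempty_GPSLirr_equiv :
    Nonempty (GPSLirr ≃* Matrix.ProjectiveSpecialLinearGroup (Fin 2) (ZMod 7)) :=
  nonempty_equiv_PSL δ _ (signed_mem _ _) rfl (by decide +kernel) (by decide +kernel)
    (by decide +kernel) (by decide +kernel) (by decide +kernel)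

end OctGroups

end

theorem mainTheorem8 :
    -- tensor products
    TensorRule.{u} G168 cls168 chi168 tensor168 ∧
    TensorRule.{u} G1344ns cls1344ns chi1344 tensor1344 ∧
    TensorRule.{u} G1344sp cls1344sp chi1344 tensor1344 ∧
    TensorRule.{u} G192aNs cls192aNs chi192a tensor192a ∧
    TensorRule.{u} G192aSp cls192aSp chi192a tensor192a ∧
    TensorRule.{u} G192bNs cls192bNs chi192b tensor192b ∧
    TensorRule.{u} G192bSp cls192bSp chi192b tensor192b ∧
    -- restrictions
    BranchingRule.{u} G1344ns G168 cls1344ns chi1344 cls168 chi168 br1344To168 ∧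
    BranchingRule.{u} G1344sp G168 cls1344sp chi1344 cls168 chi168 br1344To168 ∧
    Nonempty (GPSLirr ≃* Matrix.ProjectiveSpecialLinearGroup (Fin 2) (ZMod 7)) ∧
    BranchingRule.{u} G1344sp GPSLirr cls1344sp chi1344 clsPSLirr chiPSL br1344ToPSL ∧
    Nonempty (GPSL ≃* Matrix.ProjectiveSpecialLinearGroup (Fin 2) (ZMod 7)) ∧
    BranchingRule.{u} G1344sp GPSL cls1344sp chi1344 clsPSL chiPSL br1344ToPSL' ∧
    BranchingRule.{u} G168 G21 cls168 chi168 cls21 chi21 br168To21 ∧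
    BranchingRule.{u} GPSL G21 clsPSL chiPSL cls21 chi21 brPSLTo21 :=
  ⟨tensorRule_168, tensorRule_1344ns, tensorRule_1344sp, tensorRule_192aNs, tensorRule_192aSp,
    tensorRule_192bNs, tensorRule_192bSp, branchingRule_1344ns_168, branchingRule_1344sp_168,
    nonempty_GPSLirr_equiv, branchingRule_1344sp_PSLirr, nonempty_GPSL_equiv,
    branchingRule_1344sp_PSL, branchingRule_168_21, branchingRule_PSL_21⟩
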